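/- Let $U$ be a set of $n\ge 1$ users with a strict partial order $<$, and let $S$ be a set of $k\ge 1$ steps. An instance of $\mathrm{WSP}(=,\neq,<)$ consists of $(U,<)$, a set $L(s)\subseteq U$ of authorized users for each step $s\in S$, and a set $C$ of constraints $(\rho,s',s'')$ with $\rho\in\{=,\neq,<\}$ and $s',s''\in S$. It is a Yes-instance if there is a plan $\pi:S\to U$ with $\pi(s)\in L(s)$ for all $s\in S$ and $\pi(s')\,\rho\,\pi(s'')$ for all $(\rho,s',s'')\in C$. The reduced graph (Hasse diagram) $D$ of $(U,<)$ is the directed graph on $U$ whose transitive closure is $<$ and which loses this property when any arc is deleted. A tree decomposition of $D$ consists of a tree and a bag $B_i\subseteq U$ for each node $i$ of the tree, such that every user is in some bag, the two end-points of every arc of $D$ are together in some bag, and for each user $u$ the nodes $i$ with $u\in B_i$ induce a connected subtree; its width is $\max_i|B_i|-1$. Theorem. There is an algorithm that, given an instance of $\mathrm{WSP}(=,\neq,<)$ with $n$ users and $k$ steps together with a tree decomposition of the reduced graph $D$ of $(U,<)$ of width $r$ and with $O(n)$ nodes, decides whether the instance is a Yes-instance in time $$O\!\left(n\,k\,4^k\,(r+2+3^{r+1})^k\right).$$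 Precisely: there is a single program such that for every $c$ there is a constant $C$, depending only on $c$, such that whenever the decomposition has at most $cn$ nodes the program halts with the correct answer after at most $C\,n\,k\,4^k(r+2+3^{r+1})^k$ steps. Time is measured on a random access machine with addition and truncated subtraction at unit cost. The input is given in read-only arrays with unit-cost access: 0-1 tables for authorization, for the constraints and for the order $<$, the list of edges of the tree, and a list of the elements of each bag. -/

import Mathlib

/-! ### The workflow satisfiability problem with constraints `=`, `≠`, `<` -/

/-- The three kinds of binary constraints. -/
inductive ConstraintKind : Type
  | eq
  | ne
  | lt

/-- An instance of `WSP(=, ≠, <)` with users `Fin n` and steps `Fin k`. The strict partial order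
`lt` on the users has nothing to do with the numbering of the users. -/
structure WSPInstance (n k : ℕ) where
  /-- the partial order `<` on the users -/
  lt : Fin n → Fin n → Prop
  lt_irrefl : ∀ u, ¬ lt u u
  lt_trans : ∀ u v w, lt u v → lt v w → lt u w
  /-- the users authorized for a step -/
  auth : Fin k → Set (Fin n)
  /-- the constraints `(ρ, s', s'')` -/
  constraints : Set (ConstraintKind × Fin k × Fin k)

namespace WSPInstance

variable {n k : ℕ}

/-- The binary relation on the users that a kind of constraint stands for. -/
def rel (I : WSPInstance n k) : ConstraintKind → Fin n → Fin n → Prop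
  | .eq => fun u v => u = v
  | .ne => fun u v => u ≠ v
  | .lt => I.lt

/-- A plan `π` is valid if it respects all authorizations and satisfies all constraints. -/
def IsValidPlan (I : WSPInstance n k) (π : Fin k → Fin n) : Prop :=
  (∀ s, π s ∈ I.auth s) ∧
    ∀ (ρ : ConstraintKind) (s s' : Fin k), (ρ, s, s') ∈ I.constraints → I.rel ρ (π s) (π s')

/-- `I` is a Yes-instance. -/
def IsYes (I : WSPInstance n k) : Prop :=
  ∃ π : Fin k → Fin n, I.IsValidPlan π

end WSPInstance

/-! ### Reduced graphs and tree decompositions -/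

/-- `D` is the reduced graph (Hasse diagram) of the strict order `lt`: the transitive closure of
`D` is (the full graph of) `lt`, and this fails as soon as any one arc is deleted from `D`. -/
structure IsReducedGraph {V : Type*} (D : Digraph V) (lt : V → V → Prop) : Prop where
  closure_eq : ∀ u v, Relation.TransGen D.Adj u v ↔ lt u v
  minimal : ∀ a b, D.Adj a b →
    ¬ ∀ u v, Relation.TransGen (fun x y => D.Adj x y ∧ ¬ (x = a ∧ y = b)) u v ↔ lt u v

/-- A tree decomposition of the digraph `D`, the nodes of the tree being the elements of `ι`. -/
structure TreeDecomposition {V : Type*} (D : Digraph V) (ι : Type*) where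
  tree : SimpleGraph ι
  isTree : tree.IsTree
  bag : ι → Finset V
  exists_mem_bag : ∀ v, ∃ i, v ∈ bag i
  exists_arc_bag : ∀ u v, D.Adj u v → ∃ i, u ∈ bag i ∧ v ∈ bag i
  connected : ∀ v, (tree.induce {i | v ∈ bag i}).Connected

namespace TreeDecomposition

variable {V : Type*} {D : Digraph V} {ι : Type*}

/-- The width: the largest size of a bag, minus one. -/
def width [Fintype ι] (X : TreeDecomposition D ι) : ℕ :=
  (Finset.univ.sup fun i => (X.bag i).card) - 1

/-- A listing of a tree decomposition, as given to an algorithm: the edges of the tree, each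
once, in any order and with the end-points in any order, and the elements of each bag, each once,
in any order. -/
structure Listing (X : TreeDecomposition D ι) where
  edges : List (ι × ι)
  edges_nodup : (edges.map fun e => s(e.1, e.2)).Nodup
  mem_edges : ∀ i j, s(i, j) ∈ (edges.map fun e => s(e.1, e.2)) ↔ X.tree.Adj i j
  elems : ι → List V
  elems_nodup : ∀ i, (elems i).Nodup
  mem_elems : ∀ i v, v ∈ elems i ↔ v ∈ X.bag i

end TreeDecomposition

/-! ### Random access machine programs with unit cost

Registers and memory cells hold natural numbers. The only arithmetic operations are addition and
truncated subtraction. Programs are structured (sequence, conditional, loop). The input is a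
family of read-only two-dimensional arrays. -/

namespace RAM

/-- The input: `inp t i j` is the entry `(i, j)` of the array number `t`. -/
abbrev Input : Type := ℕ → ℕ → ℕ → ℕ

/-- Expressions: constants, registers, indirect access to the memory, access to the input,
addition and truncated subtraction. -/
inductive Expr : Type
  | const (c : ℕ)
  | reg (x : ℕ)
  | mem (a : Expr)
  | input (t : ℕ) (i j : Expr)
  | add (a b : Expr)
  | sub (a b : Expr)

/-- A configuration: contents of the registers and of the memory. -/
structure State : Type where
  reg : ℕ → ℕ
  mem : ℕ → ℕ

/-- At the start all registers and memory cells are zero. -/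
def State.start : State := ⟨fun _ => 0, fun _ => 0⟩

/-- The value of an expression. -/
def Expr.eval (inp : Input) (σ : State) : Expr → ℕ
  | .const c => c
  | .reg x => σ.reg x
  | .mem a => σ.mem (a.eval inp σ)
  | .input t i j => inp t (i.eval inp σ) (j.eval inp σ)
  | .add a b => a.eval inp σ + b.eval inp σ
  | .sub a b => a.eval inp σ - b.eval inp σ

/-- The time for evaluating an expression: one unit for each node. -/
def Expr.cost : Expr → ℕ
  | .const _ => 1
  | .reg _ => 1
  | .mem a => a.cost + 1
  | .input _ i j => i.cost + j.cost + 1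
  | .add a b => a.cost + b.cost + 1
  | .sub a b => a.cost + b.cost + 1

/-- Programs. `cond e p q` runs `p` if `e` is nonzero and `q` if `e` is zero; `loop e p` repeats
`p` as long as `e` is nonzero. -/
inductive Program : Type
  | skip
  | assign (x : ℕ) (e : Expr)
  | store (a e : Expr)
  | seq (p q : Program)
  | cond (e : Expr) (p q : Program)
  | loop (e : Expr) (p : Program)

/-- `Runs inp p σ t τ`: on the input `inp`, the program `p`, started in `σ`, halts in `τ` after
`t` units of time. -/
inductive Runs (inp : Input) : Program → State → ℕ → State → Prop
  | skip (σ : State) : Runs inp .skip σ 1 σ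
  | assign (x : ℕ) (e : Expr) (σ : State) :
      Runs inp (.assign x e) σ (e.cost + 1)
        { σ with reg := Function.update σ.reg x (e.eval inp σ) }
  | store (a e : Expr) (σ : State) :
      Runs inp (.store a e) σ (a.cost + e.cost + 1)
        { σ with mem := Function.update σ.mem (a.eval inp σ) (e.eval inp σ) }
  | seq {p q : Program} {σ τ υ : State} {t t' : ℕ} :
      Runs inp p σ t τ → Runs inp q τ t' υ → Runs inp (.seq p q) σ (t + t') υ
  | cond_pos {e : Expr} {p q : Program} {σ τ : State} {t : ℕ} :
      e.eval inp σ ≠ 0 → Runs inp p σ t τ → Runs inp (.cond e p q) σ (e.cost + 1 + t) τ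
  | cond_zero {e : Expr} {p q : Program} {σ τ : State} {t : ℕ} :
      e.eval inp σ = 0 → Runs inp q σ t τ → Runs inp (.cond e p q) σ (e.cost + 1 + t) τ
  | loop_zero {e : Expr} {p : Program} {σ : State} :
      e.eval inp σ = 0 → Runs inp (.loop e p) σ (e.cost + 1) σ
  | loop_pos {e : Expr} {p : Program} {σ τ υ : State} {t t' : ℕ} :
      e.eval inp σ ≠ 0 → Runs inp p σ t τ → Runs inp (.loop e p) τ t' υ →
        Runs inp (.loop e p) σ (e.cost + 1 + t + t') υ

/-- Programs are deterministic: the final state and the running time are unique. -/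
theorem Runs.unique {inp : Input} {p : Program} {σ τ : State} {t : ℕ} (h : Runs inp p σ t τ) :
    ∀ {t' : ℕ} {τ' : State}, Runs inp p σ t' τ' → t = t' ∧ τ = τ' := by
  induction h with
  | skip σ => intro t' τ' h'; cases h'; exact ⟨rfl, rfl⟩
  | assign x e σ => intro t' τ' h'; cases h'; exact ⟨rfl, rfl⟩
  | store a e σ => intro t' τ' h'; cases h'; exact ⟨rfl, rfl⟩
  | seq _ _ ih₁ ih₂ =>
    intro t' τ' h'
    cases h' with
    | seq a b =>
      obtain ⟨rfl, rfl⟩ := ih₁ a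
      obtain ⟨rfl, rfl⟩ := ih₂ b
      exact ⟨rfl, rfl⟩
  | cond_pos he _ ih =>
    intro t' τ' h'
    cases h' with
    | cond_pos _ a => obtain ⟨rfl, rfl⟩ := ih a; exact ⟨rfl, rfl⟩
    | cond_zero he' _ => exact absurd he' he
  | cond_zero he _ ih =>
    intro t' τ' h'
    cases h' with
    | cond_pos he' _ => exact absurd he he'
    | cond_zero _ a => obtain ⟨rfl, rfl⟩ := ih a; exact ⟨rfl, rfl⟩
  | loop_zero he =>
    intro t' τ' h'
    cases h' with
    | loop_zero _ => exact ⟨rfl, rfl⟩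
    | loop_pos he' _ _ => exact absurd he he'
  | loop_pos he _ _ ih₁ ih₂ =>
    intro t' τ' h'
    cases h' with
    | loop_zero he' => exact absurd he' he
    | loop_pos _ a b =>
      obtain ⟨rfl, rfl⟩ := ih₁ a
      obtain ⟨rfl, rfl⟩ := ih₂ b
      exact ⟨rfl, rfl⟩

end RAM

/-! ### The input of the algorithm -/

/-- The array given by a list of rows, padded with zeros. -/
def listArray (rows : List (List ℕ)) (i j : ℕ) : ℕ :=
  (rows.getD i []).getD j 0

open Classical in
/-- The `0`-`1`-matrix of a relation, padded with zeros. -/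
noncomputable def relArray {a b : ℕ} (R : Fin a → Fin b → Prop) (i j : ℕ) : ℕ :=
  if ∃ (hi : i < a) (hj : j < b), R ⟨i, hi⟩ ⟨j, hj⟩ then 1 else 0

/-- The input for an instance together with a listed tree decomposition:
the numbers of users, steps and nodes (array 0); the authorization matrix (array 1); the
constraint matrices for `=`, `≠`, `<` (arrays 2, 3, 4); the comparison matrix of the order on
the users (array 5); the edges of the tree, one per row (array 6); and the bags, one per row, each
row holding the size of the bag followed by its elements (array 7). -/
noncomputable def inputArrays {n k N : ℕ} (I : WSPInstance n k) {D : Digraph (Fin n)}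
    {X : TreeDecomposition D (Fin N)} (P : X.Listing) : RAM.Input
  | 0 => listArray [[n, k, N]]
  | 1 => relArray fun s u => u ∈ I.auth s
  | 2 => relArray fun s s' => (ConstraintKind.eq, s, s') ∈ I.constraints
  | 3 => relArray fun s s' => (ConstraintKind.ne, s, s') ∈ I.constraints
  | 4 => relArray fun s s' => (ConstraintKind.lt, s, s') ∈ I.constraints
  | 5 => relArray I.lt
  | 6 => listArray (P.edges.map fun e => [(e.1 : ℕ), (e.2 : ℕ)])
  | 7 => listArray (List.ofFn fun i => (P.elems i).length :: (P.elems i).map fun u => (u : ℕ))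
  | _ => fun _ _ => 0

/-! Let `F` be a set of users all of whose order relations to the other users factor through a bag
`L` disjoint from `F`. The outside then sees a user of `F` only through its type: which elements of
`L` lie above it and which below. There are at most `3 ^ |L|` types, and users of one type are
interchangeable as far as constraints with outside users are concerned; `=` and `≠` cause no
trouble, since users on different sides are distinct. So a partial plan into `F` may be replaced by
its state, which records for each step the digit `0` (unassigned) or one plus the code of the type
of its user. Dynamic programming tabulates the states that are realized.

The sets `F` come from contracting leaves of the tree. At each surviving node they consist of the
users that occur in the bags contracted into it but not in its own bag. When a leaf `v` is
contracted into its neighbour `u`, an order relation between the two sides is a path in `D`, each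
arc of which lies in one bag; the path must therefore meet the intersection of the bags of `u` and
`v` (`separated_of_leaf`). For the merge, every step chooses among `q = 2 g + b + 1` options, where
`g = 3 ^ b` and `b` is the largest bag size: unassigned, a type in the part of `u`, a type in the
part of `v`, or an element of the bag of `v` that is forgotten now. Constraints inside one part are
already accounted for by its table. The others can be tested on an arbitrary representative of each
type (`Realizes.rel_iff`), so the new table is exact (`realized_merge_of` and
`exists_of_realized_merge`). At the end the last node is merged into an extra node with an empty
bag. All users are then forgotten and have the same type, and the answer is the entry of the state
with all digits one (`isYes_iff_realized`).

A merge tries `q ^ k` vectors of options and spends `O(k ^ 2)` on each. With `M = r + 2 + 3 ^ (r +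
1)` one has `q ≤ 2 M` and `k + 1 ≤ 2 ^ k`, so `k ^ 2 * q ^ k` is `O(k * 4 ^ k * M ^ k)`. Building
the option tables costs about `q * b` per merge, which is affordable for `k ≥ 2` because `q ^ 2 ≤ q
^ k`. For `k = 1` the program tries all users instead.

The program is written in a small language in which execution is a function `exec`, so that
correctness is a statement about `exec`. `TimeBound` carries both the result and the running time
over to the machine. For a command that preserves its loop bounds, the time is at most its size
times the largest product of nested loop lengths (`timeBound_of_stable`). -/

/-! ### A language with arrays and bounded loops -/

namespace ArrayLang

/-- The registers used by the algorithm. -/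
inductive Reg : Type
  | rout | rn | rk | rN | rb | rg | rq | rqk | rn1 | rn2 | rp | rptr | racc | rs | rs2 | ro | rj
  | rm | ri | rv | ru | rroot | rx | rit | rfresh | rfresh2 | ry | rcls | rdu | rdv | rcode | rdup
  | rbad | ra1 | ra2 | ra3 | rbase | rcarry | rw | re1 | re2
  deriving DecidableEq

/-- The arrays used by the algorithm. -/
inductive Arr : Type
  | adeg | anbr | atbase | arbase | atab | arep | ausr | acls | adu | adv | adn | adig | apw
  deriving DecidableEq

theorem Reg.ctorIdx_injective : Function.Injective Reg.ctorIdx := by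
  intro a b h
  have ha : Reg.ofNat a.ctorIdx = a := by cases a <;> rfl
  have hb : Reg.ofNat b.ctorIdx = b := by cases b <;> rfl
  rw [← ha, ← hb, h]

theorem Arr.ctorIdx_injective : Function.Injective Arr.ctorIdx := by
  intro a b h
  have ha : Arr.ofNat a.ctorIdx = a := by cases a <;> rfl
  have hb : Arr.ofNat b.ctorIdx = b := by cases b <;> rfl
  rw [← ha, ← hb, h]

/-- The arrays occupy distinct residue classes of addresses modulo 16; this modulus makes the
address computation four doublings and one addition. -/
theorem Arr.ctorIdx_lt (a : Arr) : a.ctorIdx < 16 := by cases a <;> decide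

/-- Expressions. -/
inductive Ex : Type
  | const (c : ℕ)
  | reg (x : Reg)
  | arr (t : Arr) (i : Ex)
  | inp (t : ℕ) (i j : Ex)
  | add (a b : Ex)
  | sub (a b : Ex)

/-- Conditions. -/
inductive Cn : Type
  | eq (a b : Ex)
  | lt (a b : Ex)
  | and (c d : Cn)
  | not (c : Cn)

/-- Commands. `loop x y p` runs `p` with `x = 0, 1, …, y - 1`. -/
inductive Cmd : Type
  | skip
  | set (x : Reg) (e : Ex)
  | put (t : Arr) (i e : Ex)
  | seq (p q : Cmd)
  | ite (c : Cn) (p q : Cmd)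
  | loop (x y : Reg) (p : Cmd)

/-- Contents of the registers and of the arrays. -/
structure St : Type where
  reg : Reg → ℕ
  arr : Arr → ℕ → ℕ

namespace St

def setReg (σ : St) (x : Reg) (v : ℕ) : St := ⟨Function.update σ.reg x v, σ.arr⟩

def setArr (σ : St) (t : Arr) (i v : ℕ) : St :=
  ⟨σ.reg, Function.update σ.arr t (Function.update (σ.arr t) i v)⟩

@[simp] theorem reg_setReg (σ : St) (x y : Reg) (v : ℕ) :
    (σ.setReg x v).reg y = if y = x then v else σ.reg y := by
  simp [setReg, Function.update_apply]

@[simp] theorem arr_setReg (σ : St) (x : Reg) (v : ℕ) : (σ.setReg x v).arr = σ.arr := rfl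

@[simp] theorem reg_setArr (σ : St) (t : Arr) (i v : ℕ) : (σ.setArr t i v).reg = σ.reg := rfl

theorem arr_setArr (σ : St) (t t' : Arr) (i v : ℕ) :
    (σ.setArr t i v).arr t' = if t' = t then Function.update (σ.arr t) i v else σ.arr t' := by
  simp only [setArr, Function.update_apply]

@[simp] theorem arr_setArr_same (σ : St) (t : Arr) (i v : ℕ) :
    (σ.setArr t i v).arr t = Function.update (σ.arr t) i v := by
  simp [setArr]

@[simp] theorem arr_setArr_ne (σ : St) {t t' : Arr} (h : t' ≠ t) (i v : ℕ) :
    (σ.setArr t i v).arr t' = σ.arr t' := by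
  simp [setArr, h]

def zero : St := ⟨fun _ => 0, fun _ _ => 0⟩

end St

variable (inp : RAM.Input)

def Ex.eval (σ : St) : Ex → ℕ
  | .const c => c
  | .reg x => σ.reg x
  | .arr t i => σ.arr t (i.eval σ)
  | .inp t i j => inp t (i.eval σ) (j.eval σ)
  | .add a b => a.eval σ + b.eval σ
  | .sub a b => a.eval σ - b.eval σ

def Cn.holds (σ : St) : Cn → Prop
  | .eq a b => a.eval inp σ = b.eval inp σ
  | .lt a b => a.eval inp σ < b.eval inp σ
  | .and c d => c.holds σ ∧ d.holds σ
  | .not c => ¬ c.holds σ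

-- The number of iterations is fixed on entry to a loop, whereas the machine consults `y` before
-- each iteration. The two agree when the body writes neither to `x` nor to `y`. The final value of
-- `x` is the one with which the machine leaves the loop.
open Classical in
noncomputable def exec : Cmd → St → St
  | .skip, σ => σ
  | .set x e, σ => σ.setReg x (e.eval inp σ)
  | .put t i e, σ => σ.setArr t (i.eval inp σ) (e.eval inp σ)
  | .seq p q, σ => exec q (exec p σ)
  | .ite c p q, σ => if c.holds inp σ then exec p σ else exec q σ
  | .loop x y p, σ =>
      (Nat.rec σ (fun i τ => exec p (τ.setReg x i)) (σ.reg y) : St).setReg x (σ.reg y)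

/-- `c` does not assign to `x`. -/
def Cmd.keeps : Cmd → Reg → Bool
  | .skip, _ => true
  | .set x _, z => z ≠ x
  | .put _ _ _, _ => true
  | .seq p q, z => p.keeps z && q.keeps z
  | .ite _ p q, z => p.keeps z && q.keeps z
  | .loop x _ p, z => z ≠ x && p.keeps z

/-- `c` does not write to the array `t`. -/
def Cmd.keepsArr : Cmd → Arr → Bool
  | .skip, _ => true
  | .set _ _, _ => true
  | .put t _ _, z => z ≠ t
  | .seq p q, z => p.keepsArr z && q.keepsArr z
  | .ite _ p q, z => p.keepsArr z && q.keepsArr z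
  | .loop _ _ p, z => p.keepsArr z

theorem exec_reg_of_keeps {c : Cmd} {z : Reg} (h : c.keeps z = true) (σ : St) :
    (exec inp c σ).reg z = σ.reg z := by
  induction c generalizing σ with
  | skip => rfl
  | set x e => simp_all [exec, Cmd.keeps]
  | put t i e => rfl
  | seq p q ihp ihq => simp_all [exec, Cmd.keeps]
  | ite c p q ihp ihq =>
    simp only [Cmd.keeps, Bool.and_eq_true] at h
    simp only [exec]
    split_ifs
    · exact ihp h.1 σ
    · exact ihq h.2 σ
  | loop x y p ih =>
    simp only [Cmd.keeps, Bool.and_eq_true, decide_eq_true_eq] at h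
    simp only [exec, St.reg_setReg, if_neg h.1]
    induction σ.reg y with
    | zero => rfl
    | succ i ihi => simp only [ih h.2, St.reg_setReg, if_neg h.1, ihi]

theorem exec_arr_of_keepsArr {c : Cmd} {z : Arr} (h : c.keepsArr z = true) (σ : St) :
    (exec inp c σ).arr z = σ.arr z := by
  induction c generalizing σ with
  | skip => rfl
  | set x e => rfl
  | put t i e =>
    simp only [Cmd.keepsArr, decide_eq_true_eq] at h
    simp [exec, h]
  | seq p q ihp ihq => simp_all [exec, Cmd.keepsArr]
  | ite c p q ihp ihq =>
    simp only [Cmd.keepsArr, Bool.and_eq_true] at h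
    simp only [exec]
    split_ifs
    · exact ihp h.1 σ
    · exact ihq h.2 σ
  | loop x y p ih =>
    simp only [Cmd.keepsArr] at h
    simp only [exec, St.arr_setReg]
    induction σ.reg y with
    | zero => rfl
    | succ i ihi => simp only [ih h, St.arr_setReg, ihi]

/-- The invariant rule for loops. In the body, everything that the loop does not write to may be
taken from the initial state. -/
theorem exec_loop {x y : Reg} {p : Cmd} {σ : St} (Inv : ℕ → St → Prop) (h0 : Inv 0 σ)
    (hs : ∀ i < σ.reg y, ∀ τ : St, (∀ z, (Cmd.loop x y p).keeps z = true → τ.reg z = σ.reg z) →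
      (∀ t, p.keepsArr t = true → τ.arr t = σ.arr t) → Inv i τ →
      Inv (i + 1) (exec inp p (τ.setReg x i))) :
    ∃ τ, Inv (σ.reg y) τ ∧ exec inp (.loop x y p) σ = τ.setReg x (σ.reg y) := by
  refine ⟨_, ?_, rfl⟩
  -- The frame conditions are proved together with the invariant, because the hypothesis on the body
  -- asks for them at every iteration.
  suffices H : ∀ m ≤ σ.reg y,
      let τ : St := Nat.rec σ (fun i τ => exec inp p (τ.setReg x i)) m
      Inv m τ ∧ (∀ z, (Cmd.loop x y p).keeps z = true → τ.reg z = σ.reg z) ∧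
      (∀ t, p.keepsArr t = true → τ.arr t = σ.arr t) from (H _ le_rfl).1
  intro m
  induction m with
  | zero => intro _; exact ⟨h0, fun _ _ => rfl, fun _ _ => rfl⟩
  | succ m ih =>
    intro hm
    obtain ⟨a, b, c⟩ := ih (by omega)
    refine ⟨hs m (by omega) _ b c a, fun z hz => ?_, fun t ht => ?_⟩
    · have hz' := hz
      simp only [Cmd.keeps, Bool.and_eq_true, decide_eq_true_eq] at hz'
      dsimp only
      rw [exec_reg_of_keeps inp hz'.2, St.reg_setReg, if_neg hz'.1]
      exact b z hz
    · dsimp only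
      rw [exec_arr_of_keepsArr inp ht, St.arr_setReg]
      exact c t ht

/-! ### Translation to random access machines -/

def twice (e : RAM.Expr) : RAM.Expr := .add e e

def Ex.compile : Ex → RAM.Expr
  | .const c => .const c
  | .reg x => .reg x.ctorIdx
  | .arr t i => .mem (.add (twice (twice (twice (twice i.compile)))) (.const t.ctorIdx))
  | .inp t i j => .input t i.compile j.compile
  | .add a b => .add a.compile b.compile
  | .sub a b => .sub a.compile b.compile

/-- Nonzero stands for true, and `1 - e` is negation. Two numbers are equal when both truncated
differences vanish. -/
def Cn.compile : Cn → RAM.Expr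
  | .eq a b => .sub (.const 1) (.add (.sub a.compile b.compile) (.sub b.compile a.compile))
  | .lt a b => .sub b.compile a.compile
  | .and c d => .sub (.const 1) (.add (.sub (.const 1) c.compile) (.sub (.const 1) d.compile))
  | .not c => .sub (.const 1) c.compile

def Cmd.compile : Cmd → RAM.Program
  | .skip => .skip
  | .set x e => .assign x.ctorIdx e.compile
  | .put t i e =>
      .store (.add (twice (twice (twice (twice i.compile)))) (.const t.ctorIdx)) e.compile
  | .seq p q => .seq p.compile q.compile
  | .ite c p q => .cond c.compile p.compile q.compile
  | .loop x y p => .seq (.assign x.ctorIdx (.const 0))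
      (.loop (.sub (.reg y.ctorIdx) (.reg x.ctorIdx))
        (.seq p.compile (.assign x.ctorIdx (.add (.reg x.ctorIdx) (.const 1)))))

/-- The machine state `s` represents `σ`. -/
structure Represents (σ : St) (s : RAM.State) : Prop where
  reg : ∀ x : Reg, s.reg x.ctorIdx = σ.reg x
  mem : ∀ (t : Arr) (i : ℕ), s.mem (16 * i + t.ctorIdx) = σ.arr t i

theorem represents_start : Represents St.zero RAM.State.start := ⟨fun _ => rfl, fun _ _ => rfl⟩

variable {inp} {σ : St} {s : RAM.State}

theorem eval_twice (e : RAM.Expr) : (twice e).eval inp s = 2 * e.eval inp s := by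
  simp only [twice, RAM.Expr.eval]; ring

theorem Represents.eval (h : Represents σ s) (e : Ex) :
    e.compile.eval inp s = e.eval inp σ := by
  induction e with
  | const c => rfl
  | reg x => exact h.reg x
  | arr t i ih =>
    simp only [Ex.compile, RAM.Expr.eval, eval_twice, ih, Ex.eval, ← h.mem]
    congr 1; ring
  | inp t i j ihi ihj => simp only [Ex.compile, RAM.Expr.eval, ihi, ihj, Ex.eval]
  | add a b iha ihb => simp only [Ex.compile, RAM.Expr.eval, iha, ihb, Ex.eval]
  | sub a b iha ihb => simp only [Ex.compile, RAM.Expr.eval, iha, ihb, Ex.eval]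

theorem Represents.holds (h : Represents σ s) (c : Cn) :
    c.compile.eval inp s ≠ 0 ↔ c.holds inp σ := by
  induction c with
  | eq a b => simp only [Cn.compile, RAM.Expr.eval, h.eval, Cn.holds]; omega
  | lt a b => simp only [Cn.compile, RAM.Expr.eval, h.eval, Cn.holds]; omega
  | and c d ihc ihd => simp only [Cn.compile, RAM.Expr.eval, Cn.holds, ← ihc, ← ihd]; omega
  | not c ih => simp only [Cn.compile, RAM.Expr.eval, Cn.holds, ← ih]; omega

theorem Represents.setReg (h : Represents σ s) (x : Reg) (v : ℕ) :
    Represents (σ.setReg x v) { s with reg := Function.update s.reg x.ctorIdx v } := by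
  refine ⟨fun z => ?_, h.mem⟩
  simp only [Function.update_apply, St.reg_setReg, Reg.ctorIdx_injective.eq_iff, h.reg]

theorem Represents.setArr (h : Represents σ s) (t : Arr) (i v : ℕ) :
    Represents (σ.setArr t i v)
      { s with mem := Function.update s.mem (16 * i + t.ctorIdx) v } := by
  refine ⟨h.reg, fun t' i' => ?_⟩
  simp only [Function.update_apply, St.arr_setArr]
  have h1 := t.ctorIdx_lt
  have h2 := t'.ctorIdx_lt
  by_cases ht : t' = t
  · subst ht
    by_cases hi : i' = i
    · simp [hi]
    · rw [if_neg (by omega), if_pos rfl, Function.update_apply, if_neg hi, h.mem]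
  · have : t'.ctorIdx ≠ t.ctorIdx := fun e => ht (Arr.ctorIdx_injective e)
    rw [if_neg (by omega), if_neg ht, h.mem]

/-! ### Running times -/

variable (inp)

/-- `c`, started in `σ`, takes at most `T` units of time. -/
def TimeBound (c : Cmd) (σ : St) (T : ℕ) : Prop :=
  ∀ s, Represents σ s → ∃ t s', RAM.Runs inp c.compile s t s' ∧
    Represents (exec inp c σ) s' ∧ t ≤ T

variable {inp}

theorem TimeBound.mono {c : Cmd} {T T' : ℕ} (h : TimeBound inp c σ T) (hT : T ≤ T') :
    TimeBound inp c σ T' := fun s hs =>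
  let ⟨t, s', h1, h2, h3⟩ := h s hs
  ⟨t, s', h1, h2, h3.trans hT⟩

theorem TimeBound.seq {p q : Cmd} {T T' : ℕ} (hp : TimeBound inp p σ T)
    (hq : TimeBound inp q (exec inp p σ) T') : TimeBound inp (.seq p q) σ (T + T') := by
  intro s hs
  obtain ⟨t, s', h1, h2, h3⟩ := hp s hs
  obtain ⟨t', s'', h1', h2', h3'⟩ := hq s' h2
  exact ⟨_, _, .seq h1 h1', h2', add_le_add h3 h3'⟩

theorem TimeBound.ite {c : Cn} {p q : Cmd} {T : ℕ} (hp : c.holds inp σ → TimeBound inp p σ T)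
    (hq : ¬ c.holds inp σ → TimeBound inp q σ T) :
    TimeBound inp (.ite c p q) σ (c.compile.cost + 1 + T) := by
  intro s hs
  by_cases hc : c.holds inp σ
  · obtain ⟨t, s', h1, h2, h3⟩ := hp hc s hs
    exact ⟨_, _, .cond_pos ((hs.holds c).2 hc) h1, by simpa only [exec, if_pos hc] using h2,
      by omega⟩
  · obtain ⟨t, s', h1, h2, h3⟩ := hq hc s hs
    refine ⟨_, _, .cond_zero ?_ h1, by simpa only [exec, if_neg hc] using h2, by omega⟩
    exact not_not.1 fun h => hc ((hs.holds c).1 h)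

/-- The registers that bound the loops. -/
def Cmd.bounds : Cmd → List Reg
  | .skip => []
  | .set _ _ => []
  | .put _ _ _ => []
  | .seq p q => p.bounds ++ q.bounds
  | .ite _ p q => p.bounds ++ q.bounds
  | .loop _ y p => y :: p.bounds

/-- Loop bodies do not write to the loop variable. -/
def Cmd.wf : Cmd → Bool
  | .skip => true
  | .set _ _ => true
  | .put _ _ _ => true
  | .seq p q => p.wf && q.wf
  | .ite _ p q => p.wf && q.wf
  | .loop x _ p => p.keeps x && p.wf

/-- `c` is well formed and does not write to the registers that bound its loops. -/
def Cmd.stable (c : Cmd) : Bool := c.wf && c.bounds.all fun y => c.keeps y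

/-- The size of a command. -/
def Cmd.size : Cmd → ℕ
  | .skip => 1
  | .set _ e => e.compile.cost + 1
  | .put t i e => (Ex.arr t i).compile.cost + e.compile.cost + 1
  | .seq p q => p.size + q.size
  | .ite c p q => c.compile.cost + 1 + (p.size + q.size)
  | .loop _ _ p => p.size + 12

/-- The largest number of iterations of nested loops. -/
def Cmd.weight (ρ : Reg → ℕ) : Cmd → ℕ
  | .skip => 1
  | .set _ _ => 1
  | .put _ _ _ => 1
  | .seq p q => max (p.weight ρ) (q.weight ρ)
  | .ite _ p q => max (p.weight ρ) (q.weight ρ)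
  | .loop _ y p => (ρ y + 1) * p.weight ρ

theorem Cmd.one_le_weight (ρ : Reg → ℕ) (c : Cmd) : 1 ≤ c.weight ρ := by
  induction c with
  | skip => rfl
  | set x e => rfl
  | put t i e => rfl
  | seq p q ihp ihq => exact ihp.trans (le_max_left _ _)
  | ite c p q ihp ihq => exact ihp.trans (le_max_left _ _)
  | loop x y p ih => exact Nat.mul_pos (Nat.succ_pos _) ih

theorem Cmd.weight_congr {ρ ρ' : Reg → ℕ} {c : Cmd} (h : ∀ y ∈ c.bounds, ρ y = ρ' y) :
    c.weight ρ = c.weight ρ' := by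
  induction c with
  | skip => rfl
  | set x e => rfl
  | put t i e => rfl
  | seq p q ihp ihq =>
    simp only [Cmd.bounds, List.mem_append] at h
    simp only [Cmd.weight, ihp fun y hy => h y (.inl hy), ihq fun y hy => h y (.inr hy)]
  | ite c p q ihp ihq =>
    simp only [Cmd.bounds, List.mem_append] at h
    simp only [Cmd.weight, ihp fun y hy => h y (.inl hy), ihq fun y hy => h y (.inr hy)]
  | loop x y p ih =>
    simp only [Cmd.bounds, List.mem_cons] at h
    simp only [Cmd.weight, ih fun y hy => h y (.inr hy), h y (.inl rfl)]

/-- Test and increment add 8 units to each execution of the body. The initial assignment and the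
last, failing test cost 6 units, paid by the additional summand 1 in the number of iterations. The
constant 12 covers both. -/
theorem timeBound_loop {x y : Reg} {p : Cmd} {T : ℕ} (hxy : y ≠ x) (hx : p.keeps x = true)
    (hy : p.keeps y = true) {σ : St}
    (hp : ∀ τ : St, (∀ z, (Cmd.loop x y p).keeps z = true → τ.reg z = σ.reg z) →
      TimeBound inp p τ T) :
    TimeBound inp (.loop x y p) σ ((σ.reg y + 1) * (T + 12)) := by
  let F : ℕ → St := fun m => Nat.rec σ (fun i τ => exec inp p (τ.setReg x i)) m
  have hF : ∀ m z, (Cmd.loop x y p).keeps z = true → (F m).reg z = σ.reg z := by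
    intro m z hz
    have hz' := hz
    simp only [Cmd.keeps, Bool.and_eq_true, decide_eq_true_eq] at hz'
    induction m with
    | zero => rfl
    | succ m ih =>
      change (exec inp p ((F m).setReg x m)).reg z = _
      rw [exec_reg_of_keeps inp hz'.2, St.reg_setReg, if_neg hz'.1, ih]
  have hky : (Cmd.loop x y p).keeps y = true := by simp [Cmd.keeps, hxy, hy]
  have key : ∀ d m, m + d = σ.reg y → ∀ s, Represents ((F m).setReg x m) s →
      ∃ t s', RAM.Runs inp (.loop (.sub (.reg y.ctorIdx) (.reg x.ctorIdx))
        (.seq p.compile (.assign x.ctorIdx (.add (.reg x.ctorIdx) (.const 1))))) s t s' ∧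
        Represents ((F (σ.reg y)).setReg x (σ.reg y)) s' ∧ t ≤ d * (T + 12) + 4 := by
    intro d
    induction d with
    | zero =>
      intro m hm s hs
      obtain rfl : m = σ.reg y := by omega
      refine ⟨_, s, .loop_zero ?_, hs, ?_⟩
      · simp [RAM.Expr.eval, hs.reg, hxy, hF _ y hky]
      · simp [RAM.Expr.cost]
    | succ d ih =>
      intro m hm s hs
      obtain ⟨t, s', h1, h2, h3⟩ := hp ((F m).setReg x m) (fun z hz => by
        have hz' := hz
        simp only [Cmd.keeps, Bool.and_eq_true, decide_eq_true_eq] at hz'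
        rw [St.reg_setReg, if_neg hz'.1, hF m z hz]) s hs
      have hv : s'.reg x.ctorIdx = m := by
        rw [h2.reg, exec_reg_of_keeps inp hx]; simp
      have h2' : Represents (F (m + 1)) s' := h2
      obtain ⟨t', s'', h1', h2'', h3'⟩ := ih (m + 1) (by omega) _ (h2'.setReg x (m + 1))
      refine ⟨_, s'', .loop_pos (t' := t') ?_ (.seq h1 (.assign _ _ _)) ?_, h2'', ?_⟩
      · simp [RAM.Expr.eval, hs.reg, hxy, hF _ y hky]; omega
      · simpa [RAM.Expr.eval, hv] using h1'
      · simp only [RAM.Expr.cost]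
        rw [Nat.add_mul]; omega
  intro s hs
  obtain ⟨t, s', h1, h2, h3⟩ := key (σ.reg y) 0 (by omega) _ (hs.setReg x 0)
  refine ⟨_, s', .seq (.assign _ _ _) h1, h2, ?_⟩
  simp only [RAM.Expr.cost]
  rw [Nat.add_mul]; omega

/-- No bound of a loop is ever overwritten, so all loop lengths can be read off from the registers
at the start and nested loops simply multiply. -/
theorem timeBound_of_wf {c : Cmd} (hwf : c.wf = true)
    (hst : ∀ y ∈ c.bounds, c.keeps y = true) (σ : St) :
    TimeBound inp c σ (c.size * c.weight σ.reg) := by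
  induction c generalizing σ with
  | skip => exact fun s hs => ⟨_, _, .skip s, hs, le_rfl⟩
  | set x e =>
    intro s hs
    refine ⟨_, _, .assign _ _ s, ?_, (Nat.mul_one _).ge⟩
    rw [hs.eval]
    exact hs.setReg _ _
  | put t i e =>
    intro s hs
    refine ⟨_, _, .store _ _ s, ?_, ?_⟩
    · simp only [RAM.Expr.eval, eval_twice, hs.eval]
      rw [show ∀ a, 2 * (2 * (2 * (2 * a))) = 16 * a by intro a; ring]
      exact hs.setArr t (i.eval inp σ) (e.eval inp σ)
    · simp only [Cmd.size, Cmd.weight, Ex.compile, RAM.Expr.cost]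
      omega
  | seq p q ihp ihq =>
    simp only [Cmd.bounds, List.mem_append, Cmd.keeps, Bool.and_eq_true] at hst
    simp only [Cmd.wf, Bool.and_eq_true] at hwf
    refine ((ihp hwf.1 (fun y hy => (hst y (.inl hy)).1) σ).seq
      (ihq hwf.2 (fun y hy => (hst y (.inr hy)).2) _)).mono ?_
    rw [Cmd.weight_congr (c := q) (ρ' := σ.reg) fun y hy =>
      exec_reg_of_keeps inp (hst y (.inr hy)).1 σ]
    simp only [Cmd.size, Cmd.weight, Nat.add_mul]
    gcongr
    · exact le_max_left _ _
    · exact le_max_right _ _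
  | ite c p q ihp ihq =>
    simp only [Cmd.bounds, List.mem_append, Cmd.keeps, Bool.and_eq_true] at hst
    simp only [Cmd.wf, Bool.and_eq_true] at hwf
    have hp := ihp hwf.1 (fun y hy => (hst y (.inl hy)).1) σ
    have hq := ihq hwf.2 (fun y hy => (hst y (.inr hy)).2) σ
    have h1 : p.size * p.weight σ.reg ≤ (p.size + q.size) * max (p.weight σ.reg) (q.weight σ.reg) :=
      Nat.mul_le_mul (Nat.le_add_right _ _) (le_max_left _ _)
    have h2 : q.size * q.weight σ.reg ≤ (p.size + q.size) * max (p.weight σ.reg) (q.weight σ.reg) :=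
      Nat.mul_le_mul (Nat.le_add_left _ _) (le_max_right _ _)
    refine (TimeBound.ite (fun _ => hp.mono h1) (fun _ => hq.mono h2)).mono ?_
    simp only [Cmd.size, Cmd.weight]
    rw [Nat.add_mul (c.compile.cost + 1)]
    gcongr
    exact Nat.le_mul_of_pos_right _ ((p.one_le_weight _).trans (le_max_left _ _))
  | loop x y p ih =>
    simp only [Cmd.bounds, List.mem_cons, forall_eq_or_imp] at hst
    simp only [Cmd.wf, Bool.and_eq_true] at hwf
    have hy := hst.1
    simp only [Cmd.keeps, Bool.and_eq_true, decide_eq_true_eq] at hy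
    refine (timeBound_loop (T := p.size * p.weight σ.reg) hy.1 hwf.1 hy.2 fun τ hτ => ?_).mono ?_
    · rw [← Cmd.weight_congr (c := p) fun z hz => hτ z (hst.2 z hz)]
      refine ih hwf.2 (fun z hz => ?_) τ
      have := hst.2 z hz
      simp only [Cmd.keeps, Bool.and_eq_true] at this
      exact this.2
    · simp only [Cmd.size, Cmd.weight]
      calc _ ≤ (σ.reg y + 1) * (p.size * p.weight σ.reg + 12 * p.weight σ.reg) := by
            gcongr; exact Nat.le_mul_of_pos_right _ (p.one_le_weight _)
        _ = _ := by ring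

theorem timeBound_of_stable {c : Cmd} (h : c.stable = true) (σ : St) {W : ℕ}
    (hW : c.weight σ.reg ≤ W) : TimeBound inp c σ (c.size * W) := by
  simp only [Cmd.stable, Bool.and_eq_true, List.all_eq_true] at h
  exact (timeBound_of_wf h.1 h.2 σ).mono (Nat.mul_le_mul_left _ hW)

end ArrayLang

/-! ### Types of users over a bag, and partial plans -/

namespace WSPInstance

variable {n k : ℕ} (I : WSPInstance n k)

open Classical in
/-- How `y` compares with `w`: `0`, `1`, `2` for incomparable, smaller, larger. -/
noncomputable def compareDigit (y w : Fin n) : ℕ :=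
  (if I.lt y w then 1 else 0) + 2 * (if I.lt w y then 1 else 0)

/-- The comparisons of `y` with the elements of `l`, as a number in base three. -/
noncomputable def typeCode (l : List (Fin n)) (y : Fin n) : ℕ :=
  l.foldl (fun c w => 3 * c + I.compareDigit y w) 0

theorem typeCode_concat (l : List (Fin n)) (w y : Fin n) :
    I.typeCode (l ++ [w]) y = 3 * I.typeCode l y + I.compareDigit y w := by
  simp [typeCode, List.foldl_append]

theorem compareDigit_le (y w : Fin n) : I.compareDigit y w ≤ 2 := by
  unfold compareDigit
  split_ifs with h1 h2
  · exact absurd (I.lt_trans _ _ _ h1 h2) (I.lt_irrefl _)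
  all_goals simp

theorem typeCode_lt (l : List (Fin n)) (y : Fin n) : I.typeCode l y < 3 ^ l.length := by
  induction l using List.reverseRecOn with
  | nil => simp [typeCode]
  | append_singleton l w ih =>
    have := I.compareDigit_le y w
    rw [typeCode_concat, List.length_append, List.length_singleton, pow_succ]
    omega

/-- All digits are at most two, so the expansion in base three is unique. -/
theorem typeCode_inj {l : List (Fin n)} {y y' : Fin n} (h : I.typeCode l y = I.typeCode l y') :
    ∀ w ∈ l, I.compareDigit y w = I.compareDigit y' w := by
  induction l using List.reverseRecOn with
  | nil => simp
  | append_singleton l w ih =>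
    rw [typeCode_concat, typeCode_concat] at h
    have h1 := I.compareDigit_le y w
    have h2 := I.compareDigit_le y' w
    intro w' hw'
    rw [List.mem_append, List.mem_singleton] at hw'
    rcases hw' with hw' | rfl
    · exact ih (by omega) w' hw'
    · omega

theorem typeCode_congr {l : List (Fin n)} {y y' : Fin n}
    (h : ∀ w ∈ l, (I.lt y w ↔ I.lt y' w) ∧ (I.lt w y ↔ I.lt w y')) :
    I.typeCode l y = I.typeCode l y' := by
  induction l using List.reverseRecOn with
  | nil => rfl
  | append_singleton l w ih =>
    have h1 := h w (by simp)
    rw [typeCode_concat, typeCode_concat, ih fun w' hw' => h w' (by simp [hw'])]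
    congr 1
    unfold compareDigit
    split_ifs <;> simp_all

theorem lt_iff_of_typeCode_eq {l : List (Fin n)} {y y' : Fin n}
    (h : I.typeCode l y = I.typeCode l y') {w : Fin n} (hw : w ∈ l) :
    (I.lt y w ↔ I.lt y' w) ∧ (I.lt w y ↔ I.lt w y') := by
  have h1 := I.typeCode_inj h w hw
  unfold compareDigit at h1
  split_ifs at h1 <;> simp_all

/-- A partial plan into `F` that violates no authorization and no constraint. -/
def IsPartialPlan (F : Set (Fin n)) (σ : Fin k → Option (Fin n)) : Prop :=
  (∀ s y, σ s = some y → y ∈ F ∧ y ∈ I.auth s) ∧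
    ∀ ρ s s' y y', (ρ, s, s') ∈ I.constraints → σ s = some y → σ s' = some y' → I.rel ρ y y'

/-- The digit that records the user of a step: zero for an unassigned step. -/
noncomputable def stateDigit (l : List (Fin n)) : Option (Fin n) → ℕ
  | none => 0
  | some y => I.typeCode l y + 1

/-- The state `d` over the bag `l` is realized by a partial plan into `F`. -/
def Realized (F : Set (Fin n)) (l : List (Fin n)) (d : Fin k → ℕ) : Prop :=
  ∃ σ, I.IsPartialPlan F σ ∧ ∀ s, d s = I.stateDigit l (σ s)

theorem realized_empty (l : List (Fin n)) (d : Fin k → ℕ) :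
    I.Realized ∅ l d ↔ ∀ s, d s = 0 := by
  constructor
  · rintro ⟨σ, hσ, hd⟩ s
    rw [hd]
    cases h : σ s with
    | none => rfl
    | some y => exact (hσ.1 s y h).1.elim
  · intro h
    exact ⟨fun _ => none, by simp [IsPartialPlan], h⟩

/-- Over the empty bag the only type has code zero. Digit one at every step thus says that every
step is assigned. -/
theorem isYes_iff_realized :
    I.IsYes ↔ I.Realized Set.univ [] fun _ => 1 := by
  constructor
  · rintro ⟨π, h1, h2⟩
    refine ⟨fun s => some (π s), ⟨?_, ?_⟩, fun s => rfl⟩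
    · rintro s y ⟨⟩
      exact ⟨trivial, h1 s⟩
    · rintro ρ s s' y y' h ⟨⟩ ⟨⟩
      exact h2 ρ s s' h
  · rintro ⟨σ, h1, h2⟩
    have : ∀ s, ∃ y, σ s = some y := by
      intro s
      cases h : σ s with
      | none => have := h2 s; simp [h, stateDigit] at this
      | some y => exact ⟨y, rfl⟩
    choose π hπ using this
    exact ⟨π, fun s => (h1.1 s _ (hπ s)).2, fun ρ s s' h => h1.2 ρ s s' _ _ h (hπ s) (hπ s')⟩

/-! ### Merging two parts separated by bags -/

/-- The parts `Fu`, with bag `Lu`, and `Fv`, with bag `Lv`, are separated by both bags. -/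
structure Separated (Fu Fv : Set (Fin n)) (Lu Lv : List (Fin n)) : Prop where
  notMem_uu : ∀ x ∈ Fu, x ∉ Lu
  notMem_uv : ∀ x ∈ Fu, x ∉ Lv
  notMem_vu : ∀ y ∈ Fv, y ∉ Lu
  notMem_vv : ∀ y ∈ Fv, y ∉ Lv
  disjoint : ∀ x ∈ Fu, x ∉ Fv
  up : ∀ x y, (x ∈ Fu ∨ x ∈ Lu) → (y ∈ Fv ∨ y ∈ Lv) → I.lt x y →
    ∃ w ∈ Lu, w ∈ Lv ∧ (x = w ∨ I.lt x w) ∧ (w = y ∨ I.lt w y)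
  down : ∀ x y, (x ∈ Fu ∨ x ∈ Lu) → (y ∈ Fv ∨ y ∈ Lv) → I.lt y x →
    ∃ w ∈ Lu, w ∈ Lv ∧ (y = w ∨ I.lt y w) ∧ (w = x ∨ I.lt w x)

/-- The user `y` realizes the option `o` for a step: `1, …, g` are types over `Lu`,
`g + 1, …, 2 g` types over `Lv`, and the others elements of `Lv`. -/
def Realizes (g : ℕ) (Fu Fv : Set (Fin n)) (Lu Lv : List (Fin n)) (o : ℕ) (y : Fin n) : Prop :=
  (o ≤ g ∧ y ∈ Fu ∧ I.typeCode Lu y + 1 = o) ∨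
  (g < o ∧ o ≤ 2 * g ∧ y ∈ Fv ∧ I.typeCode Lv y + 1 + g = o) ∨
  (2 * g < o ∧ Lv[o - 2 * g - 1]? = some y ∧ y ∉ Lu)

end WSPInstance

/-! ### Users of the same type are interchangeable -/

/-- The class of an option. -/
def optionClass (g o : ℕ) : ℕ := if o ≤ g then 1 else if o ≤ 2 * g then 2 else 3

namespace WSPInstance

variable {n k : ℕ} {I : WSPInstance n k} {Fu Fv : Set (Fin n)} {Lu Lv : List (Fin n)}

/-- A relation of `x` to `y` through `w ∈ l` is inherited by users of the same type. As `x` is not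
in `l`, it lies strictly below `w`, which is what the type records. -/
theorem lt_of_typeCode_eq_of_up {l : List (Fin n)} {x x' y : Fin n} (hx : x ∉ l)
    (h : I.typeCode l x = I.typeCode l x')
    (hs : ∃ w ∈ l, (x = w ∨ I.lt x w) ∧ (w = y ∨ I.lt w y)) : I.lt x' y := by
  obtain ⟨w, hw, h1, h2⟩ := hs
  rcases h1 with rfl | h1
  · exact absurd hw hx
  · have h3 := (I.lt_iff_of_typeCode_eq h hw).1.1 h1
    rcases h2 with rfl | h2
    · exact h3
    · exact I.lt_trans _ _ _ h3 h2

theorem lt_of_typeCode_eq_of_down {l : List (Fin n)} {x x' y : Fin n} (hx : x ∉ l)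
    (h : I.typeCode l x = I.typeCode l x')
    (hs : ∃ w ∈ l, (y = w ∨ I.lt y w) ∧ (w = x ∨ I.lt w x)) : I.lt y x' := by
  obtain ⟨w, hw, h1, h2⟩ := hs
  rcases h2 with rfl | h2
  · exact absurd hw hx
  · have h3 := (I.lt_iff_of_typeCode_eq h hw).2.1 h2
    rcases h1 with rfl | h1
    · exact h3
    · exact I.lt_trans _ _ _ h1 h3

/-- Every relation between the two sides passes through an element of `Lu`, so the type over `Lu`
determines it. -/
theorem Separated.lt_iff_left (hs : I.Separated Fu Fv Lu Lv) {x x' y : Fin n} (hx : x ∈ Fu)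
    (hx' : x' ∈ Fu) (h : I.typeCode Lu x = I.typeCode Lu x') (hy : y ∈ Fv ∨ y ∈ Lv) :
    (I.lt x y ↔ I.lt x' y) ∧ (I.lt y x ↔ I.lt y x') := by
  refine ⟨⟨fun hl => ?_, fun hl => ?_⟩, fun hl => ?_, fun hl => ?_⟩
  · obtain ⟨w, h1, -, h2⟩ := hs.up _ _ (.inl hx) hy hl
    exact lt_of_typeCode_eq_of_up (hs.notMem_uu _ hx) h ⟨w, h1, h2⟩
  · obtain ⟨w, h1, -, h2⟩ := hs.up _ _ (.inl hx') hy hl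
    exact lt_of_typeCode_eq_of_up (hs.notMem_uu _ hx') h.symm ⟨w, h1, h2⟩
  · obtain ⟨w, h1, -, h2⟩ := hs.down _ _ (.inl hx) hy hl
    exact lt_of_typeCode_eq_of_down (hs.notMem_uu _ hx) h ⟨w, h1, h2⟩
  · obtain ⟨w, h1, -, h2⟩ := hs.down _ _ (.inl hx') hy hl
    exact lt_of_typeCode_eq_of_down (hs.notMem_uu _ hx') h.symm ⟨w, h1, h2⟩

theorem Separated.lt_iff_right (hs : I.Separated Fu Fv Lu Lv) {y y' x : Fin n} (hy : y ∈ Fv)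
    (hy' : y' ∈ Fv) (h : I.typeCode Lv y = I.typeCode Lv y') (hx : x ∈ Fu ∨ x ∈ Lu) :
    (I.lt y x ↔ I.lt y' x) ∧ (I.lt x y ↔ I.lt x y') := by
  refine ⟨⟨fun hl => ?_, fun hl => ?_⟩, fun hl => ?_, fun hl => ?_⟩
  · obtain ⟨w, -, h1, h2⟩ := hs.down _ _ hx (.inl hy) hl
    exact lt_of_typeCode_eq_of_up (hs.notMem_vv _ hy) h ⟨w, h1, h2⟩
  · obtain ⟨w, -, h1, h2⟩ := hs.down _ _ hx (.inl hy') hl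
    exact lt_of_typeCode_eq_of_up (hs.notMem_vv _ hy') h.symm ⟨w, h1, h2⟩
  · obtain ⟨w, -, h1, h2⟩ := hs.up _ _ hx (.inl hy) hl
    exact lt_of_typeCode_eq_of_down (hs.notMem_vv _ hy) h ⟨w, h1, h2⟩
  · obtain ⟨w, -, h1, h2⟩ := hs.up _ _ hx (.inl hy') hl
    exact lt_of_typeCode_eq_of_down (hs.notMem_vv _ hy') h.symm ⟨w, h1, h2⟩

/-- This makes the digit of the merged state well defined: it may be computed from one
representative of a type over `Lv`. -/
theorem Separated.typeCode_eq (hs : I.Separated Fu Fv Lu Lv) {y y' : Fin n} (hy : y ∈ Fv)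
    (hy' : y' ∈ Fv) (h : I.typeCode Lv y = I.typeCode Lv y') :
    I.typeCode Lu y = I.typeCode Lu y' :=
  I.typeCode_congr fun _ hw => hs.lt_iff_right hy hy' h (.inr hw)

theorem rel_iff_of {x x' y : Fin n} (h : (I.lt x y ↔ I.lt x' y) ∧ (I.lt y x ↔ I.lt y x'))
    (hx : x ≠ y) (hx' : x' ≠ y) (ρ : ConstraintKind) :
    (I.rel ρ x y ↔ I.rel ρ x' y) ∧ (I.rel ρ y x ↔ I.rel ρ y x') := by
  cases ρ <;> simp [rel, hx, hx', hx.symm, hx'.symm, h]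

theorem Realizes.mem {g : ℕ} {o : ℕ} {y : Fin n} (h : I.Realizes g Fu Fv Lu Lv o y) :
    y ∈ Fu ∪ Fv ∪ {w | w ∈ Lv ∧ w ∉ Lu} := by
  rcases h with ⟨-, h, -⟩ | ⟨-, -, h, -⟩ | ⟨-, h, h'⟩
  · exact .inl (.inl h)
  · exact .inl (.inr h)
  · exact .inr ⟨List.mem_of_getElem? h, h'⟩

theorem Realizes.typeCode_eq (hs : I.Separated Fu Fv Lu Lv) {g o : ℕ} {y y' : Fin n}
    (h : I.Realizes g Fu Fv Lu Lv o y) (h' : I.Realizes g Fu Fv Lu Lv o y') :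
    I.typeCode Lu y = I.typeCode Lu y' := by
  rcases h with ⟨a, b, c⟩ | ⟨a, a', b, c⟩ | ⟨a, b, c⟩ <;>
    rcases h' with ⟨d, e, f⟩ | ⟨d, d', e, f⟩ | ⟨d, e, f⟩ <;> try omega
  · exact hs.typeCode_eq b e (by omega)
  · rw [b] at e; cases e; rfl

/-- Users realizing the same option compare in the same way with users realizing an option of
another class. -/
theorem Realizes.rel_iff (hs : I.Separated Fu Fv Lu Lv) {g o o' : ℕ} {y y' z : Fin n}
    (h : I.Realizes g Fu Fv Lu Lv o y) (h' : I.Realizes g Fu Fv Lu Lv o y')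
    (hz : I.Realizes g Fu Fv Lu Lv o' z)
    (hc : ¬ (optionClass g o = optionClass g o' ∧ optionClass g o ≠ 3)) (ρ : ConstraintKind) :
    (I.rel ρ y z ↔ I.rel ρ y' z) ∧ (I.rel ρ z y ↔ I.rel ρ z y') := by
  have h12 : ∀ {x w}, x ∈ Fu → w ∈ Fv → x ≠ w := by
    rintro x w hx hw rfl; exact hs.disjoint _ hx hw
  have h13 : ∀ {x w}, x ∈ Fu → w ∈ Lv → x ≠ w := by
    rintro x w hx hw rfl; exact hs.notMem_uv _ hx hw
  have h23 : ∀ {x w}, x ∈ Fv → w ∈ Lv → x ≠ w := by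
    rintro x w hx hw rfl; exact hs.notMem_vv _ hx hw
  rcases h with ⟨a, b, c⟩ | ⟨a, a', b, c⟩ | ⟨a, b, c⟩ <;>
    rcases h' with ⟨d, e, f⟩ | ⟨d, d', e, f⟩ | ⟨d, e, f⟩ <;> try omega
  · have hcode : I.typeCode Lu y = I.typeCode Lu y' := by omega
    rcases hz with ⟨p, q, r⟩ | ⟨p, p', q, r⟩ | ⟨p, q, r⟩
    · simp [optionClass, a, p] at hc
    · exact rel_iff_of (hs.lt_iff_left b e hcode (.inl q)) (h12 b q) (h12 e q) ρ
    · have q' := List.mem_of_getElem? q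
      exact rel_iff_of (hs.lt_iff_left b e hcode (.inr q')) (h13 b q') (h13 e q') ρ
  · have hcode : I.typeCode Lv y = I.typeCode Lv y' := by omega
    rcases hz with ⟨p, q, r⟩ | ⟨p, p', q, r⟩ | ⟨p, q, r⟩
    · exact rel_iff_of (hs.lt_iff_right b e hcode (.inl q)) (h12 q b).symm (h12 q e).symm ρ
    · simp [optionClass, a.not_ge, a', p.not_ge, p'] at hc
    · have q' := List.mem_of_getElem? q
      exact rel_iff_of (I.lt_iff_of_typeCode_eq hcode q') (h23 b q') (h23 e q') ρ
  -- An option beyond `2 * g` names a single element of `Lv`, so both users coincide.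
  · rw [b] at e; cases e; exact ⟨Iff.rfl, Iff.rfl⟩

/-- The tables describing the options for a step. -/
structure OptionTables (I : WSPInstance n k) (g q : ℕ) (Fu Fv : Set (Fin n))
    (Lu Lv : List (Fin n)) (usr cls du dv dn : ℕ → ℕ) : Prop where
  cls_zero : cls 0 = 0
  du_zero : du 0 = 0
  dv_zero : dv 0 = 0
  dn_zero : dn 0 = 0
  du_eq : ∀ o, 0 < o → o < q → du o = if o ≤ g then o else 0
  dv_eq : ∀ o, 0 < o → o < q → dv o = if g < o ∧ o ≤ 2 * g then o - g else 0
  entry : ∀ o, 0 < o → o < q →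
    (cls o = 4 ∧ ∀ y, ¬ I.Realizes g Fu Fv Lu Lv o y) ∨
    ∃ y : Fin n, I.Realizes g Fu Fv Lu Lv o y ∧ usr o = y + 1 ∧ cls o = optionClass g o ∧
      dn o = I.typeCode Lu y + 1

end WSPInstance

/-! ### Testing vectors of options, and exactness of the merge -/

/-- The option `o` is not available for the step `s`. -/
def stepConflict (inp : RAM.Input) (usr cls : ℕ → ℕ) (s o : ℕ) : Prop :=
  cls o = 4 ∨ (cls o = 3 ∧ inp 1 s (usr o - 1) = 0)

/-- The options `o` and `o'` for the steps `s` and `s'` violate a constraint. -/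
def pairConflict (inp : RAM.Input) (usr cls : ℕ → ℕ) (s s' o o' : ℕ) : Prop :=
  cls o ≠ 0 ∧ cls o' ≠ 0 ∧ ¬ (cls o = cls o' ∧ cls o ≠ 3) ∧
    ((inp 2 s s' ≠ 0 ∧ usr o ≠ usr o') ∨ (inp 3 s s' ≠ 0 ∧ usr o = usr o') ∨
      (inp 4 s s' ≠ 0 ∧ inp 5 (usr o - 1) (usr o' - 1) = 0))

/-- No conflicts between the options `e`. -/
def Compatible (inp : RAM.Input) (k : ℕ) (usr cls : ℕ → ℕ) (e : ℕ → ℕ) : Prop :=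
  ∀ s < k, ¬ stepConflict inp usr cls s (e s) ∧
    ∀ s' < k, ¬ pairConflict inp usr cls s s' (e s) (e s')

theorem relArray_ne_zero {a b : ℕ} (R : Fin a → Fin b → Prop) (i : Fin a) (j : Fin b) :
    relArray R i j ≠ 0 ↔ R i j := by
  simp [relArray]

/-- The arrays describing an instance. -/
structure Encodes {n k : ℕ} (inp : RAM.Input) (I : WSPInstance n k) : Prop where
  auth : ∀ (s : Fin k) (u : Fin n), inp 1 s u ≠ 0 ↔ u ∈ I.auth s
  eq : ∀ s s' : Fin k, inp 2 s s' ≠ 0 ↔ (ConstraintKind.eq, s, s') ∈ I.constraints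
  ne : ∀ s s' : Fin k, inp 3 s s' ≠ 0 ↔ (ConstraintKind.ne, s, s') ∈ I.constraints
  lt : ∀ s s' : Fin k, inp 4 s s' ≠ 0 ↔ (ConstraintKind.lt, s, s') ∈ I.constraints
  order : ∀ u v : Fin n, inp 5 u v ≠ 0 ↔ I.lt u v
  order_le : ∀ u v : ℕ, inp 5 u v ≤ 1

namespace WSPInstance

variable {n k : ℕ} {I : WSPInstance n k} {Fu Fv : Set (Fin n)} {Lu Lv : List (Fin n)}

/-- Users are stored with one added, so that zero can mean that there is no user. Pairs of options
of the same class 1 or 2 are exempt from the test: a single plan into one part realizes both. -/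
theorem not_pairConflict_iff {inp : RAM.Input} (hinp : Encodes inp I) {usr cls : ℕ → ℕ}
    {s s' : Fin k} {o o' : ℕ} {y y' : Fin n} (hu : usr o = y + 1) (hu' : usr o' = y' + 1) :
    ¬ pairConflict inp usr cls s s' o o' ↔
      (cls o ≠ 0 → cls o' ≠ 0 → ¬ (cls o = cls o' ∧ cls o ≠ 3) →
        ∀ ρ, (ρ, s, s') ∈ I.constraints → I.rel ρ y y') := by
  have h5 : inp 5 y y' = 0 ↔ ¬ I.lt y y' := by rw [← hinp.order, not_not]
  have hall : (∀ ρ, (ρ, s, s') ∈ I.constraints → I.rel ρ y y') ↔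
      ((ConstraintKind.eq, s, s') ∈ I.constraints → y = y') ∧
      ((ConstraintKind.ne, s, s') ∈ I.constraints → y ≠ y') ∧
      ((ConstraintKind.lt, s, s') ∈ I.constraints → I.lt y y') :=
    ⟨fun h => ⟨h .eq, h .ne, h .lt⟩, fun h ρ => by cases ρ; exacts [h.1, h.2.1, h.2.2]⟩
  rw [hall]
  simp only [pairConflict, hinp.eq, hinp.ne, hinp.lt, hu, hu', Nat.add_sub_cancel, h5,
    Nat.add_right_cancel_iff, Fin.val_inj, Ne]
  tauto

theorem compareDigit_eq {inp : RAM.Input} (hinp : Encodes inp I) (y w : Fin n) :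
    I.compareDigit y w = inp 5 y w + (inp 5 w y + inp 5 w y) := by
  have h1 := hinp.order y w
  have h2 := hinp.order w y
  have h3 := hinp.order_le y w
  have h4 := hinp.order_le w y
  unfold compareDigit
  split_ifs <;> simp_all <;> omega

theorem OptionTables.of_realizes {g q : ℕ} {usr cls du dv dn : ℕ → ℕ}
    (hs : I.Separated Fu Fv Lu Lv) (ht : I.OptionTables g q Fu Fv Lu Lv usr cls du dv dn)
    {o : ℕ} (h0 : 0 < o) (hq : o < q) {y : Fin n} (hy : I.Realizes g Fu Fv Lu Lv o y) :
    ∃ y₀ : Fin n, I.Realizes g Fu Fv Lu Lv o y₀ ∧ usr o = y₀ + 1 ∧ cls o = optionClass g o ∧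
      dn o = I.typeCode Lu y + 1 := by
  rcases ht.entry o h0 hq with ⟨-, h⟩ | ⟨y₀, h1, h2, h3, h4⟩
  · exact absurd hy (h y)
  · exact ⟨y₀, h1, h2, h3, by rw [h4, hy.typeCode_eq hs h1]⟩

theorem optionClass_ne_zero (g o : ℕ) : optionClass g o ≠ 0 := by
  unfold optionClass; split_ifs <;> simp

theorem exists_getElem?_eq {l : List (Fin n)} {y : Fin n} (h : y ∈ l) :
    ∃ i < l.length, l[i]? = some y := by
  obtain ⟨i, hi, rfl⟩ := List.getElem_of_mem h
  exact ⟨i, hi, List.getElem?_eq_getElem hi⟩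

/-- Glue plans for the two parts: each step follows the plan to which its option points, or takes
the element of `Lv` named by the option. Constraints between steps of one part hold in the plan for
that part. All others were tested on representatives, and the outcome is the same for the actual
users. -/
theorem realized_merge_of {inp : RAM.Input} (hinp : Encodes inp I) {g q : ℕ}
    {usr cls du dv dn : ℕ → ℕ} (hs : I.Separated Fu Fv Lu Lv)
    (ht : I.OptionTables g q Fu Fv Lu Lv usr cls du dv dn) {e : ℕ → ℕ} (he : ∀ s < k, e s < q)
    (hu : I.Realized Fu Lu fun s => du (e s)) (hv : I.Realized Fv Lv fun s => dv (e s))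
    (hc : Compatible inp k usr cls e) :
    I.Realized (Fu ∪ Fv ∪ {w | w ∈ Lv ∧ w ∉ Lu}) Lu fun s => dn (e s) := by
  obtain ⟨σ₁, h₁, hd₁⟩ := hu
  obtain ⟨σ₂, h₂, hd₂⟩ := hv
  let σ : Fin k → Option (Fin n) := fun s =>
    if e s = 0 then none else if e s ≤ g then σ₁ s else if e s ≤ 2 * g then σ₂ s
    else Lv[e s - 2 * g - 1]?
  have hσ : ∀ s : Fin k, (e s = 0 ∧ σ s = none) ∨
      (0 < e s ∧ ∃ y, σ s = some y ∧ I.Realizes g Fu Fv Lu Lv (e s) y) := by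
    intro s
    rcases Nat.eq_zero_or_pos (e s) with h0 | h0
    · exact .inl ⟨h0, if_pos h0⟩
    refine .inr ⟨h0, ?_⟩
    have hq := he s s.2
    by_cases hg : e s ≤ g
    · have hd := hd₁ s
      dsimp only at hd
      rw [ht.du_eq _ h0 hq, if_pos hg] at hd
      cases hσ : σ₁ s with
      | none => rw [hσ] at hd; simp only [stateDigit] at hd; omega
      | some y =>
        rw [hσ] at hd
        exact ⟨y, by simp [σ, h0.ne', hg, hσ], .inl ⟨hg, (h₁.1 s y hσ).1, hd.symm⟩⟩
    by_cases hg2 : e s ≤ 2 * g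
    · have hd := hd₂ s
      dsimp only at hd
      rw [ht.dv_eq _ h0 hq, if_pos ⟨by omega, hg2⟩] at hd
      cases hσ : σ₂ s with
      | none => rw [hσ] at hd; simp only [stateDigit] at hd; omega
      | some y =>
        rw [hσ] at hd
        simp only [stateDigit] at hd
        exact ⟨y, by simp [σ, h0.ne', hg, hg2, hσ],
          .inr (.inl ⟨by omega, hg2, (h₂.1 s y hσ).1, by omega⟩)⟩
    · rcases ht.entry _ h0 hq with ⟨h4, -⟩ | ⟨y, hy, -⟩
      · exact absurd (.inl h4) (hc s s.2).1
      · refine ⟨y, ?_, hy⟩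
        rcases hy with h | h | h
        · omega
        · omega
        · simp [σ, h0.ne', hg, hg2, h.2.1]
  have hσ' : ∀ {s : Fin k} {y}, σ s = some y → 0 < e s ∧ I.Realizes g Fu Fv Lu Lv (e s) y := by
    intro s y hy
    rcases hσ s with ⟨-, h⟩ | ⟨h0, y', h, h'⟩
    · simp [h] at hy
    · rw [h] at hy; cases hy; exact ⟨h0, h'⟩
  refine ⟨σ, ⟨fun s y hy => ?_, fun ρ s s' y y' hmem hy hy' => ?_⟩, fun s => ?_⟩
  · obtain ⟨h0, hr⟩ := hσ' hy
    refine ⟨hr.mem, ?_⟩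
    by_cases hg : e s ≤ g
    · simp only [σ, if_neg h0.ne', if_pos hg] at hy
      exact (h₁.1 s y hy).2
    by_cases hg2 : e s ≤ 2 * g
    · simp only [σ, if_neg h0.ne', if_neg hg, if_pos hg2] at hy
      exact (h₂.1 s y hy).2
    obtain ⟨y₀, hr₀, hu, hcl, -⟩ := ht.of_realizes hs h0 (he s s.2) hr
    -- For an option of class 3 the representative is the user itself, so the tested authorization
    -- is the right one. In the other two classes authorization comes from the given plans.
    have hyy : y₀ = y := by
      rcases hr with h | h | h <;> rcases hr₀ with h' | h' | h' <;> try omega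
      have := h.2.1.symm.trans h'.2.1
      exact (Option.some.inj this).symm
    subst hyy
    rw [← hinp.auth]
    intro h
    refine (hc s s.2).1 (.inr ⟨?_, ?_⟩)
    · rw [hcl, optionClass, if_neg hg, if_neg hg2]
    · rw [hu, Nat.add_sub_cancel, h]
  · obtain ⟨h0, hr⟩ := hσ' hy
    obtain ⟨h0', hr'⟩ := hσ' hy'
    by_cases hcl : optionClass g (e s) = optionClass g (e s') ∧ optionClass g (e s) ≠ 3
    · simp only [optionClass] at hcl
      by_cases hg : e s ≤ g
      · have hg' : e s' ≤ g := by
          by_contra hg'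
          simp only [hg, hg', if_true, if_false] at hcl
          split_ifs at hcl <;> simp at hcl
        simp only [σ, if_neg h0.ne', if_pos hg] at hy
        simp only [σ, if_neg h0'.ne', if_pos hg'] at hy'
        exact h₁.2 ρ s s' y y' hmem hy hy'
      by_cases hg2 : e s ≤ 2 * g
      · have hg' : ¬ e s' ≤ g := by
          intro hg'
          simp [hg, hg', hg2] at hcl
        have hg2' : e s' ≤ 2 * g := by
          by_contra hg2'
          simp [hg, hg', hg2, hg2'] at hcl
        simp only [σ, if_neg h0.ne', if_neg hg, if_pos hg2] at hy
        simp only [σ, if_neg h0'.ne', if_neg hg', if_pos hg2'] at hy'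
        exact h₂.2 ρ s s' y y' hmem hy hy'
      · simp [hg, hg2] at hcl
    · obtain ⟨y₀, hr₀, hu, hcl₀, -⟩ := ht.of_realizes hs h0 (he s s.2) hr
      obtain ⟨y₀', hr₀', hu', hcl₀', -⟩ := ht.of_realizes hs h0' (he s' s'.2) hr'
      have := (not_pairConflict_iff hinp hu hu').1 ((hc s s.2).2 s' s'.2)
        (by rw [hcl₀]; exact optionClass_ne_zero _ _)
        (by rw [hcl₀']; exact optionClass_ne_zero _ _) (by rwa [hcl₀, hcl₀']) ρ hmem
      -- The two users are replaced by their representatives one after the other.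
      rw [(hr.rel_iff hs hr₀ hr' hcl ρ).1]
      refine ((hr'.rel_iff hs hr₀' hr₀ (fun h => hcl ⟨h.1.symm, ?_⟩) ρ).2).2 this
      rw [← h.1]; exact h.2
  · rcases hσ s with ⟨h0, hn⟩ | ⟨h0, y, hy, hr⟩
    · simp [h0, hn, ht.dn_zero, stateDigit]
    · obtain ⟨y₀, -, -, -, hdn⟩ := ht.of_realizes hs h0 (he s s.2) hr
      simp [hy, stateDigit, hdn]

theorem exists_option {g q : ℕ} (hgu : 3 ^ Lu.length ≤ g) (hgv : 3 ^ Lv.length ≤ g)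
    (hq : 2 * g + Lv.length + 1 ≤ q) {y : Fin n}
    (hy : y ∈ Fu ∪ Fv ∪ {w | w ∈ Lv ∧ w ∉ Lu}) :
    ∃ o, 0 < o ∧ o < q ∧ I.Realizes g Fu Fv Lu Lv o y := by
  rcases hy with (hy | hy) | hy
  · have := I.typeCode_lt Lu y
    exact ⟨I.typeCode Lu y + 1, by omega, by omega, .inl ⟨by omega, hy, rfl⟩⟩
  · have := I.typeCode_lt Lv y
    exact ⟨I.typeCode Lv y + 1 + g, by omega, by omega,
      .inr (.inl ⟨by omega, by omega, hy, rfl⟩)⟩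
  · obtain ⟨i, hi, hi'⟩ := exists_getElem?_eq hy.1
    exact ⟨2 * g + 1 + i, by omega, by omega, .inr (.inr ⟨by omega, by
      rwa [show 2 * g + 1 + i - 2 * g - 1 = i by omega], hy.2⟩)⟩

/-- Every user of the merged part realizes some option, and the restrictions of the plan to the
steps with options of one part realize the states demanded from the two old tables. Exchanging users
for representatives turns satisfied constraints into passed tests. Compatibility is asserted for all
extensions `e'` of the options to `ℕ`, because the program keeps them in an array. -/
theorem exists_of_realized_merge {inp : RAM.Input} (hinp : Encodes inp I) {g q : ℕ}
    {usr cls du dv dn : ℕ → ℕ} (hs : I.Separated Fu Fv Lu Lv)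
    (ht : I.OptionTables g q Fu Fv Lu Lv usr cls du dv dn) (hgu : 3 ^ Lu.length ≤ g)
    (hgv : 3 ^ Lv.length ≤ g) (hq : 2 * g + Lv.length + 1 ≤ q) {d : Fin k → ℕ}
    (hd : I.Realized (Fu ∪ Fv ∪ {w | w ∈ Lv ∧ w ∉ Lu}) Lu d) :
    ∃ e : Fin k → ℕ, (∀ s, e s < q) ∧ I.Realized Fu Lu (fun s => du (e s)) ∧
      I.Realized Fv Lv (fun s => dv (e s)) ∧
      (∀ e' : ℕ → ℕ, (∀ s : Fin k, e' s = e s) → Compatible inp k usr cls e') ∧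
      ∀ s, d s = dn (e s) := by
  classical
  obtain ⟨σ, ⟨hσ1, hσ2⟩, hσd⟩ := hd
  have hex : ∀ s, ∃ o, o < q ∧ ((o = 0 ∧ σ s = none) ∨
      (0 < o ∧ ∃ y, σ s = some y ∧ I.Realizes g Fu Fv Lu Lv o y)) := by
    intro s
    cases h : σ s with
    | none => exact ⟨0, by omega, .inl ⟨rfl, rfl⟩⟩
    | some y =>
      obtain ⟨o, h0, h1, h2⟩ := exists_option hgu hgv hq (hσ1 s y h).1
      exact ⟨o, h1, .inr ⟨h0, y, rfl, h2⟩⟩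
  choose e heq he using hex
  refine ⟨e, heq, ?_, ?_, ?_, ?_⟩
  · refine ⟨fun s => if e s ≤ g then σ s else none, ⟨fun s y hy => ?_, ?_⟩, fun s => ?_⟩
    · dsimp only at hy
      split_ifs at hy with hg
      refine ⟨?_, (hσ1 s y hy).2⟩
      rcases he s with ⟨-, h⟩ | ⟨h0, y', h, h'⟩
      · simp [h] at hy
      · rw [h] at hy; cases hy
        rcases h' with h' | h' | h'
        · exact h'.2.1
        · omega
        · omega
    · intro ρ s s' y y' hmem hy hy'
      dsimp only at hy hy'
      split_ifs at hy hy'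
      exact hσ2 ρ s s' y y' hmem hy hy'
    · rcases he s with ⟨h0, h⟩ | ⟨h0, y', h, h'⟩
      · simp [h0, h, ht.du_zero, stateDigit]
      · dsimp only
        rw [ht.du_eq _ h0 (heq s)]
        split_ifs with hg
        · rw [h]
          rcases h' with h' | h' | h'
          · exact h'.2.2.symm
          · omega
          · omega
        · rfl
  · refine ⟨fun s => if g < e s ∧ e s ≤ 2 * g then σ s else none, ⟨fun s y hy => ?_, ?_⟩,
      fun s => ?_⟩
    · dsimp only at hy
      split_ifs at hy with hg
      refine ⟨?_, (hσ1 s y hy).2⟩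
      rcases he s with ⟨-, h⟩ | ⟨h0, y', h, h'⟩
      · simp [h] at hy
      · rw [h] at hy; cases hy
        rcases h' with h' | h' | h'
        · omega
        · exact h'.2.2.1
        · omega
    · intro ρ s s' y y' hmem hy hy'
      dsimp only at hy hy'
      split_ifs at hy hy'
      exact hσ2 ρ s s' y y' hmem hy hy'
    · rcases he s with ⟨h0, h⟩ | ⟨h0, y', h, h'⟩
      · simp [h0, ht.dv_zero, stateDigit]
      · dsimp only
        rw [ht.dv_eq _ h0 (heq s)]
        split_ifs with hg
        · rw [h]
          rcases h' with h' | h' | h'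
          · omega
          · simp only [stateDigit]; omega
          · omega
        · rfl
  · intro e' he' s hsk
    have hes := he' ⟨s, hsk⟩
    simp only at hes
    rw [hes]
    rcases he ⟨s, hsk⟩ with ⟨h0, h⟩ | ⟨h0, y, hy, hr⟩
    · rw [h0]
      exact ⟨by simp [stepConflict, ht.cls_zero], fun s' _ h => h.1 ht.cls_zero⟩
    obtain ⟨y₀, hr₀, hu, hcl, -⟩ := ht.of_realizes hs h0 (heq _) hr
    refine ⟨?_, fun s' hsk' => ?_⟩
    · rintro (h4 | ⟨h3, ha⟩)
      · rw [hcl] at h4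
        unfold optionClass at h4
        split_ifs at h4 <;> simp at h4
      · have hyy : y₀ = y := by
          rw [hcl] at h3
          unfold optionClass at h3
          rcases hr with h | h | h <;> rcases hr₀ with h' | h' | h' <;> try omega
          · simp [h.1] at h3
          · simp [h.1.not_ge, h.2.1] at h3
          · have := h.2.1.symm.trans h'.2.1
            exact (Option.some.inj this).symm
        subst hyy
        rw [hu, Nat.add_sub_cancel] at ha
        exact (hinp.auth ⟨s, hsk⟩ y₀).2 (hσ1 _ _ hy).2 ha
    · have hes' := he' ⟨s', hsk'⟩
      simp only at hes'
      rw [hes']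
      rcases he ⟨s', hsk'⟩ with ⟨h0', h⟩ | ⟨h0', y', hy', hr'⟩
      · rw [h0']
        exact fun h => h.2.1 ht.cls_zero
      obtain ⟨y₀', hr₀', hu', hcl', -⟩ := ht.of_realizes hs h0' (heq _) hr'
      refine (not_pairConflict_iff (s := ⟨s, hsk⟩) (s' := ⟨s', hsk'⟩) hinp hu hu').2
        fun _ _ hc ρ hmem => ?_
      rw [hcl, hcl'] at hc
      have := hσ2 ρ _ _ _ _ hmem hy hy'
      rw [(hr.rel_iff hs hr₀ hr' hc ρ).1] at this
      refine ((hr'.rel_iff hs hr₀' hr₀ (fun h => hc ⟨h.1.symm, ?_⟩) ρ).2).1 this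
      rw [← h.1]; exact h.2
  · intro s
    rw [hσd]
    rcases he s with ⟨h0, h⟩ | ⟨h0, y, hy, hr⟩
    · simp [h0, h, ht.dn_zero, stateDigit]
    · obtain ⟨y₀, -, -, -, hdn⟩ := ht.of_realizes hs h0 (heq _) hr
      simp [hy, stateDigit, hdn]

end WSPInstance

/-! ### Contracting the leaves of a tree -/

/-- `h` maps each node to the node that it has been contracted into, where leaves of the remaining
graph have been contracted into their neighbours. -/
structure IsContraction {ι : Type*} (G : SimpleGraph ι) (h : ι → ι) : Prop where
  idem : ∀ i, h (h i) = h i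
  adj : ∀ i j, G.Adj i j → h i = h j ∨ (h i = i ∧ h j = j)

namespace IsContraction

variable {ι : Type*} {G : SimpleGraph ι} {h : ι → ι}

theorem id (G : SimpleGraph ι) : IsContraction G fun i => i :=
  ⟨fun _ => rfl, fun _ _ _ => .inr ⟨rfl, rfl⟩⟩

/-- The effect of contracting `v` into `u`. -/
def contract [DecidableEq ι] (h : ι → ι) (u v : ι) (i : ι) : ι := if h i = v then u else h i

variable [DecidableEq ι] {u v : ι}

theorem contract_eq_self_iff (hu : h u = u) (huv : u ≠ v) (i : ι) :
    contract h u v i = i ↔ h i = i ∧ i ≠ v := by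
  unfold contract
  split_ifs with hi
  · constructor
    · rintro rfl
      rw [hu] at hi
      exact absurd hi huv
    · rintro ⟨h1, h2⟩
      exact absurd (h1.symm.trans hi) h2
  · constructor
    · intro h1
      exact ⟨h1, fun h2 => hi (h1.trans h2)⟩
    · exact fun h1 => h1.1

/-- Among the survivors `v` is adjacent to `u` only, and that edge collapses. All other edges keep
their status. -/
theorem contract_isContraction (hc : IsContraction G h) (hu : h u = u) (hv : h v = v) (huv : u ≠ v)
    (hl : ∀ j, G.Adj v j → h j = j → j = u) : IsContraction G (contract h u v) := by
  refine ⟨fun i => ?_, fun i j hij => ?_⟩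
  · rw [contract_eq_self_iff hu huv]
    unfold contract
    split_ifs with hi
    · exact ⟨hu, huv⟩
    · exact ⟨hc.idem i, hi⟩
  · rw [contract_eq_self_iff hu huv, contract_eq_self_iff hu huv]
    rcases hc.adj i j hij with h1 | ⟨h1, h2⟩
    · left; simp [contract, h1]
    · by_cases hi : i = v
      · subst hi
        have := hl j hij h2
        subst this
        left; simp [contract, hv, hu]
      by_cases hj : j = v
      · subst hj
        have := hl i hij.symm h1
        subst this
        left; simp [contract, hv, hu]
      exact .inr ⟨⟨h1, hi⟩, h2, hj⟩

/-- Under `h` an edge of the tree either collapses or stays, so walks are mapped to walks among the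
survivors. These therefore induce a connected acyclic graph, and such a tree with at least two
vertices has a leaf. -/
theorem exists_leaf [Fintype ι] [DecidableRel G.Adj] (hG : G.IsTree) (hc : IsContraction G h)
    {a b : ι} (ha : h a = a) (hb : h b = b) (hab : a ≠ b) :
    ∃ i, h i = i ∧ (Finset.univ.filter fun j => G.Adj i j ∧ h j = j).card = 1 := by
  classical
  let S : Set ι := {i | h i = i}
  have hreach : ∀ i j, G.Reachable i j →
      (G.induce S).Reachable ⟨h i, hc.idem i⟩ ⟨h j, hc.idem j⟩ := by
    rintro i j ⟨p⟩
    induction p with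
    | nil => exact .refl _
    | @cons i j l hij p ih =>
      refine SimpleGraph.Reachable.trans ?_ ih
      rcases hc.adj i j hij with h1 | ⟨h1, h2⟩
      · simp only [h1]; exact .refl _
      · refine SimpleGraph.Adj.reachable ?_
        simp only [SimpleGraph.comap_adj, Function.Embedding.subtype_apply, h1, h2, hij]
  have hconn : (G.induce S).Connected := by
    have : Nonempty S := ⟨⟨a, ha⟩⟩
    refine ⟨fun ⟨i, hi⟩ ⟨j, hj⟩ => ?_⟩
    have := hreach i j (hG.1.preconnected i j)
    simp only [S, Set.mem_ofPred_eq] at hi hj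
    simpa only [hi, hj] using this
  have hT : (G.induce S).IsTree := ⟨hconn, hG.2.induce S⟩
  have : Nontrivial S := ⟨⟨a, ha⟩, ⟨b, hb⟩, fun h => hab (congrArg Subtype.val h)⟩
  obtain ⟨⟨i, hi⟩, hdeg⟩ := hT.exists_vert_degree_one_of_nontrivial
  refine ⟨i, hi, ?_⟩
  rw [SimpleGraph.degree_eq_one_iff_existsUnique_adj] at hdeg
  obtain ⟨⟨j, hj⟩, h1, h2⟩ := hdeg
  rw [Finset.card_eq_one]
  refine ⟨j, Finset.ext fun l => ?_⟩
  simp only [Finset.mem_filter, Finset.mem_univ, true_and, Finset.mem_singleton]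
  constructor
  · rintro ⟨h3, h4⟩
    exact congrArg Subtype.val (h2 ⟨l, h4⟩ h3)
  · rintro rfl
    exact ⟨h1, hj⟩

variable [Fintype ι] [DecidableRel G.Adj]

theorem filter_adj_contract (hu : h u = u) (huv : u ≠ v)
    (hl : ∀ j, G.Adj v j → h j = j → j = u) {i : ι} (hi : h i = i) (hiu : i ≠ u) :
    (Finset.univ.filter fun j => G.Adj i j ∧ contract h u v j = j) =
      Finset.univ.filter fun j => G.Adj i j ∧ h j = j := by
  ext j
  simp only [Finset.mem_filter, Finset.mem_univ, true_and, contract_eq_self_iff hu huv]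
  refine ⟨fun h1 => ⟨h1.1, h1.2.1⟩, fun h1 => ⟨h1.1, h1.2, ?_⟩⟩
  rintro rfl
  exact hiu (hl i h1.1.symm hi)

theorem filter_adj_contract_self (hu : h u = u) (huv : u ≠ v) :
    (Finset.univ.filter fun j => G.Adj u j ∧ contract h u v j = j) =
      (Finset.univ.filter fun j => G.Adj u j ∧ h j = j).erase v := by
  ext j
  simp only [Finset.mem_filter, Finset.mem_univ, true_and, contract_eq_self_iff hu huv,
    Finset.mem_erase]
  tauto

end IsContraction

/-! ### Separation in a tree decomposition -/

/-- As each arc stays within `V` or within `W`, a path can change sides only at a vertex common to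
both. -/
theorem exists_mem_inter_of_transGen {α : Type*} {r : α → α → Prop} {V W : Set α}
    (harc : ∀ a b, r a b → (a ∈ V ∧ b ∈ V) ∨ (a ∈ W ∧ b ∈ W)) {x y : α}
    (h : Relation.TransGen r x y) (hxy : (x ∈ V ∧ y ∈ W) ∨ (x ∈ W ∧ y ∈ V)) :
    ∃ w, w ∈ V ∧ w ∈ W ∧ Relation.ReflTransGen r x w ∧ Relation.ReflTransGen r w y := by
  induction h using Relation.TransGen.head_induction_on with
  | single h =>
    rename_i a
    rcases harc _ _ h with h1 | h1 <;> rcases hxy with h2 | h2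
    · exact ⟨y, h1.2, h2.2, .single h, .refl⟩
    · exact ⟨a, h1.1, h2.1, .refl, .single h⟩
    · exact ⟨a, h2.1, h1.1, .refl, .single h⟩
    · exact ⟨y, h2.2, h1.2, .single h, .refl⟩
  | head h hr ih =>
    rename_i a b
    by_cases hb : a ∈ V ∧ a ∈ W
    · exact ⟨a, hb.1, hb.2, .refl, (Relation.TransGen.head h hr).to_reflTransGen⟩
    obtain ⟨w, h1, h2, h3, h4⟩ := ih (by
      rcases harc _ _ h with h1 | h1 <;> tauto)
    exact ⟨w, h1, h2, .head h h3, h4⟩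

namespace TreeDecomposition

variable {n k N : ℕ} {I : WSPInstance n k} {D : Digraph (Fin n)}

/-- The users in bags of nodes contracted into `u`, but not in the bag of `u`. -/
def forgotten (X : TreeDecomposition D (Fin N)) (h : Fin N → Fin N) (u : Fin N) : Set (Fin n) :=
  {x | (∃ i, h i = u ∧ x ∈ X.bag i) ∧ x ∉ X.bag u}

variable (X : TreeDecomposition D (Fin N)) {h : Fin N → Fin N} {u v : Fin N}

/-- The nodes whose bags contain `x` are connected, so a walk among them leaves `C`; it can do so
only along the edge from `v` to `u`. -/
theorem mem_bag_of_crossing {C : Set (Fin N)}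
    (hC : ∀ i j, X.tree.Adj i j → i ∈ C → j ∉ C → i = v ∧ j = u) {x : Fin n} {i j : Fin N}
    (hi : i ∈ C) (hj : j ∉ C) (hxi : x ∈ X.bag i) (hxj : x ∈ X.bag j) :
    x ∈ X.bag v ∧ x ∈ X.bag u := by
  obtain ⟨p⟩ := (X.connected x).preconnected ⟨i, hxi⟩ ⟨j, hxj⟩
  obtain ⟨d, -, h1, h2⟩ := p.exists_boundary_dart {y | y.1 ∈ C} hi hj
  obtain ⟨h3, h4⟩ := hC _ _ d.adj h1 h2
  rw [← h3, ← h4]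
  exact ⟨d.fst.2, d.snd.2⟩

/-- Let `V` be the users in bags contracted into `v`, and `W` the users in the remaining bags. The
edge from `v` to `u` is the only one between the two groups of nodes, hence `V ∩ W` lies in both
bags. Each arc of `D` stays in `V` or in `W`, so a path representing an order relation between the
sides meets `V ∩ W`. -/
theorem separated_of_leaf (hD : IsReducedGraph D I.lt) (P : X.Listing)
    (hc : IsContraction X.tree h) (hu : h u = u) (hv : h v = v) (huv : u ≠ v)
    (hl : ∀ j, X.tree.Adj v j → h j = j → j = u) :
    I.Separated (X.forgotten h u) (X.forgotten h v) (P.elems u) (P.elems v) := by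
  have hC : ∀ i j, X.tree.Adj i j → i ∈ {i | h i = v} → j ∉ {i | h i = v} → i = v ∧ j = u := by
    intro i j hij hi hj
    simp only [Set.mem_ofPred_eq] at hi hj
    rcases hc.adj i j hij with h1 | ⟨h1, h2⟩
    · exact absurd (h1.symm.trans hi) hj
    · have : i = v := h1.symm.trans hi
      subst this
      exact ⟨rfl, hl j hij h2⟩
  let V : Set (Fin n) := {x | ∃ i, h i = v ∧ x ∈ X.bag i}
  let W : Set (Fin n) := {x | ∃ i, h i ≠ v ∧ x ∈ X.bag i}
  have hVW : ∀ x, x ∈ V → x ∈ W → x ∈ X.bag v ∧ x ∈ X.bag u := by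
    rintro x ⟨i, hi, hxi⟩ ⟨j, hj, hxj⟩
    exact X.mem_bag_of_crossing hC hi hj hxi hxj
  have harc : ∀ a b, D.Adj a b → (a ∈ V ∧ b ∈ V) ∨ (a ∈ W ∧ b ∈ W) := by
    intro a b hab
    obtain ⟨i, h1, h2⟩ := X.exists_arc_bag a b hab
    by_cases hi : h i = v
    · exact .inl ⟨⟨i, hi, h1⟩, ⟨i, hi, h2⟩⟩
    · exact .inr ⟨⟨i, hi, h1⟩, ⟨i, hi, h2⟩⟩
  have huW : ∀ x, x ∈ X.forgotten h u ∨ x ∈ P.elems u → x ∈ W := by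
    rintro x (⟨⟨i, hi, hx⟩, -⟩ | hx)
    · exact ⟨i, by rwa [hi], hx⟩
    · exact ⟨u, by rwa [hu], (P.mem_elems u x).1 hx⟩
  have hvV : ∀ x, x ∈ X.forgotten h v ∨ x ∈ P.elems v → x ∈ V := by
    rintro x (⟨⟨i, hi, hx⟩, -⟩ | hx)
    · exact ⟨i, hi, hx⟩
    · exact ⟨v, hv, (P.mem_elems v x).1 hx⟩
  have hle : ∀ {a b}, Relation.ReflTransGen D.Adj a b → a = b ∨ I.lt a b := by
    intro a b hab
    rcases Relation.reflTransGen_iff_eq_or_transGen.1 hab with h1 | h1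
    · exact .inl h1.symm
    · exact .inr ((hD.closure_eq a b).1 h1)
  refine ⟨?_, ?_, ?_, ?_, ?_, ?_, ?_⟩
  · intro x hx h1
    exact hx.2 ((P.mem_elems u x).1 h1)
  · intro x hx h1
    exact hx.2 (hVW x (hvV x (.inr h1)) (huW x (.inl hx))).2
  · intro x hx h1
    exact hx.2 (hVW x (hvV x (.inl hx)) (huW x (.inr h1))).1
  · intro x hx h1
    exact hx.2 ((P.mem_elems v x).1 h1)
  · intro x hx h1
    exact hx.2 (hVW x (hvV x (.inl h1)) (huW x (.inl hx))).2
  · intro x y hx hy hlt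
    obtain ⟨w, h1, h2, h3, h4⟩ := exists_mem_inter_of_transGen harc ((hD.closure_eq x y).2 hlt)
      (.inr ⟨huW x hx, hvV y hy⟩)
    obtain ⟨h5, h6⟩ := hVW w h1 h2
    exact ⟨w, (P.mem_elems u w).2 h6, (P.mem_elems v w).2 h5, hle h3, hle h4⟩
  · intro x y hx hy hlt
    obtain ⟨w, h1, h2, h3, h4⟩ := exists_mem_inter_of_transGen harc ((hD.closure_eq y x).2 hlt)
      (.inl ⟨hvV y hy, huW x hx⟩)
    obtain ⟨h5, h6⟩ := hVW w h1 h2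
    exact ⟨w, (P.mem_elems u w).2 h6, (P.mem_elems v w).2 h5, hle h3, hle h4⟩

/-- Separation ensures that users forgotten at `v` do not reappear in the bag of `u`. The users that
become forgotten are those in the bag of `v` but not in the bag of `u`. -/
theorem forgotten_contract_self (P : X.Listing) (hv : h v = v)
    (hs : I.Separated (X.forgotten h u) (X.forgotten h v) (P.elems u) (P.elems v)) :
    X.forgotten (IsContraction.contract h u v) u =
      X.forgotten h u ∪ X.forgotten h v ∪ {w | w ∈ P.elems v ∧ w ∉ P.elems u} := by
  ext x
  constructor
  · rintro ⟨⟨i, hi, hx⟩, hxu⟩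
    unfold IsContraction.contract at hi
    split_ifs at hi with h1
    · by_cases hxv : x ∈ X.bag v
      · exact .inr ⟨(P.mem_elems v x).2 hxv, fun h => hxu ((P.mem_elems u x).1 h)⟩
      · exact .inl (.inr ⟨⟨i, h1, hx⟩, hxv⟩)
    · exact .inl (.inl ⟨⟨i, hi, hx⟩, hxu⟩)
  · rintro ((hx | hx) | hx)
    · obtain ⟨⟨i, hi, hx⟩, hxu⟩ := hx
      refine ⟨⟨i, ?_, hx⟩, hxu⟩
      unfold IsContraction.contract
      split_ifs
      · rfl
      · exact hi
    · obtain ⟨i, hi, hx'⟩ := hx.1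
      refine ⟨⟨i, ?_, hx'⟩, fun h => hs.notMem_vu x hx ((P.mem_elems u x).2 h)⟩
      simp [IsContraction.contract, hi]
    · refine ⟨⟨v, ?_, (P.mem_elems v x).1 hx.1⟩, fun h => hx.2 ((P.mem_elems u x).2 h)⟩
      simp [IsContraction.contract, hv]

theorem forgotten_contract_of_ne {i : Fin N} (hiu : i ≠ u) (hiv : i ≠ v) :
    X.forgotten (IsContraction.contract h u v) i = X.forgotten h i := by
  have : ∀ j, IsContraction.contract h u v j = i ↔ h j = i := by
    intro j
    unfold IsContraction.contract
    split_ifs with h1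
    · rw [h1]; exact ⟨fun h => absurd h.symm hiu, fun h => absurd h.symm hiv⟩
    · rfl
  simp only [forgotten, this]

theorem forgotten_id (i : Fin N) : X.forgotten (fun i => i) i = ∅ := by
  ext x
  simp only [forgotten, exists_eq_left, Set.mem_ofPred_eq, Set.mem_empty_iff_false, iff_false]
  tauto

end TreeDecomposition

/-! ### The final merge into an empty bag -/

namespace WSPInstance

variable {n k N : ℕ} {I : WSPInstance n k} {D : Digraph (Fin n)}

/-- One side has neither users nor a bag, so the conditions on order relations are vacuous. -/
theorem separated_nil {F : Set (Fin n)} {L : List (Fin n)} (h : ∀ y ∈ F, y ∉ L) :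
    I.Separated ∅ F [] L := by
  constructor <;> simp_all

theorem forgotten_root_union (X : TreeDecomposition D (Fin N)) (P : X.Listing)
    {h : Fin N → Fin N} {u : Fin N} (hu : ∀ i, h i = u) :
    (∅ : Set (Fin n)) ∪ X.forgotten h u ∪ {w | w ∈ P.elems u ∧ w ∉ ([] : List (Fin n))} =
      Set.univ := by
  ext x
  obtain ⟨i, hi⟩ := X.exists_mem_bag x
  simp only [TreeDecomposition.forgotten, hu, true_and, P.mem_elems, Set.empty_union,
    List.not_mem_nil, not_false_eq_true, and_true, Set.mem_union, Set.mem_ofPred_eq, Set.mem_univ,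
    iff_true]
  by_cases hx : x ∈ X.bag u
  · exact .inr hx
  · exact .inl ⟨⟨i, hi⟩, hx⟩

end WSPInstance

/-! ### The algorithm -/

namespace ArrayLang

instance : Coe Reg Ex := ⟨Ex.reg⟩
instance (m : ℕ) : OfNat Ex m := ⟨.const m⟩
instance : Add Ex := ⟨.add⟩
instance : Sub Ex := ⟨.sub⟩

/-- Disjunction of conditions. -/
def Cn.or (c d : Cn) : Cn := .not (.and (.not c) (.not d))

/-- Negated equality. -/
def Cn.ne (a b : Ex) : Cn := .not (.eq a b)

/-- Sequential composition of a list of commands. -/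
def Cmd.block : List Cmd → Cmd
  | [] => .skip
  | c :: l => .seq c (Cmd.block l)

section

variable (inp : RAM.Input) (σ : St)

@[simp] theorem eval_coe (x : Reg) : (Ex.reg x).eval inp σ = σ.reg x := rfl
@[simp] theorem eval_ofNat (m : ℕ) : (no_index (OfNat.ofNat m : Ex)).eval inp σ = OfNat.ofNat m := rfl
@[simp] theorem eval_add (a b : Ex) : (a + b).eval inp σ = a.eval inp σ + b.eval inp σ := rfl
@[simp] theorem eval_sub (a b : Ex) : (a - b).eval inp σ = a.eval inp σ - b.eval inp σ := rfl
@[simp] theorem eval_arr (t : Arr) (i : Ex) : (Ex.arr t i).eval inp σ = σ.arr t (i.eval inp σ) := rfl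
@[simp] theorem eval_inp (t : ℕ) (i j : Ex) :
    (Ex.inp t i j).eval inp σ = inp t (i.eval inp σ) (j.eval inp σ) := rfl
@[simp] theorem holds_eq (a b : Ex) : (Cn.eq a b).holds inp σ ↔ a.eval inp σ = b.eval inp σ := Iff.rfl
@[simp] theorem holds_ne (a b : Ex) : (Cn.ne a b).holds inp σ ↔ a.eval inp σ ≠ b.eval inp σ := Iff.rfl
@[simp] theorem holds_lt (a b : Ex) : (Cn.lt a b).holds inp σ ↔ a.eval inp σ < b.eval inp σ := Iff.rfl
@[simp] theorem holds_and (c d : Cn) : (Cn.and c d).holds inp σ ↔ c.holds inp σ ∧ d.holds inp σ := Iff.rfl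
@[simp] theorem holds_not (c : Cn) : (Cn.not c).holds inp σ ↔ ¬ c.holds inp σ := Iff.rfl
@[simp] theorem holds_or (c d : Cn) : (Cn.or c d).holds inp σ ↔ c.holds inp σ ∨ d.holds inp σ := by
  simp only [Cn.or, Cn.holds]; tauto
@[simp] theorem exec_skip : exec inp .skip σ = σ := rfl
@[simp] theorem exec_set (x : Reg) (e : Ex) : exec inp (.set x e) σ = σ.setReg x (e.eval inp σ) := rfl
@[simp] theorem exec_put (t : Arr) (i e : Ex) :
    exec inp (.put t i e) σ = σ.setArr t (i.eval inp σ) (e.eval inp σ) := rfl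
@[simp] theorem exec_seq (p q : Cmd) : exec inp (.seq p q) σ = exec inp q (exec inp p σ) := rfl
open Classical in
@[simp] theorem exec_ite (c : Cn) (p q : Cmd) :
    exec inp (.ite c p q) σ = if c.holds inp σ then exec inp p σ else exec inp q σ := rfl
@[simp] theorem exec_block_nil : exec inp (.block []) σ = σ := rfl
@[simp] theorem exec_block_cons (c : Cmd) (l : List Cmd) :
    exec inp (.block (c :: l)) σ = exec inp (.block l) (exec inp c σ) := rfl

end

open Reg Arr

/-- Determine the user, the class and the digits of the option `ro`. -/
def selectOption : Cmd :=
  .ite (.not (.lt rg ro))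
    (.block [.set rcls 1, .set rdu ro, .set rdv 0,
      .set ry (.arr arep (.arr arbase ru + (ro - 1)))])
    (.ite (.not (.lt (rg + rg) ro))
      (.block [.set rcls 2, .set rdu 0, .set rdv (ro - rg),
        .set ry (.arr arep (.arr arbase rv + (ro - rg - 1)))])
      (.block [.set rcls 3, .set rdu 0, .set rdv 0, .set rw (ro - (rg + rg) - 1),
        .ite (.lt rw (.inp 7 rv 0)) (.set ry (.inp 7 rv (rw + 1) + 1)) (.set ry 0)]))

/-- Compare the user `ry - 1` with the element number `rj` of the bag of `ru`. -/
def compareStep : Cmd :=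
  .ite (.lt rj (.inp 7 ru 0))
    (.block [.set rw (.inp 7 ru (rj + 1)),
      .set rcode (rcode + rcode + rcode +
        (.inp 5 (ry - 1) rw + (.inp 5 rw (ry - 1) + .inp 5 rw (ry - 1)))),
      .ite (.eq (rw + 1) ry) (.set rdup 1) .skip]) .skip

/-- Compute the type of the user `ry - 1` over the bag of `ru`. -/
def computeType : Cmd :=
  .block [.set rcode 0, .set rdup 0, .loop rj rb compareStep]

/-- Enter the option `ro` into the tables. -/
def storeOption : Cmd :=
  -- For a void option the entries made here may be meaningless; class 4 prevents their use. A later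
  -- user of the same type may replace an earlier representative, which does no harm.
  .block [.put ausr ro ry, .put adu ro rdu, .put adv ro rdv, .put adn ro (rcode + 1),
    .ite (.or (.eq ry 0) (.eq rdup 1)) (.put acls ro 4)
      (.block [.put acls ro rcls, .put arep (rfresh2 + rcode) ry])]

/-- Build the table entries of the option `ro`. -/
def buildOption : Cmd :=
  .ite (.eq ro 0) .skip (.block [selectOption, computeType, storeOption])

/-- Build the tables of all options. -/
def buildOptions : Cmd := .loop ro rq buildOption

/-- The condition that the options `re1` and `re2` for the steps `rs` and `rs2` conflict. -/
def pairCond : Cn :=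
  .and (.ne (.arr acls re1) 0) (.and (.ne (.arr acls re2) 0)
    (.and (.not (.and (.eq (.arr acls re1) (.arr acls re2)) (.ne (.arr acls re1) 3)))
      (.or (.and (.ne (.inp 2 rs rs2) 0) (.ne (.arr ausr re1) (.arr ausr re2)))
        (.or (.and (.ne (.inp 3 rs rs2) 0) (.eq (.arr ausr re1) (.arr ausr re2)))
          (.and (.ne (.inp 4 rs rs2) 0)
            (.eq (.inp 5 (.arr ausr re1 - 1) (.arr ausr re2 - 1)) 0))))))

/-- The condition that the option `re1` is not available for the step `rs`. -/
def stepCond : Cn :=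
  .or (.eq (.arr acls re1) 4)
    (.and (.eq (.arr acls re1) 3) (.eq (.inp 1 rs (.arr ausr re1 - 1)) 0))

/-- Look for a conflict of the steps `rs` and `rs2`. -/
def checkPair : Cmd :=
  .block [.set re2 (.arr adig rs2), .ite pairCond (.set rbad 1) .skip]

/-- Look for conflicts of the step `rs`, and update the addresses of table entries. -/
def checkStep : Cmd :=
  .block [.set re1 (.arr adig rs),
    .set ra1 (ra1 + .arr apw (rbase + .arr adu re1)),
    .set ra2 (ra2 + .arr apw (rbase + .arr adv re1)),
    .set ra3 (ra3 + .arr apw (rbase + .arr adn re1)),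
    .set rbase (rbase + rq),
    .ite stepCond (.set rbad 1) .skip,
    .loop rs2 rk checkPair]

/-- Add the carry to the digit `rs` of the counter. -/
def carryStep : Cmd :=
  .ite (.eq rcarry 1)
    (.block [.put adig rs (.arr adig rs + 1),
      .ite (.eq (.arr adig rs) rq) (.put adig rs 0) (.set rcarry 0)]) .skip

/-- Increment the counter `adig`, a number in base `rq`. -/
def incrementCounter : Cmd := .block [.set rcarry 1, .loop rs rk carryStep]

/-- Process the options given by the counter. -/
def processState : Cmd :=
  .block [.set rbad 0, .set ra1 (.arr atbase ru), .set ra2 (.arr atbase rv), .set ra3 rfresh,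
    .set rbase 0, .loop rs rk checkStep,
    .ite (.and (.eq rbad 0) (.and (.ne (.arr atab ra1) 0) (.ne (.arr atab ra2) 0)))
      (.put atab ra3 1) .skip,
    incrementCounter]

/-- Merge the part of the node `rv` into the part of the node `ru`. -/
def merge : Cmd :=
  -- The new tables go into untouched memory, which is still zero, so that no table ever has to be
  -- cleared. Old tables are abandoned.
  .block [buildOptions, .loop rx rqk processState, .put atbase ru rfresh, .put arbase ru rfresh2,
    .set rfresh (rfresh + rqk), .set rfresh2 (rfresh2 + rq)]

/-- Contract the leaf `rv` into its neighbour. -/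
def contractLeaf : Cmd :=
  -- The sum of the remaining neighbours of a leaf is its only neighbour. The search goes on at that
  -- neighbour, which may have become a leaf.
  .block [.set ru (.arr anbr rv), merge, .put adeg rv 0,
    .put adeg ru (.arr adeg ru - 1), .put anbr ru (.arr anbr ru - rv), .set rv ru,
    .set rroot ru]

/-- Contract the node `rv` if it is a leaf, and otherwise go on to the next node. -/
def contractStep : Cmd :=
  .ite (.lt ri rN)
    (.ite (.eq (.arr adeg rv) 1) contractLeaf (.block [.set ri (ri + 1), .set rv ri])) .skip

/-- Contract the tree into a single node. -/
def contractTree : Cmd := .loop rit rn2 contractStep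

/-- Update the address of the table entry for the state all of whose digits are one. -/
def answerStep : Cmd := .block [.set ra1 (ra1 + .arr apw (rbase + 1)), .set rbase (rbase + rq)]

/-- Read off the answer from the table of the node `rN`. -/
def readAnswer : Cmd :=
  .block [.set ra1 (.arr atbase rN), .set rbase 0, .loop rs rk answerStep,
    .set rout (.arr atab ra1)]

/-- Compare the size of the bag of `rm` with the maximum so far. -/
def maxStep : Cmd := .ite (.lt rb (.inp 7 rm 0)) (.set rb (.inp 7 rm 0)) .skip

/-- Compute the size of the largest bag. -/
def maxBag : Cmd := .block [.set rb 0, .loop rm rN maxStep]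

/-- Compute the number of types. -/
def countTypes : Cmd := .block [.set rg 1, .loop rj rb (.set rg (rg + rg + rg))]

/-- Write one multiple of the current power. -/
def multipleStep : Cmd :=
  .block [.put apw rptr racc, .set racc (racc + rp), .set rptr (rptr + 1)]

/-- Write the multiples of the current power. -/
def powerStep : Cmd := .block [.set racc 0, .loop ro rq multipleStep, .set rp racc]

/-- Tabulate multiples of powers of `rq`. -/
def tabulatePowers : Cmd :=
  .block [.set rp 1, .set rptr 0, .loop rs rk powerStep, .set rqk rp]

/-- Count the edge number `rm`. -/
def edgeStep : Cmd :=
  .block [.set re1 (.inp 6 rm 0), .set re2 (.inp 6 rm 1),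
    .put adeg re1 (.arr adeg re1 + 1), .put anbr re1 (.arr anbr re1 + re2),
    .put adeg re2 (.arr adeg re2 + 1), .put anbr re2 (.arr anbr re2 + re1)]

/-- Compute the degrees and the sums of the neighbours of the nodes. -/
def readTree : Cmd := .loop rm rn1 edgeStep

/-- Start with tables that contain the empty plan only. -/
def initTables : Cmd :=
  -- At the start all nodes share the state table and the representative table at address 0. State
  -- number 0 is the empty plan, the only one into an empty part, and there are no representatives.
  .block [.put atab 0 1, .set rfresh rqk, .set rfresh2 rq, .set rn2 (rN + rN)]

/-- Merge the root into an empty bag and read off the answer. -/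
def finish : Cmd := .block [.set rv rroot, .set ru rN, merge, readAnswer]

/-- The algorithm for at least two steps. -/
def dynamicProgram : Cmd :=
  .block [.set rN (.inp 0 0 2), maxBag, countTypes, .set rq (rg + rg + rb + 1), tabulatePowers,
    .set rn1 (rN - 1), readTree, initTables, contractTree, finish]

/-- Try the user `rm` for the only step. -/
def tryUser : Cmd :=
  .ite (.and (.ne (.inp 1 0 rm) 0) (.and (.eq (.inp 3 0 0) 0) (.eq (.inp 4 0 0) 0)))
    (.set rout 1) .skip

/-- The algorithm for one step. -/
def tryUsers : Cmd := .block [.set rn (.inp 0 0 0), .loop rm rn tryUser]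

/-- The algorithm. -/
def decideWSP : Cmd :=
  -- For a single step the option tables would cost an extra factor of the bag size, which the time
  -- bound does not provide.
  .block [.set rk (.inp 0 0 1), .ite (.eq rk 1) tryUsers dynamicProgram]


end ArrayLang

/-! ### Correctness of the tables of options and representatives -/

open ArrayLang Reg Arr

/-- The row `u` of array 7 lists the users `L`. -/
structure ListsBag {n : ℕ} (inp : RAM.Input) (u : ℕ) (L : List (Fin n)) : Prop where
  length : inp 7 u 0 = L.length
  get : ∀ j (hj : j < L.length), inp 7 u (j + 1) = L[j]

namespace WSPInstance

variable {n k : ℕ} {I : WSPInstance n k} {Fu Fv : Set (Fin n)} {Lu Lv : List (Fin n)}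
  {inp : RAM.Input}

/-- `rep` lists, from `base` on, a representative in `F` for each type over `L`. -/
def IsRepTable (I : WSPInstance n k) (rep : ℕ → ℕ) (base g : ℕ) (F : Set (Fin n))
    (L : List (Fin n)) : Prop :=
  (∀ c < g, rep (base + c) ≠ 0 → ∃ y ∈ F, rep (base + c) = y + 1 ∧ I.typeCode L y = c) ∧
    ∀ y ∈ F, rep (base + I.typeCode L y) ≠ 0

theorem exec_computeType (hinp : Encodes inp I) {σ : St} {y : Fin n} (hy : σ.reg ry = y + 1)
    (hL : ListsBag inp (σ.reg ru) Lu) (hb : Lu.length ≤ σ.reg rb) :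
    (exec inp computeType σ).reg rcode = I.typeCode Lu y ∧
      ((exec inp computeType σ).reg rdup = 1 ↔ y ∈ Lu) := by
  simp only [computeType, exec_block_cons, exec_block_nil, exec_set, eval_ofNat]
  obtain ⟨τ, hτ, he⟩ := exec_loop inp (x := rj) (y := rb) (p := compareStep)
    (σ := (σ.setReg rcode 0).setReg rdup 0)
    (fun i τ => τ.reg rcode = I.typeCode (Lu.take i) y ∧ (τ.reg rdup = 1 ↔ y ∈ Lu.take i))
    (by simp [typeCode]) (by
      intro i hi τ hτ _ ⟨h1, h2⟩
      have hu : τ.reg ru = σ.reg ru := by rw [hτ ru rfl]; simp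
      have hy' : τ.reg ry = y + 1 := by rw [hτ ry rfl]; simpa using hy
      by_cases hiL : i < Lu.length
      · have hg := hL.get i hiL
        have ht : Lu.take (i + 1) = Lu.take i ++ [Lu[i]] := (List.take_concat_get' Lu i hiL).symm
        rw [ht, typeCode_concat, compareDigit_eq hinp]
        by_cases hw : Lu[i] = y
        · simp [compareStep, hu, hL.length, hiL, hg, hy', h1, hw]
          omega
        · have hw' : (Lu[i] : ℕ) ≠ y := fun h => hw (Fin.ext h)
          simp [compareStep, hu, hL.length, hiL, hg, hy', h1, hw', h2]
          refine ⟨by omega, ?_⟩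
          rw [ht, List.mem_append, List.mem_singleton]
          exact ⟨.inl, fun h => h.resolve_right fun h => hw h.symm⟩
      -- The loop runs up to the largest bag size; beyond the end of this bag the body is idle.
      · rw [List.take_of_length_le (by omega)] at h1 h2 ⊢
        simp [compareStep, hu, hL.length, hiL, h1, h2])
  rw [he]
  have : ((σ.setReg rcode 0).setReg rdup 0).reg rb = σ.reg rb := by simp
  rw [this, List.take_of_length_le hb] at hτ
  simpa using hτ

/-- The class, the digits and the user that are found for an option. -/
theorem exec_selectOption (hs : I.Separated Fu Fv Lu Lv) {g : ℕ} {σ : St} (hg : σ.reg rg = g)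
    (hu : I.IsRepTable (σ.arr arep) (σ.arr arbase (σ.reg ru)) g Fu Lu)
    (hv : I.IsRepTable (σ.arr arep) (σ.arr arbase (σ.reg rv)) g Fv Lv)
    (hL : ListsBag inp (σ.reg rv) Lv) {o : ℕ} (ho : σ.reg ro = o) (h0 : 0 < o) :
    let τ := exec inp selectOption σ
    τ.reg rcls = optionClass g o ∧ τ.reg rdu = (if o ≤ g then o else 0) ∧
    τ.reg rdv = (if g < o ∧ o ≤ 2 * g then o - g else 0) ∧
    ((τ.reg ry = 0 ∧ ∀ y, ¬ I.Realizes g Fu Fv Lu Lv o y) ∨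
      ∃ y : Fin n, τ.reg ry = y + 1 ∧ (y ∉ Lu → I.Realizes g Fu Fv Lu Lv o y) ∧
        (y ∈ Lu → ∀ y', ¬ I.Realizes g Fu Fv Lu Lv o y')) := by
  intro τ
  by_cases h1 : o ≤ g
  · have hτ : τ.reg rcls = 1 ∧ τ.reg rdu = o ∧ τ.reg rdv = 0 ∧
        τ.reg ry = σ.arr arep (σ.arr arbase (σ.reg ru) + (o - 1)) := by
      simp [τ, selectOption, hg, ho, h1.not_gt]
    refine ⟨by simp [hτ.1, optionClass, h1], by simp [hτ.2.1, h1],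
      by simp [hτ.2.2.1, h1.not_gt], ?_⟩
    rw [hτ.2.2.2]
    by_cases hz : σ.arr arep (σ.arr arbase (σ.reg ru) + (o - 1)) = 0
    · refine .inl ⟨hz, ?_⟩
      rintro y (h | h | h)
      · refine hu.2 y h.2.1 ?_
        rwa [show I.typeCode Lu y = o - 1 by omega]
      · omega
      · omega
    · obtain ⟨y, hy, hy1, hy2⟩ := hu.1 (o - 1) (by omega) hz
      exact .inr ⟨y, hy1, fun _ => .inl ⟨h1, hy, by omega⟩,
        fun h => absurd h (hs.notMem_uu y hy)⟩
  by_cases h2 : o ≤ 2 * g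
  · have hτ : τ.reg rcls = 2 ∧ τ.reg rdu = 0 ∧ τ.reg rdv = o - g ∧
        τ.reg ry = σ.arr arep (σ.arr arbase (σ.reg rv) + (o - g - 1)) := by
      have : ¬ (g + g < o) := by omega
      simp [τ, selectOption, hg, ho, not_le.1 h1, this]
    refine ⟨by simp [hτ.1, optionClass, h1, h2], by simp [hτ.2.1, h1],
      by simp [hτ.2.2.1, not_le.1 h1, h2], ?_⟩
    rw [hτ.2.2.2]
    by_cases hz : σ.arr arep (σ.arr arbase (σ.reg rv) + (o - g - 1)) = 0
    · refine .inl ⟨hz, ?_⟩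
      rintro y (h | h | h)
      · omega
      · refine hv.2 y h.2.2.1 ?_
        rwa [show I.typeCode Lv y = o - g - 1 by omega]
      · omega
    · obtain ⟨y, hy, hy1, hy2⟩ := hv.1 (o - g - 1) (by omega) hz
      exact .inr ⟨y, hy1, fun _ => .inr (.inl ⟨by omega, h2, hy, by omega⟩),
        fun h => absurd h (hs.notMem_vu y hy)⟩
  · have hτ : τ.reg rcls = 3 ∧ τ.reg rdu = 0 ∧ τ.reg rdv = 0 ∧
        τ.reg ry = if o - 2 * g - 1 < Lv.length then inp 7 (σ.reg rv) (o - 2 * g - 1 + 1) + 1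
          else 0 := by
      have : g + g < o := by omega
      simp only [τ, selectOption, hg, ho, not_le.1 h1, this, exec_ite, holds_not, holds_lt,
        eval_coe, eval_add, not_true_eq_false, if_false, exec_block_cons, exec_block_nil, exec_set,
        St.reg_setReg, eval_inp, eval_sub, eval_ofNat, two_mul, reduceCtorEq, hL.length, if_true]
      split_ifs <;> simp
    refine ⟨by simp [hτ.1, optionClass, h1, h2], by simp [hτ.2.1, h1],
      by simp [hτ.2.2.1, h2], ?_⟩
    rw [hτ.2.2.2]
    by_cases hl : o - 2 * g - 1 < Lv.length
    · have hsome : Lv[o - 2 * g - 1]? = some Lv[o - 2 * g - 1] := List.getElem?_eq_getElem hl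
      rw [if_pos hl, hL.get _ hl]
      refine .inr ⟨_, rfl, fun h => .inr (.inr ⟨by omega, hsome, h⟩), ?_⟩
      rintro hmem y' (h | h | h)
      · omega
      · omega
      · rw [hsome, Option.some_inj] at h
        exact h.2.2 (h.2.1 ▸ hmem)
    · rw [if_neg hl]
      refine .inl ⟨rfl, ?_⟩
      rintro y (h | h | h)
      · omega
      · omega
      · rw [List.getElem?_eq_none (by omega)] at h
        simp at h

/-- The entries of the option `o` in the tables are correct. -/
def IsOptionEntry (I : WSPInstance n k) (g : ℕ) (Fu Fv : Set (Fin n)) (Lu Lv : List (Fin n))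
    (usr cls du dv dn : ℕ → ℕ) (o : ℕ) : Prop :=
  du o = (if o ≤ g then o else 0) ∧ dv o = (if g < o ∧ o ≤ 2 * g then o - g else 0) ∧
    ((cls o = 4 ∧ ∀ y, ¬ I.Realizes g Fu Fv Lu Lv o y) ∨
    ∃ y : Fin n, I.Realizes g Fu Fv Lu Lv o y ∧ usr o = y + 1 ∧ cls o = optionClass g o ∧
      dn o = I.typeCode Lu y + 1)

/-- An option is void for two reasons: no user was found, or the element of `Lv` found also lies in
`Lu` and so is not yet forgotten. A valid option also supplies a representative for the merged part.
-/
theorem exec_buildOption (hinp : Encodes inp I) (hs : I.Separated Fu Fv Lu Lv) {g : ℕ} {σ : St}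
    (hg : σ.reg rg = g)
    (hu : I.IsRepTable (σ.arr arep) (σ.arr arbase (σ.reg ru)) g Fu Lu)
    (hv : I.IsRepTable (σ.arr arep) (σ.arr arbase (σ.reg rv)) g Fv Lv)
    (hLu : ListsBag inp (σ.reg ru) Lu) (hLv : ListsBag inp (σ.reg rv) Lv)
    (hb : Lu.length ≤ σ.reg rb) {o : ℕ} (ho : σ.reg ro = o) (h0 : 0 < o) :
    let τ := exec inp buildOption σ
    I.IsOptionEntry g Fu Fv Lu Lv (τ.arr ausr) (τ.arr acls) (τ.arr adu) (τ.arr adv) (τ.arr adn) o ∧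
    (∀ o' ≠ o, τ.arr ausr o' = σ.arr ausr o' ∧ τ.arr acls o' = σ.arr acls o' ∧
      τ.arr adu o' = σ.arr adu o' ∧ τ.arr adv o' = σ.arr adv o' ∧ τ.arr adn o' = σ.arr adn o') ∧
    ((τ.arr arep = σ.arr arep ∧ ∀ y, ¬ I.Realizes g Fu Fv Lu Lv o y) ∨
      ∃ y : Fin n, I.Realizes g Fu Fv Lu Lv o y ∧
        τ.arr arep = Function.update (σ.arr arep) (σ.reg rfresh2 + I.typeCode Lu y) (y + 1)) := by
  intro τ
  obtain ⟨h1, h2, h3, h4⟩ := exec_selectOption (inp := inp) hs hg hu hv hLv ho h0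
  set σ₁ := exec inp selectOption σ with hσ₁
  have hk : ∀ c, selectOption.keeps c = true → σ₁.reg c = σ.reg c :=
    fun c hc => exec_reg_of_keeps inp hc σ
  have ha : σ₁.arr = σ.arr := funext fun t => exec_arr_of_keepsArr inp (by cases t <;> rfl) σ
  set σ₂ := exec inp computeType σ₁ with hσ₂
  have hk2 : ∀ c, computeType.keeps c = true → σ₂.reg c = σ₁.reg c :=
    fun c hc => exec_reg_of_keeps inp hc σ₁
  have ha2 : σ₂.arr = σ.arr := by
    rw [← ha]
    exact funext fun t => exec_arr_of_keepsArr inp (by cases t <;> rfl) σ₁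
  have hτ : τ = exec inp storeOption σ₂ := by
    simp [τ, buildOption, ho, h0.ne', σ₂, σ₁]
  have e1 : σ₂.reg ro = o := by rw [hk2 ro rfl, hk ro rfl, ho]
  have e2 : σ₂.reg rfresh2 = σ.reg rfresh2 := by rw [hk2 rfresh2 rfl, hk rfresh2 rfl]
  have e3 : σ₂.reg rcls = optionClass g o := by rw [hk2 rcls rfl, h1]
  have e4 := (hk2 rdu rfl).trans h2
  have e5 := (hk2 rdv rfl).trans h3
  have e6 := hk2 ry rfl
  have hd : τ.arr adu o = (if o ≤ g then o else 0) ∧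
      τ.arr adv o = (if g < o ∧ o ≤ 2 * g then o - g else 0) := by
    rw [hτ]
    by_cases hc : σ₂.reg ry = 0 ∨ σ₂.reg rdup = 1 <;> simp [storeOption, hc, e1, e4, e5]
  refine ⟨⟨hd.1, hd.2, ?_⟩, fun o' ho' => ?_, ?_⟩
  · rcases h4 with ⟨hy, hr⟩ | ⟨y, hy, hr1, hr2⟩
    · refine .inl ⟨?_, hr⟩
      rw [hτ]
      simp [storeOption, e1, e6, hy]
    · obtain ⟨hc1, hc2⟩ := exec_computeType hinp (σ := σ₁) hy (by rwa [hk ru rfl])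
        (by rwa [hk rb rfl])
      rw [← hσ₂] at hc1 hc2
      by_cases hmem : y ∈ Lu
      · refine .inl ⟨?_, hr2 hmem⟩
        rw [hτ]
        simp [storeOption, e1, e6, hy, hc2.2 hmem]
      · refine .inr ⟨y, hr1 hmem, ?_⟩
        have := mt hc2.1 hmem
        rw [hτ]
        simp [storeOption, e1, e3, e6, hy, this, hc1]
  · rw [hτ]
    by_cases hc : σ₂.reg ry = 0 ∨ σ₂.reg rdup = 1 <;> simp [storeOption, hc, e1, ha2, ho']
  · rcases h4 with ⟨hy, hr⟩ | ⟨y, hy, hr1, hr2⟩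
    · refine .inl ⟨?_, hr⟩
      rw [hτ]
      simp [storeOption, e6, hy, ha2]
    · obtain ⟨hc1, hc2⟩ := exec_computeType hinp (σ := σ₁) hy (by rwa [hk ru rfl])
        (by rwa [hk rb rfl])
      rw [← hσ₂] at hc1 hc2
      by_cases hmem : y ∈ Lu
      · refine .inl ⟨?_, hr2 hmem⟩
        rw [hτ]
        simp [storeOption, e6, hy, hc2.2 hmem, ha2]
      · refine .inr ⟨y, hr1 hmem, ?_⟩
        have := mt hc2.1 hmem
        rw [hτ]
        simp [storeOption, e6, hy, this, hc1, ha2, e2]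

/-- The option tables, and the table of representatives of the merged part. -/
theorem exec_buildOptions (hinp : Encodes inp I) (hs : I.Separated Fu Fv Lu Lv) {g q : ℕ} {σ : St}
    (hg : σ.reg rg = g) (hq : σ.reg rq = q) (hgu : 3 ^ Lu.length ≤ g) (hgv : 3 ^ Lv.length ≤ g)
    (hgq : 2 * g + Lv.length + 1 ≤ q)
    (hu : I.IsRepTable (σ.arr arep) (σ.arr arbase (σ.reg ru)) g Fu Lu)
    (hv : I.IsRepTable (σ.arr arep) (σ.arr arbase (σ.reg rv)) g Fv Lv)
    (hbu : σ.arr arbase (σ.reg ru) + g ≤ σ.reg rfresh2)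
    (hbv : σ.arr arbase (σ.reg rv) + g ≤ σ.reg rfresh2)
    (hLu : ListsBag inp (σ.reg ru) Lu) (hLv : ListsBag inp (σ.reg rv) Lv)
    (hb : Lu.length ≤ σ.reg rb) (hrep : ∀ a, σ.reg rfresh2 ≤ a → σ.arr arep a = 0)
    (hz : σ.arr acls 0 = 0 ∧ σ.arr adu 0 = 0 ∧ σ.arr adv 0 = 0 ∧ σ.arr adn 0 = 0) :
    let τ := exec inp buildOptions σ
    I.OptionTables g q Fu Fv Lu Lv (τ.arr ausr) (τ.arr acls) (τ.arr adu) (τ.arr adv)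
      (τ.arr adn) ∧
    (∀ a < σ.reg rfresh2, τ.arr arep a = σ.arr arep a) ∧
    (∀ a, σ.reg rfresh2 + g ≤ a → τ.arr arep a = 0) ∧
    I.IsRepTable (τ.arr arep) (σ.reg rfresh2) g (Fu ∪ Fv ∪ {w | w ∈ Lv ∧ w ∉ Lu}) Lu := by
  have hcong : ∀ {rep rep' : ℕ → ℕ} {base F L}, base + g ≤ σ.reg rfresh2 →
      3 ^ L.length ≤ g → I.IsRepTable rep base g F L →
      (∀ a < σ.reg rfresh2, rep' a = rep a) → I.IsRepTable rep' base g F L := by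
    intro rep rep' base F L hb hL h heq
    refine ⟨fun c hc => ?_, fun y hy => ?_⟩
    · rw [heq _ (by omega)]; exact h.1 c hc
    · have := I.typeCode_lt L y
      rw [heq _ (by omega)]; exact h.2 y hy
  obtain ⟨τ, ⟨t1, t2, t3, t4, t5⟩, he⟩ := exec_loop inp (x := ro) (y := rq) (p := buildOption)
    (σ := σ) (fun i τ =>
      (τ.arr acls 0 = 0 ∧ τ.arr adu 0 = 0 ∧ τ.arr adv 0 = 0 ∧ τ.arr adn 0 = 0) ∧
      (∀ o, 0 < o → o < i → I.IsOptionEntry g Fu Fv Lu Lv (τ.arr ausr) (τ.arr acls) (τ.arr adu)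
        (τ.arr adv) (τ.arr adn) o) ∧
      (∀ a < σ.reg rfresh2, τ.arr arep a = σ.arr arep a) ∧
      -- Without any bound on `c`, this clause also shows that cells from `rfresh2 + g` on stay
      -- zero, since codes of types over `Lu` are below `g`.
      (∀ c, τ.arr arep (σ.reg rfresh2 + c) ≠ 0 → ∃ o, ∃ y : Fin n,
        I.Realizes g Fu Fv Lu Lv o y ∧ I.typeCode Lu y = c ∧
        τ.arr arep (σ.reg rfresh2 + c) = y + 1) ∧
      (∀ o, 0 < o → o < i → ∀ y, I.Realizes g Fu Fv Lu Lv o y →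
        τ.arr arep (σ.reg rfresh2 + I.typeCode Lu y) ≠ 0))
    ⟨hz, by omega, fun _ _ => rfl, fun c hc => absurd (hrep _ (by omega)) hc, by omega⟩ (by
      rintro i hi τ hτ hτa ⟨h1, h2, h3, h4, h5⟩
      rcases Nat.eq_zero_or_pos i with rfl | h0
      · simp only [buildOption, exec_ite, holds_eq, eval_coe, St.reg_setReg, eval_ofNat, if_true,
          exec_skip, St.arr_setReg]
        exact ⟨h1, by omega, h3, h4, by omega⟩
      have hru : τ.reg ru = σ.reg ru := hτ ru rfl
      have hrv : τ.reg rv = σ.reg rv := hτ rv rfl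
      have hrg : τ.reg rg = σ.reg rg := hτ rg rfl
      have hrb : τ.reg rb = σ.reg rb := hτ rb rfl
      have hrf : τ.reg rfresh2 = σ.reg rfresh2 := hτ rfresh2 rfl
      have hra : τ.arr arbase = σ.arr arbase := hτa arbase rfl
      obtain ⟨b1, b2, b3⟩ := exec_buildOption hinp hs (σ := τ.setReg ro i) (g := g) (o := i)
        (by simpa [hrg] using hg)
        (by simpa [hra, hru] using hcong hbu hgu hu h3)
        (by simpa [hra, hrv] using hcong hbv hgv hv h3)
        (by simpa [hru] using hLu) (by simpa [hrv] using hLv) (by simpa [hrb] using hb)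
        (by simp) h0
      simp only [St.arr_setReg, St.reg_setReg, reduceCtorEq, if_false, hrf] at b2 b3
      refine ⟨?_, ?_, ?_, ?_, ?_⟩
      · obtain ⟨-, c2, c3, c4, c5⟩ := b2 0 h0.ne
        rw [c2, c3, c4, c5]
        exact h1
      · intro o ho hoi
        rcases Nat.lt_or_ge o i with ho' | ho'
        · obtain ⟨c1, c2, c3, c4, c5⟩ := b2 o ho'.ne
          unfold IsOptionEntry
          rw [c1, c2, c3, c4, c5]
          exact h2 o ho ho'
        · obtain rfl : o = i := by omega
          exact b1
      · intro a ha
        rw [← h3 a ha]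
        rcases b3 with ⟨b3, -⟩ | ⟨y, -, b3⟩
        · rw [b3]
        · rw [b3, Function.update_of_ne (by omega)]
      · intro c hc
        rcases b3 with ⟨b3, -⟩ | ⟨y, hy, b3⟩
        · rw [b3] at hc ⊢
          exact h4 c hc
        · rw [b3] at hc ⊢
          by_cases hcy : c = I.typeCode Lu y
          · subst hcy
            exact ⟨i, y, hy, rfl, Function.update_self _ _ _⟩
          · rw [Function.update_of_ne (by omega)] at hc ⊢
            exact h4 c hc
      · intro o ho hoi y hy
        rcases Nat.lt_or_ge o i with ho' | ho'
        · rcases b3 with ⟨b3, -⟩ | ⟨y', hy', b3⟩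
          · rw [b3]; exact h5 o ho ho' y hy
          · rw [b3, Function.update_apply]
            split_ifs
            · simp
            · exact h5 o ho ho' y hy
        · obtain rfl : o = i := by omega
          rcases b3 with ⟨-, b3⟩ | ⟨y', hy', b3⟩
          · exact absurd hy (b3 y)
          -- The user recorded need not be `y`, but all users realizing the option have the same
          -- type over `Lu`.
          · rw [b3, hy.typeCode_eq hs hy', Function.update_self]
            simp)
  intro τ'
  have hτ' : τ'.arr = τ.arr := by simp [τ', buildOptions, he]
  rw [hτ']
  rw [hq] at t2 t5
  refine ⟨⟨t1.1, t1.2.1, t1.2.2.1, t1.2.2.2, fun o h0 h1 => (t2 o h0 h1).1,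
    fun o h0 h1 => (t2 o h0 h1).2.1, fun o h0 h1 => (t2 o h0 h1).2.2⟩, t3, ?_, ?_, ?_⟩
  · intro a ha
    by_contra hne
    obtain ⟨c, rfl⟩ : ∃ c, a = σ.reg rfresh2 + c := ⟨a - σ.reg rfresh2, by omega⟩
    obtain ⟨o, y, -, h2, -⟩ := t4 c hne
    have := I.typeCode_lt Lu y
    omega
  · intro c hc hne
    obtain ⟨o, y, h1, h2, h3⟩ := t4 c hne
    exact ⟨y, h1.mem, h3, h2⟩
  · intro y hy
    obtain ⟨o, h0, h1, h2⟩ := exists_option hgu hgv hgq hy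
    exact t5 o h0 h1 y h2

end WSPInstance

/-! ### Numbers of states -/

/-- The number of a state with digits in base `q`. -/
def stateIndex {k : ℕ} (q : ℕ) (d : Fin k → ℕ) : ℕ := ∑ s, d s * q ^ (s : ℕ)

theorem stateIndex_eq_coe {k q : ℕ} (d : Fin k → ℕ) (hd : ∀ s, d s < q) :
    stateIndex q d = (finFunctionFinEquiv fun s => (⟨d s, hd s⟩ : Fin q) : Fin (q ^ k)) := by
  rw [finFunctionFinEquiv_apply, stateIndex]

theorem stateIndex_lt {k q : ℕ} {d : Fin k → ℕ} (hd : ∀ s, d s < q) : stateIndex q d < q ^ k := by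
  rw [stateIndex_eq_coe d hd]
  exact Fin.is_lt _

theorem stateIndex_inj {k q : ℕ} {d d' : Fin k → ℕ} (hd : ∀ s, d s < q) (hd' : ∀ s, d' s < q)
    (h : stateIndex q d = stateIndex q d') : d = d' := by
  rw [stateIndex_eq_coe d hd, stateIndex_eq_coe d' hd', Fin.val_inj,
    Equiv.apply_eq_iff_eq] at h
  funext s
  exact congrArg Fin.val (congrFun h s)

theorem exists_digits {k q : ℕ} {d : Fin k → ℕ} (hd : ∀ s, d s < q) :
    ∃ x < q ^ k, ∀ s : Fin k, x / q ^ (s : ℕ) % q = d s := by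
  refine ⟨stateIndex q d, stateIndex_lt hd, fun s => ?_⟩
  have h := finFunctionFinEquiv.symm_apply_apply fun s => (⟨d s, hd s⟩ : Fin q)
  have h' := congrArg Fin.val (congrFun h s)
  rw [finFunctionFinEquiv_symm_apply_val] at h'
  rw [stateIndex_eq_coe d hd]
  exact h'

/-! ### The counter -/

/-- The carry reaches digit `i` exactly when `q ^ i` divides `x + 1`. By `Nat.succ_div` this is also
when the quotient by `q ^ i` increases. -/
theorem exec_incrementCounter {inp : RAM.Input} {σ : St} {k q x : ℕ} (hk : σ.reg rk = k)
    (hq : σ.reg rq = q) (hq0 : 0 < q) (hd : ∀ s < k, σ.arr adig s = x / q ^ s % q) :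
    ∀ s < k, (exec inp incrementCounter σ).arr adig s = (x + 1) / q ^ s % q := by
  obtain ⟨τ, ⟨h1, -, -⟩, he⟩ := exec_loop inp (x := rs) (y := rk) (p := carryStep)
    (σ := σ.setReg rcarry 1)
    (fun i τ => (∀ s < i, τ.arr adig s = (x + 1) / q ^ s % q) ∧
      (∀ s, i ≤ s → s < k → τ.arr adig s = x / q ^ s % q) ∧
      τ.reg rcarry = if q ^ i ∣ x + 1 then 1 else 0)
    (by simpa using hd) (by
      rintro i hi τ hτ - ⟨h1, h2, h3⟩
      have hi' : i < k := by simpa [hk] using hi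
      have hq' : τ.reg rq = q := by rw [hτ rq rfl]; simpa using hq
      have hpos : 0 < q ^ i := Nat.pow_pos hq0
      have hs := Nat.succ_div (a := x) (b := q ^ i)
      by_cases hc : q ^ i ∣ x + 1
      · rw [if_pos hc] at h3 hs
        obtain ⟨m, hm⟩ := hc
        have hdig := h2 i le_rfl hi'
        have hxm : (x + 1) / q ^ i = m := by rw [hm, Nat.mul_div_cancel_left _ hpos]
        have hdvd : q ^ (i + 1) ∣ x + 1 ↔ x / q ^ i % q + 1 = q := by
          rw [hm, pow_succ, Nat.mul_dvd_mul_iff_left hpos]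
          have hm' : m = x / q ^ i + 1 := by omega
          rw [hm', Nat.dvd_iff_mod_eq_zero, Nat.add_mod]
          have := Nat.mod_lt (x / q ^ i) hq0
          rcases Nat.lt_or_ge 1 q with h1q | h1q
          · rw [Nat.mod_eq_of_lt h1q]
            constructor
            · intro h
              by_contra hne
              rw [Nat.mod_eq_of_lt (by omega)] at h
              omega
            · intro h; rw [h, Nat.mod_self]
          · obtain rfl : q = 1 := by omega
            simp [Nat.mod_one]
        have hnew : (x + 1) / q ^ i % q = if x / q ^ i % q + 1 = q then 0
            else x / q ^ i % q + 1 := by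
          rw [show (x + 1) / q ^ i = x / q ^ i + 1 by omega]
          have := Nat.mod_lt (x / q ^ i) hq0
          split_ifs with h
          · rw [← Nat.mod_add_mod, h, Nat.mod_self]
          · rw [← Nat.mod_add_mod, Nat.mod_eq_of_lt (by omega)]
        by_cases hw : x / q ^ i % q + 1 = q
        · rw [if_pos hw] at hnew
          refine ⟨fun s hs => ?_, fun s hs hsk => ?_, ?_⟩
          · rcases Nat.lt_or_ge s i with hsi | hsi
            · simpa [carryStep, h3, hdig, hw, hq', hsi.ne] using h1 s hsi
            · obtain rfl : s = i := by omega
              simp [carryStep, h3, hdig, hw, hq', hnew]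
          · have : s ≠ i := by omega
            simpa [carryStep, h3, hdig, hw, hq', this] using h2 s (by omega) hsk
          · rw [if_pos (hdvd.2 hw)]
            simp [carryStep, h3, hdig, hw, hq']
        · rw [if_neg hw] at hnew
          refine ⟨fun s hs => ?_, fun s hs hsk => ?_, ?_⟩
          · rcases Nat.lt_or_ge s i with hsi | hsi
            · simpa [carryStep, h3, hdig, hw, hq', hsi.ne] using h1 s hsi
            · obtain rfl : s = i := by omega
              simp [carryStep, h3, hdig, hw, hq', hnew]
          · have : s ≠ i := by omega
            simpa [carryStep, h3, hdig, hw, hq', this] using h2 s (by omega) hsk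
          · rw [if_neg (mt hdvd.1 hw)]
            simp [carryStep, h3, hdig, hw, hq']
      · rw [if_neg hc] at h3 hs
        refine ⟨fun s hs' => ?_, fun s hs' hsk => ?_, ?_⟩
        · rcases Nat.lt_or_ge s i with hsi | hsi
          · simpa [carryStep, h3] using h1 s hsi
          · obtain rfl : s = i := by omega
            rw [show (x + 1) / q ^ s = x / q ^ s by omega]
            simpa [carryStep, h3] using h2 s le_rfl hi'
        · simpa [carryStep, h3] using h2 s (by omega) hsk
        · rw [if_neg fun h => hc ((pow_dvd_pow q (Nat.le_succ i)).trans h)]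
          simp [carryStep, h3])
  intro s hs
  have hr : (σ.setReg rcarry 1).reg rk = k := by simpa using hk
  rw [hr] at h1
  simpa [incrementCounter, he] using h1 s hs

/-! ### Conflicts -/

theorem pairCond_holds {inp : RAM.Input} {σ : St} :
    pairCond.holds inp σ ↔ pairConflict inp (σ.arr ausr) (σ.arr acls) (σ.reg rs) (σ.reg rs2)
      (σ.reg re1) (σ.reg re2) := by
  simp only [pairCond, holds_and, holds_or, holds_ne, holds_eq, holds_not, eval_arr, eval_coe,
    eval_inp, eval_sub, eval_ofNat, pairConflict]

theorem stepCond_holds {inp : RAM.Input} {σ : St} :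
    stepCond.holds inp σ ↔ stepConflict inp (σ.arr ausr) (σ.arr acls) (σ.reg rs) (σ.reg re1) := by
  simp only [stepCond, holds_and, holds_or, holds_eq, eval_arr, eval_coe,
    eval_inp, eval_sub, eval_ofNat, stepConflict]

theorem exec_checkPairs {inp : RAM.Input} {σ : St} :
    (exec inp (.loop rs2 rk checkPair) σ).reg rbad ≠ 0 ↔ σ.reg rbad ≠ 0 ∨ ∃ s' < σ.reg rk,
      pairConflict inp (σ.arr ausr) (σ.arr acls) (σ.reg rs) s' (σ.reg re1) (σ.arr adig s') := by
  obtain ⟨τ, h, he⟩ := exec_loop inp (x := rs2) (y := rk) (p := checkPair) (σ := σ)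
    (fun i τ => τ.reg rbad ≠ 0 ↔ σ.reg rbad ≠ 0 ∨ ∃ s' < i,
      pairConflict inp (σ.arr ausr) (σ.arr acls) (σ.reg rs) s' (σ.reg re1) (σ.arr adig s'))
    (by simp) (by
      intro i hi τ hτ hτa h
      have e1 : τ.reg rs = σ.reg rs := hτ rs rfl
      have e2 : τ.reg re1 = σ.reg re1 := hτ re1 rfl
      have e3 : τ.arr = σ.arr := funext fun t => hτa t (by cases t <;> rfl)
      simp only [checkPair, exec_block_cons, exec_block_nil, exec_set, exec_ite, pairCond_holds,
        St.reg_setReg, St.arr_setReg, eval_arr, eval_coe, e1, e2, e3, reduceCtorEq, if_true,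
        if_false]
      split_ifs with hc <;> simp only [pairCond_holds, St.reg_setReg, St.arr_setReg, e1, e2, e3,
        reduceCtorEq, if_true, if_false] at hc
      · simp only [St.reg_setReg, if_true, eval_ofNat]
        exact iff_of_true one_ne_zero (.inr ⟨i, by omega, hc⟩)
      · simp only [exec_skip, St.reg_setReg, reduceCtorEq, if_false, h]
        refine or_congr_right ⟨?_, ?_⟩
        · rintro ⟨s', h1, h2⟩
          exact ⟨s', by omega, h2⟩
        · rintro ⟨s', h1, h2⟩
          refine ⟨s', ?_, h2⟩
          rcases Nat.lt_or_ge s' i with h3 | h3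
          · exact h3
          · obtain rfl : s' = i := by omega
            exact absurd h2 hc)
  rw [he]
  simpa using h

/-- While `rbase` runs through the multiples `s * q`, the entry of `apw` at offset `d` is the
contribution `d * q ^ s` of a digit `d`. The three addresses thus accumulate the numbers of the two
old states and of the new one by additions alone. -/
theorem exec_checkSteps {inp : RAM.Input} {σ : St} (hbad : σ.reg rbad = 0)
    (hbase : σ.reg rbase = 0) :
    let τ := exec inp (.loop rs rk checkStep) σ
    (τ.reg rbad = 0 ↔
      Compatible inp (σ.reg rk) (σ.arr ausr) (σ.arr acls) (σ.arr adig)) ∧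
    τ.reg ra1 = σ.reg ra1 + ∑ s ∈ Finset.range (σ.reg rk),
      σ.arr apw (s * σ.reg rq + σ.arr adu (σ.arr adig s)) ∧
    τ.reg ra2 = σ.reg ra2 + ∑ s ∈ Finset.range (σ.reg rk),
      σ.arr apw (s * σ.reg rq + σ.arr adv (σ.arr adig s)) ∧
    τ.reg ra3 = σ.reg ra3 + ∑ s ∈ Finset.range (σ.reg rk),
      σ.arr apw (s * σ.reg rq + σ.arr adn (σ.arr adig s)) := by
  obtain ⟨τ, ⟨h1, h2, h3, h4, h5⟩, he⟩ := exec_loop inp (x := rs) (y := rk) (p := checkStep)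
    (σ := σ)
    (fun i τ => (τ.reg rbad = 0 ↔ ∀ s < i,
        ¬ stepConflict inp (σ.arr ausr) (σ.arr acls) s (σ.arr adig s) ∧ ∀ s' < σ.reg rk,
        ¬ pairConflict inp (σ.arr ausr) (σ.arr acls) s s' (σ.arr adig s) (σ.arr adig s')) ∧
      τ.reg ra1 = σ.reg ra1 + ∑ s ∈ Finset.range i,
        σ.arr apw (s * σ.reg rq + σ.arr adu (σ.arr adig s)) ∧
      τ.reg ra2 = σ.reg ra2 + ∑ s ∈ Finset.range i,
        σ.arr apw (s * σ.reg rq + σ.arr adv (σ.arr adig s)) ∧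
      τ.reg ra3 = σ.reg ra3 + ∑ s ∈ Finset.range i,
        σ.arr apw (s * σ.reg rq + σ.arr adn (σ.arr adig s)) ∧
      τ.reg rbase = i * σ.reg rq)
    (by simp [hbad, hbase]) (by
      rintro i hi τ hτ hτa ⟨h1, h2, h3, h4, h5⟩
      have e1 : τ.reg rk = σ.reg rk := hτ rk rfl
      have e2 : τ.reg rq = σ.reg rq := hτ rq rfl
      have e3 : τ.arr = σ.arr := funext fun t => hτa t (by cases t <;> rfl)
      set υ := exec inp (.block [.set re1 (.arr adig rs),
        .set ra1 (ra1 + .arr apw (rbase + .arr adu re1)),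
        .set ra2 (ra2 + .arr apw (rbase + .arr adv re1)),
        .set ra3 (ra3 + .arr apw (rbase + .arr adn re1)),
        .set rbase (rbase + rq), .ite stepCond (.set rbad 1) .skip]) (τ.setReg rs i) with hυ
      have hx : exec inp checkStep (τ.setReg rs i) = exec inp (.loop rs2 rk checkPair) υ := by
        simp only [checkStep, υ, exec_block_cons, exec_block_nil]
      have hυa : υ.arr = σ.arr := by
        rw [← e3]
        exact funext fun t => exec_arr_of_keepsArr inp (by cases t <;> rfl) _
      have u1 : υ.reg rk = σ.reg rk := by
        rw [hυ, exec_reg_of_keeps inp rfl]; simpa using e1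
      have u2 : υ.reg rs = i := by
        rw [hυ, exec_reg_of_keeps inp rfl]; simp
      have u3 : υ.reg re1 = σ.arr adig i ∧
          υ.reg ra1 = τ.reg ra1 + σ.arr apw (i * σ.reg rq + σ.arr adu (σ.arr adig i)) ∧
          υ.reg ra2 = τ.reg ra2 + σ.arr apw (i * σ.reg rq + σ.arr adv (σ.arr adig i)) ∧
          υ.reg ra3 = τ.reg ra3 + σ.arr apw (i * σ.reg rq + σ.arr adn (σ.arr adig i)) ∧
          υ.reg rbase = (i + 1) * σ.reg rq ∧
          (υ.reg rbad = 0 ↔ τ.reg rbad = 0 ∧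
            ¬ stepConflict inp (σ.arr ausr) (σ.arr acls) i (σ.arr adig i)) := by
        simp only [hυ, exec_block_cons, exec_block_nil, exec_set, exec_ite, stepCond_holds,
          St.reg_setReg, St.arr_setReg, eval_arr, eval_coe, eval_add, e2, e3, h5, reduceCtorEq,
          if_true, if_false, eval_ofNat, exec_skip]
        split_ifs with hc <;> simp only [stepCond_holds, St.reg_setReg, St.arr_setReg, e3,
          reduceCtorEq, if_true, if_false] at hc <;> simp [hc, Nat.succ_mul]
      obtain ⟨u3, u4, u5, u6, u7, u8⟩ := u3
      rw [hx]
      have hp := exec_checkPairs (inp := inp) (σ := υ)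
      rw [hυa, u1, u2, u3] at hp
      refine ⟨?_, ?_, ?_, ?_, ?_⟩
      · rw [← not_iff_not]
        change _ ≠ 0 ↔ _
        rw [hp, Ne, u8, h1]
        constructor
        · rintro h hall
          rcases h with h | ⟨s', h6, h7⟩
          · exact h ⟨fun s hs => hall s (by omega), (hall i (by omega)).1⟩
          · exact (hall i (by omega)).2 s' h6 h7
        · intro h
          by_contra hne
          push Not at hne
          obtain ⟨⟨h6, h7⟩, h8⟩ := hne
          refine h fun s hs => ?_
          rcases Nat.lt_or_ge s i with hsi | hsi
          · exact h6 s hsi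
          · obtain rfl : s = i := by omega
            exact ⟨h7, h8⟩
      · rw [exec_reg_of_keeps inp rfl, u4, h2, Finset.sum_range_succ, add_assoc]
      · rw [exec_reg_of_keeps inp rfl, u5, h3, Finset.sum_range_succ, add_assoc]
      · rw [exec_reg_of_keeps inp rfl, u6, h4, Finset.sum_range_succ, add_assoc]
      · rw [exec_reg_of_keeps inp rfl, u7])
  intro τ'
  simp only [τ', he, St.reg_setReg, reduceCtorEq, if_false]
  exact ⟨h1, h2, h3, h4⟩

/-! ### Merging two tables -/

/-- The constants of the algorithm are in place. -/
structure IsSetUp (k b g q : ℕ) (σ : St) : Prop where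
  steps : σ.reg rk = k
  bag : σ.reg rb = b
  types : σ.reg rg = g
  options : σ.reg rq = q
  states : σ.reg rqk = q ^ k
  powers : ∀ s < k, ∀ o < q, σ.arr apw (s * q + o) = o * q ^ s

theorem IsSetUp.congr {k b g q : ℕ} {σ τ : St} (h : IsSetUp k b g q σ)
    (hr : ∀ x ∈ [rk, rb, rg, rq, rqk], τ.reg x = σ.reg x) (ha : τ.arr apw = σ.arr apw) :
    IsSetUp k b g q τ := by
  simp only [List.mem_cons, forall_eq_or_imp, List.not_mem_nil, false_imp_iff, implies_true,
    and_true] at hr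
  obtain ⟨h1, h2, h3, h4, h5⟩ := hr
  exact ⟨h1 ▸ h.steps, h2 ▸ h.bag, h3 ▸ h.types, h4 ▸ h.options, h5 ▸ h.states, ha ▸ h.powers⟩

theorem IsSetUp.exec {inp : RAM.Input} {k b g q : ℕ} {σ : St} (h : IsSetUp k b g q σ) (c : Cmd)
    (hr : ([rk, rb, rg, rq, rqk].all fun x => c.keeps x) = true) (ha : c.keepsArr apw = true) :
    IsSetUp k b g q (exec inp c σ) :=
  h.congr (fun x hx => exec_reg_of_keeps inp (List.all_eq_true.1 hr x hx) σ)
    (exec_arr_of_keepsArr inp ha σ)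

theorem IsSetUp.sum_powers {k b g q : ℕ} {σ : St} (h : IsSetUp k b g q σ) {f : ℕ → ℕ}
    (hf : ∀ s < k, f s < q) :
    ∑ s ∈ Finset.range (σ.reg rk), σ.arr apw (s * σ.reg rq + f s) =
      stateIndex q fun s : Fin k => f s := by
  rw [h.steps, h.options, stateIndex, Finset.sum_range]
  exact Finset.sum_congr rfl fun s _ => h.powers s s.2 _ (hf s s.2)

/-- The options `e` lead to a new state. -/
def IsGood (inp : RAM.Input) (k q : ℕ) (tab : ℕ → ℕ) (tu tv : ℕ) (usr cls du dv : ℕ → ℕ)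
    (e : ℕ → ℕ) : Prop :=
  Compatible inp k usr cls e ∧ tab (tu + stateIndex q fun s : Fin k => du (e s)) ≠ 0 ∧
    tab (tv + stateIndex q fun s : Fin k => dv (e s)) ≠ 0

/-- The digits of `x`. -/
def digitsOf (q x s : ℕ) : ℕ := x / q ^ s % q

-- The bound on `adn` excludes void options, whose entries are arbitrary. This suffices because a
-- vector containing a void option is a conflict and nothing is written for it.
open Classical in
theorem exec_processState {inp : RAM.Input} {k b g q x : ℕ} {σ : St} (hset : IsSetUp k b g q σ)
    (hq : 0 < q) (hdu : ∀ o < q, σ.arr adu o < q) (hdv : ∀ o < q, σ.arr adv o < q)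
    (hdn : ∀ o < q, σ.arr acls o ≠ 4 → σ.arr adn o < q)
    (hdig : ∀ s < k, σ.arr adig s = digitsOf q x s) :
    let τ := exec inp processState σ
    (∀ s < k, τ.arr adig s = digitsOf q (x + 1) s) ∧
    τ.arr atab =
      if IsGood inp k q (σ.arr atab) (σ.arr atbase (σ.reg ru)) (σ.arr atbase (σ.reg rv))
        (σ.arr ausr) (σ.arr acls) (σ.arr adu) (σ.arr adv) (σ.arr adig) then
        Function.update (σ.arr atab)
          (σ.reg rfresh + stateIndex q fun s : Fin k => σ.arr adn (σ.arr adig s)) 1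
      else σ.arr atab := by
  intro τ
  have hlt : ∀ s < k, σ.arr adig s < q := fun s hs => by
    rw [hdig s hs]; exact Nat.mod_lt _ hq
  set σ₁ := exec inp (.block [.set rbad 0, .set ra1 (.arr atbase ru), .set ra2 (.arr atbase rv),
    .set ra3 rfresh, .set rbase 0]) σ with hσ₁
  have r1 : σ₁.reg rbad = 0 ∧ σ₁.reg rbase = 0 ∧ σ₁.reg ra1 = σ.arr atbase (σ.reg ru) ∧
      σ₁.reg ra2 = σ.arr atbase (σ.reg rv) ∧ σ₁.reg ra3 = σ.reg rfresh := by simp [hσ₁]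
  have a1 : σ₁.arr = σ.arr := funext fun t => exec_arr_of_keepsArr inp (by cases t <;> rfl) σ
  have hset₁ : IsSetUp k b g q σ₁ := hset.exec _ rfl rfl
  obtain ⟨c1, c2, c3, c4⟩ := exec_checkSteps (inp := inp) r1.1 r1.2.1
  set σ₂ := exec inp (.loop rs rk checkStep) σ₁ with hσ₂
  have a2 : σ₂.arr = σ.arr := by
    rw [← a1]
    exact funext fun t => exec_arr_of_keepsArr inp (by cases t <;> rfl) σ₁
  have hset₂ : IsSetUp k b g q σ₂ := hset₁.exec _ rfl rfl
  rw [r1.2.2.1, hset₁.sum_powers fun s hs => by rw [a1]; exact hdu _ (hlt s hs), a1] at c2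
  rw [r1.2.2.2.1, hset₁.sum_powers fun s hs => by rw [a1]; exact hdv _ (hlt s hs), a1] at c3
  rw [a1, hset₁.steps] at c1
  set σ₃ := exec inp (.ite (.and (.eq rbad 0) (.and (.ne (.arr atab ra1) 0)
    (.ne (.arr atab ra2) 0))) (.put atab ra3 1) .skip) σ₂ with hσ₃
  have hτ : τ = exec inp incrementCounter σ₃ := rfl
  have hset₃ : IsSetUp k b g q σ₃ := hset₂.exec _ rfl rfl
  have a3 : σ₃.arr adig = σ.arr adig := by rw [← a2]; exact exec_arr_of_keepsArr inp rfl σ₂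
  refine ⟨fun s hs => ?_, ?_⟩
  · rw [hτ]
    exact exec_incrementCounter hset₃.steps hset₃.options hq (by rw [a3]; exact hdig) s hs
  · rw [hτ, exec_arr_of_keepsArr inp rfl]
    by_cases hg : IsGood inp k q (σ.arr atab) (σ.arr atbase (σ.reg ru)) (σ.arr atbase (σ.reg rv))
        (σ.arr ausr) (σ.arr acls) (σ.arr adu) (σ.arr adv) (σ.arr adig)
    · have hb := c1.2 hg.1
      rw [if_pos hg]
      have hn : ∀ s < k, σ.arr adn (σ.arr adig s) < q := fun s hs =>
        hdn _ (hlt s hs) fun h4 => (hg.1 s hs).1 (.inl h4)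
      rw [r1.2.2.2.2, hset₁.sum_powers fun s hs => by rw [a1]; exact hn s hs, a1] at c4
      have h1 := hg.2.1
      have h2 := hg.2.2
      simp [hσ₃, hb, c2, c3, c4, a2, h1, h2]
    · rw [if_neg hg]
      have : ¬ (σ₂.reg rbad = 0 ∧ σ₂.arr atab (σ₂.reg ra1) ≠ 0 ∧
          σ₂.arr atab (σ₂.reg ra2) ≠ 0) := by
        rw [c1, c2, c3, a2]
        exact hg
      simp only [hσ₃, exec_ite, holds_and, holds_eq, holds_ne, eval_coe, eval_arr, eval_ofNat]
      rw [if_neg this, exec_skip, a2]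

/-- Goodness reads the state table only below the fresh address, so it is unaffected by the entries
that the loop has already written. -/
theorem IsGood.congr {inp : RAM.Input} {k q : ℕ} {tab tab' : ℕ → ℕ} {tu tv fresh : ℕ}
    {usr cls du dv : ℕ → ℕ} {e e' : ℕ → ℕ} (htab : ∀ a < fresh, tab' a = tab a)
    (hu : tu + q ^ k ≤ fresh) (hv : tv + q ^ k ≤ fresh)
    (hdu : ∀ o < q, du o < q) (hdv : ∀ o < q, dv o < q) (he : ∀ s < k, e s < q)
    (hee : ∀ s < k, e' s = e s) :
    IsGood inp k q tab' tu tv usr cls du dv e' ↔ IsGood inp k q tab tu tv usr cls du dv e := by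
  have h1 : stateIndex q (fun s : Fin k => du (e s)) < q ^ k :=
    stateIndex_lt fun s => hdu _ (he s s.2)
  have h2 : stateIndex q (fun s : Fin k => dv (e s)) < q ^ k :=
    stateIndex_lt fun s => hdv _ (he s s.2)
  have h3 : (fun s : Fin k => du (e' s)) = fun s : Fin k => du (e s) :=
    funext fun s => by rw [hee s s.2]
  have h4 : (fun s : Fin k => dv (e' s)) = fun s : Fin k => dv (e s) :=
    funext fun s => by rw [hee s s.2]
  have h5 : Compatible inp k usr cls e' ↔ Compatible inp k usr cls e := by
    unfold Compatible
    refine forall₂_congr fun s hs => ?_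
    rw [hee s hs]
    refine and_congr_right fun _ => forall₂_congr fun s' hs' => ?_
    rw [hee s' hs']
  unfold IsGood
  rw [h3, h4, h5, htab _ (by omega), htab _ (by omega)]

open Classical in
theorem exec_processStates {inp : RAM.Input} {k b g q : ℕ} {σ : St} (hset : IsSetUp k b g q σ)
    (hq : 0 < q) (hdu : ∀ o < q, σ.arr adu o < q) (hdv : ∀ o < q, σ.arr adv o < q)
    (hdn : ∀ o < q, σ.arr acls o ≠ 4 → σ.arr adn o < q)
    (hdig : ∀ s < k, σ.arr adig s = 0)
    (hu : σ.arr atbase (σ.reg ru) + q ^ k ≤ σ.reg rfresh)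
    (hv : σ.arr atbase (σ.reg rv) + q ^ k ≤ σ.reg rfresh)
    (htab : ∀ a, σ.reg rfresh ≤ a → σ.arr atab a = 0) :
    let τ := exec inp (.loop rx rqk processState) σ
    (∀ s < k, τ.arr adig s = 0) ∧ (∀ a < σ.reg rfresh, τ.arr atab a = σ.arr atab a) ∧
    ∀ a, σ.reg rfresh ≤ a → τ.arr atab a =
      if ∃ x < q ^ k, IsGood inp k q (σ.arr atab) (σ.arr atbase (σ.reg ru))
        (σ.arr atbase (σ.reg rv)) (σ.arr ausr) (σ.arr acls) (σ.arr adu) (σ.arr adv)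
        (digitsOf q x) ∧
        a = σ.reg rfresh + stateIndex q fun s : Fin k => σ.arr adn (digitsOf q x s)
      then 1 else 0 := by
  obtain ⟨τ, ⟨h1, h2, h3⟩, he⟩ := exec_loop inp (x := rx) (y := rqk) (p := processState) (σ := σ)
    (fun i τ => (∀ s < k, τ.arr adig s = digitsOf q i s) ∧
      (∀ a < σ.reg rfresh, τ.arr atab a = σ.arr atab a) ∧
      ∀ a, σ.reg rfresh ≤ a → τ.arr atab a =
        if ∃ x < i, IsGood inp k q (σ.arr atab) (σ.arr atbase (σ.reg ru))
          (σ.arr atbase (σ.reg rv)) (σ.arr ausr) (σ.arr acls) (σ.arr adu) (σ.arr adv)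
          (digitsOf q x) ∧
          a = σ.reg rfresh + stateIndex q fun s : Fin k => σ.arr adn (digitsOf q x s)
        then 1 else 0)
    ⟨fun s hs => by simp [hdig s hs, digitsOf], fun _ _ => rfl, fun a ha => by simp [htab a ha]⟩ (by
      rintro i hi τ hτ hτa ⟨h1, h2, h3⟩
      have e1 : τ.reg ru = σ.reg ru := hτ ru rfl
      have e2 : τ.reg rv = σ.reg rv := hτ rv rfl
      have e3 : τ.reg rfresh = σ.reg rfresh := hτ rfresh rfl
      have e4 : τ.arr atbase = σ.arr atbase := hτa _ rfl
      have e5 : τ.arr ausr = σ.arr ausr := hτa _ rfl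
      have e6 : τ.arr acls = σ.arr acls := hτa _ rfl
      have e7 : τ.arr adu = σ.arr adu := hτa _ rfl
      have e8 : τ.arr adv = σ.arr adv := hτa _ rfl
      have e9 : τ.arr adn = σ.arr adn := hτa _ rfl
      have hset' : IsSetUp k b g q (τ.setReg rx i) := by
        refine hset.congr (fun x hx => ?_) (hτa _ rfl)
        have : x ≠ rx := by rintro rfl; simp at hx
        rw [St.reg_setReg, if_neg this]
        refine hτ x ?_
        fin_cases hx <;> rfl
      have hlt : ∀ s < k, digitsOf q i s < q := fun s _ => Nat.mod_lt _ hq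
      obtain ⟨p1, p2⟩ := exec_processState (inp := inp) (x := i) hset' hq
        (by simpa [e7] using hdu) (by simpa [e8] using hdv) (by simpa [e6, e9] using hdn)
        (by simpa using h1)
      simp only [St.arr_setReg, St.reg_setReg, reduceCtorEq, if_false, e1, e2, e3, e4, e5, e6, e7,
        e8, e9] at p2
      have hgood := IsGood.congr (inp := inp) (usr := σ.arr ausr) (cls := σ.arr acls)
        h2 hu hv hdu hdv hlt h1
      have hfun : (fun s : Fin k => σ.arr adn (τ.arr adig s)) =
          fun s : Fin k => σ.arr adn (digitsOf q i s) := funext fun s => by rw [h1 s s.2]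
      rw [hfun] at p2
      refine ⟨p1, fun a ha => ?_, fun a ha => ?_⟩
      · rw [← h2 a ha, p2]
        split_ifs
        · rw [Function.update_of_ne (by omega)]
        · rfl
      · rw [p2]
        by_cases hg : IsGood inp k q (σ.arr atab) (σ.arr atbase (σ.reg ru))
          (σ.arr atbase (σ.reg rv)) (σ.arr ausr) (σ.arr acls) (σ.arr adu) (σ.arr adv)
          (digitsOf q i)
        · rw [if_pos (hgood.2 hg), Function.update_apply]
          split_ifs with ha' hx hx
          · rfl
          · exact absurd ⟨i, by omega, hg, ha'⟩ hx
          · rw [h3 a ha]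
            obtain ⟨x, hx1, hx2, hx3⟩ := hx
            rw [if_pos]
            refine ⟨x, ?_, hx2, hx3⟩
            rcases Nat.lt_or_ge x i with hxi | hxi
            · exact hxi
            · obtain rfl : x = i := by omega
              exact absurd hx3 ha'
          · rw [h3 a ha, if_neg]
            rintro ⟨x, hx1, hx2⟩
            exact hx ⟨x, by omega, hx2⟩
        · rw [if_neg (mt hgood.1 hg), h3 a ha]
          refine if_congr ⟨?_, ?_⟩ rfl rfl
          · rintro ⟨x, hx1, hx2⟩
            exact ⟨x, by omega, hx2⟩
          · rintro ⟨x, hx1, hx2, hx3⟩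
            refine ⟨x, ?_, hx2, hx3⟩
            rcases Nat.lt_or_ge x i with hxi | hxi
            · exact hxi
            · obtain rfl : x = i := by omega
              exact absurd hx2 hg)
  intro τ'
  rw [hset.states] at h1 h3
  have hτ' : τ'.arr = τ.arr := by simp [τ', he]
  rw [hτ']
  refine ⟨fun s hs => ?_, h2, h3⟩
  -- After `q ^ k` increments the counter has overflowed: its `k` digits are zero again and it can
  -- be used for the next merge.
  rw [h1 s hs, digitsOf, Nat.pow_div hs.le hq, ← Nat.dvd_iff_mod_eq_zero]
  exact dvd_pow_self q (by omega)

/-! ### Correctness of a merge -/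

namespace WSPInstance

variable {n k : ℕ} {I : WSPInstance n k}

open Classical in
/-- `tab` contains, from `base` on, the table of the states over `L` realized in `F`. -/
def IsTable (I : WSPInstance n k) (tab : ℕ → ℕ) (base q : ℕ) (F : Set (Fin n))
    (L : List (Fin n)) : Prop :=
  ∀ d : Fin k → ℕ, (∀ s, d s < q) →
    tab (base + stateIndex q d) = if I.Realized F L d then 1 else 0

/-- The arrays of the dynamic program are correct for the parts `F` of the nodes. -/
structure IsHeap (I : WSPInstance n k) (g q N : ℕ) (bags : ℕ → List (Fin n)) (σ : St)
    (F : ℕ → Set (Fin n)) : Prop where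
  table : ∀ i ≤ N, I.IsTable (σ.arr atab) (σ.arr atbase i) q (F i) (bags i)
  tbase_le : ∀ i ≤ N, σ.arr atbase i + q ^ k ≤ σ.reg rfresh
  reps : ∀ i ≤ N, I.IsRepTable (σ.arr arep) (σ.arr arbase i) g (F i) (bags i)
  rbase_le : ∀ i ≤ N, σ.arr arbase i + g ≤ σ.reg rfresh2
  tab_zero : ∀ a, σ.reg rfresh ≤ a → σ.arr atab a = 0
  rep_zero : ∀ a, σ.reg rfresh2 ≤ a → σ.arr arep a = 0
  dig_zero : ∀ s < k, σ.arr adig s = 0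
  options_zero : σ.arr acls 0 = 0 ∧ σ.arr adu 0 = 0 ∧ σ.arr adv 0 = 0 ∧ σ.arr adn 0 = 0

theorem IsHeap.congr {g q N : ℕ} {bags : ℕ → List (Fin n)} {σ τ : St} {F : ℕ → Set (Fin n)}
    (h : I.IsHeap g q N bags σ F)
    (hr : τ.reg rfresh = σ.reg rfresh ∧ τ.reg rfresh2 = σ.reg rfresh2)
    (ha : ∀ t, t ≠ adeg → t ≠ anbr → τ.arr t = σ.arr t) : I.IsHeap g q N bags τ F := by
  obtain ⟨h1, h2, h3, h4, h5, h6, h7, h8⟩ := h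
  constructor <;> simp only [hr.1, hr.2, ha atab nofun nofun, ha atbase nofun nofun,
    ha arep nofun nofun, ha arbase nofun nofun, ha adig nofun nofun, ha acls nofun nofun,
    ha adu nofun nofun, ha adv nofun nofun, ha adn nofun nofun] <;> assumption

theorem IsTable.congr {tab tab' : ℕ → ℕ} {base q fresh : ℕ} {F : Set (Fin n)} {L : List (Fin n)}
    (h : I.IsTable tab base q F L) (hb : base + q ^ k ≤ fresh)
    (heq : ∀ a < fresh, tab' a = tab a) : I.IsTable tab' base q F L := by
  intro d hd
  have := stateIndex_lt hd
  rw [heq _ (by omega)]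
  exact h d hd

theorem IsRepTable.congr {rep rep' : ℕ → ℕ} {base g fresh : ℕ} {F : Set (Fin n)}
    {L : List (Fin n)} (h : I.IsRepTable rep base g F L) (hb : base + g ≤ fresh)
    (hL : 3 ^ L.length ≤ g) (heq : ∀ a < fresh, rep' a = rep a) :
    I.IsRepTable rep' base g F L := by
  refine ⟨fun c hc => ?_, fun y hy => ?_⟩
  · rw [heq _ (by omega)]; exact h.1 c hc
  · have := I.typeCode_lt L y
    rw [heq _ (by omega)]; exact h.2 y hy

/-- A new entry is set exactly when some good vector of options leads to its state, and by the two
merging lemmas this means that the state is realized. Node `N` is the extra one with the empty bag,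
used as target of the last merge. -/
theorem exec_merge {inp : RAM.Input} (hinp : Encodes inp I) {b g q N : ℕ}
    {bags : ℕ → List (Fin n)} {F : ℕ → Set (Fin n)} {σ : St}
    (hbags : ∀ i ≤ N, ListsBag inp i (bags i)) (hb : ∀ i ≤ N, (bags i).length ≤ b)
    (hg : g = 3 ^ b) (hq : q = 2 * g + b + 1) (hset : IsSetUp k b g q σ)
    (hheap : I.IsHeap g q N bags σ F) {u v : ℕ} (hu : σ.reg ru = u) (hv : σ.reg rv = v)
    (huN : u ≤ N) (hvN : v ≤ N) (hs : I.Separated (F u) (F v) (bags u) (bags v)) :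
    I.IsHeap g q N bags (exec inp merge σ) (Function.update F u
      (F u ∪ F v ∪ {w | w ∈ bags v ∧ w ∉ bags u})) := by
  have hlen : ∀ i ≤ N, 3 ^ (bags i).length ≤ g := fun i hi => by
    rw [hg]; exact Nat.pow_le_pow_right (by omega) (hb i hi)
  have hq0 : 0 < q := by omega
  obtain ⟨o1, o2, o3, o4⟩ := exec_buildOptions (inp := inp) (q := q) (Lu := bags u) (Lv := bags v)
    hinp hs hset.types hset.options (hlen u huN) (hlen v hvN)
    (by have := hb v hvN; omega)
    (by rw [hu]; exact hheap.reps u huN) (by rw [hv]; exact hheap.reps v hvN)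
    (by rw [hu]; exact hheap.rbase_le u huN) (by rw [hv]; exact hheap.rbase_le v hvN)
    (by rw [hu]; exact hbags u huN) (by rw [hv]; exact hbags v hvN)
    (by rw [hset.bag]; exact hb u huN) hheap.rep_zero hheap.options_zero
  set σ₁ := exec inp buildOptions σ with hσ₁
  have hset₁ : IsSetUp k b g q σ₁ := hset.exec _ rfl rfl
  have f1 : σ₁.reg ru = u := (exec_reg_of_keeps inp rfl σ).trans hu
  have f2 : σ₁.reg rv = v := (exec_reg_of_keeps inp rfl σ).trans hv
  have f3 : σ₁.reg rfresh = σ.reg rfresh := exec_reg_of_keeps inp rfl σ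
  have f4 : σ₁.reg rfresh2 = σ.reg rfresh2 := exec_reg_of_keeps inp rfl σ
  have f5 : σ₁.arr atbase = σ.arr atbase := exec_arr_of_keepsArr inp rfl σ
  have f6 : σ₁.arr arbase = σ.arr arbase := exec_arr_of_keepsArr inp rfl σ
  have f7 : σ₁.arr atab = σ.arr atab := exec_arr_of_keepsArr inp rfl σ
  have f8 : σ₁.arr adig = σ.arr adig := exec_arr_of_keepsArr inp rfl σ
  have hdu : ∀ o < q, σ₁.arr adu o < q := by
    intro o ho
    rcases Nat.eq_zero_or_pos o with rfl | h0
    · rw [o1.du_zero]; exact hq0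
    · rw [o1.du_eq o h0 ho]; split_ifs <;> omega
  have hdv : ∀ o < q, σ₁.arr adv o < q := by
    intro o ho
    rcases Nat.eq_zero_or_pos o with rfl | h0
    · rw [o1.dv_zero]; exact hq0
    · rw [o1.dv_eq o h0 ho]; split_ifs <;> omega
  have hdn : ∀ o < q, σ₁.arr acls o ≠ 4 → σ₁.arr adn o < q := by
    intro o ho h4
    rcases Nat.eq_zero_or_pos o with rfl | h0
    · rw [o1.dn_zero]; exact hq0
    · rcases o1.entry o h0 ho with h | ⟨y, -, -, -, h⟩
      · exact absurd h.1 h4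
      · have h5 := I.typeCode_lt (bags u) y
        have h6 := hlen u huN
        omega
  obtain ⟨p1, p2, p3⟩ := exec_processStates (inp := inp) hset₁ hq0 hdu hdv hdn
    (by rw [f8]; exact hheap.dig_zero) (by rw [f1, f5, f3]; exact hheap.tbase_le u huN)
    (by rw [f2, f5, f3]; exact hheap.tbase_le v hvN) (by rw [f3, f7]; exact hheap.tab_zero)
  set σ₂ := exec inp (.loop rx rqk processState) σ₁ with hσ₂
  have hset₂ : IsSetUp k b g q σ₂ := hset₁.exec _ rfl rfl
  have g1 : σ₂.reg ru = u := (exec_reg_of_keeps inp rfl σ₁).trans f1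
  have g3 : σ₂.reg rfresh = σ.reg rfresh := (exec_reg_of_keeps inp rfl σ₁).trans f3
  have g4 : σ₂.reg rfresh2 = σ.reg rfresh2 := (exec_reg_of_keeps inp rfl σ₁).trans f4
  have g5 : σ₂.arr atbase = σ.arr atbase := (exec_arr_of_keepsArr inp rfl σ₁).trans f5
  have g6 : σ₂.arr arbase = σ.arr arbase := (exec_arr_of_keepsArr inp rfl σ₁).trans f6
  have g7 : σ₂.arr arep = σ₁.arr arep := exec_arr_of_keepsArr inp rfl σ₁
  rw [f3, f7] at p2
  rw [f3, f1, f2, f5, f7] at p3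
  have hτ : exec inp merge σ = exec inp (.block [.put atbase ru rfresh, .put arbase ru rfresh2,
    .set rfresh (rfresh + rqk), .set rfresh2 (rfresh2 + rq)]) σ₂ := rfl
  have t1 : (exec inp merge σ).arr atbase = Function.update (σ.arr atbase) u (σ.reg rfresh) := by
    rw [hτ]; simp [g1, g3, g5]
  have t2 : (exec inp merge σ).arr arbase = Function.update (σ.arr arbase) u (σ.reg rfresh2) := by
    rw [hτ]; simp [g1, g4, g6]
  have t3 : (exec inp merge σ).reg rfresh = σ.reg rfresh + q ^ k := by
    rw [hτ]; simp [g3, hset₂.states]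
  have t4 : (exec inp merge σ).reg rfresh2 = σ.reg rfresh2 + q := by
    rw [hτ]; simp [g4, hset₂.options]
  have t5 : ∀ t, t ≠ atbase → t ≠ arbase → (exec inp merge σ).arr t = σ₂.arr t := by
    intro t h1 h2
    rw [hτ]; simp [h1, h2]
  have hgood : ∀ e : ℕ → ℕ, (∀ s < k, e s < q) →
      (IsGood inp k q (σ.arr atab) (σ.arr atbase u) (σ.arr atbase v) (σ₁.arr ausr) (σ₁.arr acls)
        (σ₁.arr adu) (σ₁.arr adv) e ↔ Compatible inp k (σ₁.arr ausr) (σ₁.arr acls) e ∧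
          I.Realized (F u) (bags u) (fun s => σ₁.arr adu (e s)) ∧
          I.Realized (F v) (bags v) (fun s => σ₁.arr adv (e s))) := by
    intro e he
    unfold IsGood
    rw [hheap.table u huN _ fun s => hdu _ (he s s.2), hheap.table v hvN _ fun s => hdv _ (he s s.2)]
    simp
  -- Digits below `q` are needed to recover a state from its number, and to see that all entries
  -- written lie within the `q ^ k` cells allotted to the table.
  have hnew : ∀ x : ℕ, IsGood inp k q (σ.arr atab) (σ.arr atbase u) (σ.arr atbase v)
      (σ₁.arr ausr) (σ₁.arr acls) (σ₁.arr adu) (σ₁.arr adv) (digitsOf q x) →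
      ∀ s : Fin k, σ₁.arr adn (digitsOf q x s) < q := fun x hx s =>
    hdn _ (Nat.mod_lt _ hq0) fun h4 => (hx.1 s s.2).1 (.inl h4)
  constructor
  · intro i hi
    rw [t1, t5 atab nofun nofun]
    by_cases hiu : i = u
    · subst hiu
      rw [Function.update_self, Function.update_self]
      intro d hd
      rw [p3 _ (by omega)]
      classical
      refine if_congr ⟨?_, fun hd' => ?_⟩ rfl rfl
      · rintro ⟨x, hx, hgx, hdx⟩
        have hdd := stateIndex_inj hd (hnew x hgx) (Nat.add_left_cancel hdx)
        rw [hdd]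
        obtain ⟨h1, h2, h3⟩ := (hgood (digitsOf q x) fun s _ => Nat.mod_lt _ hq0).1 hgx
        exact realized_merge_of hinp hs o1 (fun s _ => Nat.mod_lt _ hq0) h2 h3 h1
      · obtain ⟨e, he, h1, h2, h3, h4⟩ := exists_of_realized_merge hinp hs o1 (hlen _ huN)
          (hlen v hvN) (by have := hb v hvN; omega) hd'
        obtain ⟨x, hx, hxe⟩ := exists_digits he
        have hxe' : ∀ s : Fin k, digitsOf q x s = e s := hxe
        refine ⟨x, hx, (hgood (digitsOf q x) fun s _ => Nat.mod_lt _ hq0).2 ⟨h3 _ hxe', ?_, ?_⟩, ?_⟩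
        · simpa only [hxe'] using h1
        · simpa only [hxe'] using h2
        · simp only [hxe', ← h4]
    · rw [Function.update_of_ne hiu, Function.update_of_ne hiu]
      exact (hheap.table i hi).congr (hheap.tbase_le i hi) p2
  · intro i hi
    rw [t1, t3, Function.update_apply]
    have := hheap.tbase_le i hi
    split_ifs <;> omega
  · intro i hi
    rw [t2, t5 arep nofun nofun, g7]
    by_cases hiu : i = u
    · subst hiu
      rw [Function.update_self, Function.update_self]
      exact o4
    · rw [Function.update_of_ne hiu, Function.update_of_ne hiu]
      exact (hheap.reps i hi).congr (hheap.rbase_le i hi) (hlen i hi) o2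
  · intro i hi
    rw [t2, t4, Function.update_apply]
    have := hheap.rbase_le i hi
    split_ifs <;> omega
  · intro a ha
    rw [t3] at ha
    rw [t5 atab nofun nofun, p3 a (by omega), if_neg]
    rintro ⟨x, hx, hgx, rfl⟩
    have := stateIndex_lt (hnew x hgx)
    omega
  · intro a ha
    rw [t4] at ha
    rw [t5 arep nofun nofun, g7]
    exact o3 a (by omega)
  · rw [t5 adig nofun nofun]
    exact p1
  · rw [t5 acls nofun nofun, t5 adu nofun nofun, t5 adv nofun nofun, t5 adn nofun nofun]
    have e1 : σ₂.arr acls = σ₁.arr acls := exec_arr_of_keepsArr inp rfl σ₁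
    have e2 : σ₂.arr adu = σ₁.arr adu := exec_arr_of_keepsArr inp rfl σ₁
    have e3 : σ₂.arr adv = σ₁.arr adv := exec_arr_of_keepsArr inp rfl σ₁
    have e4 : σ₂.arr adn = σ₁.arr adn := exec_arr_of_keepsArr inp rfl σ₁
    rw [e1, e2, e3, e4]
    exact ⟨o1.cls_zero, o1.du_zero, o1.dv_zero, o1.dn_zero⟩

end WSPInstance

/-! ### Eliminating the leaves -/

namespace TreeDecomposition

variable {n k N : ℕ} {I : WSPInstance n k} {D : Digraph (Fin n)} {X : TreeDecomposition D (Fin N)}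

/-- The list of the elements of a bag; the bags of all but the nodes are empty. -/
def Listing.bagAt (P : X.Listing) (i : ℕ) : List (Fin n) :=
  if h : i < N then P.elems ⟨i, h⟩ else []

@[simp] theorem Listing.bagAt_coe (P : X.Listing) (i : Fin N) : P.bagAt i = P.elems i := by
  simp [Listing.bagAt]

@[simp] theorem Listing.bagAt_self (P : X.Listing) : P.bagAt N = [] := by
  simp [Listing.bagAt]

open Classical in
/-- The neighbours of a node that have not been contracted. -/
noncomputable def remaining (X : TreeDecomposition D (Fin N)) (h : Fin N → Fin N) (i : Fin N) :
    Finset (Fin N) :=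
  Finset.univ.filter fun j => X.tree.Adj i j ∧ h j = j

theorem mem_remaining {h : Fin N → Fin N} {i j : Fin N} :
    j ∈ X.remaining h i ↔ X.tree.Adj i j ∧ h j = j := by
  simp [remaining]

theorem remaining_contract {h : Fin N → Fin N} {u v i : Fin N} (hu : h u = u) (huv : u ≠ v)
    (hl : ∀ j, X.tree.Adj v j → h j = j → j = u) (hi : h i = i) (hiu : i ≠ u) :
    X.remaining (IsContraction.contract h u v) i = X.remaining h i := by
  classical
  exact IsContraction.filter_adj_contract hu huv hl hi hiu

theorem remaining_contract_self {h : Fin N → Fin N} {u v : Fin N} (hu : h u = u) (huv : u ≠ v) :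
    X.remaining (IsContraction.contract h u v) u = (X.remaining h u).erase v := by
  classical
  exact IsContraction.filter_adj_contract_self hu huv

open Classical in
/-- The state of the algorithm after leaves have been contracted as described by `h`. -/
structure IsPhase (I : WSPInstance n k) (P : X.Listing) (b g q : ℕ) (h : Fin N → Fin N) (σ : St) :
    Prop where
  setUp : IsSetUp k b g q σ
  heap : ∃ F : ℕ → Set (Fin n), I.IsHeap g q N P.bagAt σ F ∧
    (∀ i : Fin N, h i = i → F i = X.forgotten h i) ∧ F N = ∅
  contraction : IsContraction X.tree h
  degree : ∀ i : Fin N, σ.arr adeg i = if h i = i then (X.remaining h i).card else 0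
  sum : ∀ i : Fin N, h i = i → σ.arr anbr i = ∑ j ∈ X.remaining h i, (j : ℕ)
  nodes : σ.reg rN = N
  root : ∃ i : Fin N, σ.reg rroot = i ∧ h i = i

theorem IsPhase.congr {P : X.Listing} {b g q : ℕ} {h : Fin N → Fin N} {σ τ : St}
    (hσ : IsPhase I P b g q h σ)
    (hr : ∀ x ∈ [rk, rb, rg, rq, rqk, rN, rroot, rfresh, rfresh2], τ.reg x = σ.reg x)
    (ha : τ.arr = σ.arr) : IsPhase I P b g q h τ := by
  obtain ⟨F, h1, h2, h3⟩ := hσ.heap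
  refine ⟨hσ.setUp.congr (fun x hx => hr x ?_) (by rw [ha]),
    ⟨F, h1.congr ⟨hr _ (by simp), hr _ (by simp)⟩ fun t _ _ => by rw [ha], h2, h3⟩,
    hσ.contraction, by rw [ha]; exact hσ.degree, by rw [ha]; exact hσ.sum,
    (hr _ (by simp)).trans hσ.nodes, by rw [hr _ (by simp)]; exact hσ.root⟩
  fin_cases hx <;> simp

/-- Contracted nodes have stored degree zero, so degree one certifies that `v` survives and has a
single surviving neighbour. The merge changes one part, and only the degree and the neighbour sum of
`u` need correction besides resetting the degree of `v`. -/
theorem exec_contractLeaf {inp : RAM.Input} (hinp : Encodes inp I)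
    (hD : IsReducedGraph D I.lt) {P : X.Listing} {b g q : ℕ}
    (hbags : ∀ i ≤ N, ListsBag inp i (P.bagAt i)) (hb : ∀ i ≤ N, (P.bagAt i).length ≤ b)
    (hg : g = 3 ^ b) (hq : q = 2 * g + b + 1) {h : Fin N → Fin N} {σ : St}
    (hσ : IsPhase I P b g q h σ) {v : Fin N} (hv : σ.reg rv = v) (hdeg : σ.arr adeg v = 1) :
    ∃ u : Fin N, h u = u ∧ h v = v ∧ u ≠ v ∧
      IsPhase I P b g q (IsContraction.contract h u v) (exec inp contractLeaf σ) ∧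
      (exec inp contractLeaf σ).reg rv = u ∧
      (∀ j : ℕ, j ≠ u → j ≠ v → (exec inp contractLeaf σ).arr adeg j = σ.arr adeg j) ∧
      (exec inp contractLeaf σ).arr adeg v = 0 := by
  classical
  have hhv : h v = v := by
    by_contra hne
    rw [hσ.degree, if_neg hne] at hdeg
    exact absurd hdeg (by omega)
  rw [hσ.degree, if_pos hhv] at hdeg
  obtain ⟨u, hu⟩ := Finset.card_eq_one.1 hdeg
  have hmem : ∀ j, j ∈ X.remaining h v ↔ j = u := fun j => by rw [hu, Finset.mem_singleton]
  obtain ⟨hadj, hhu⟩ := mem_remaining.1 ((hmem u).2 rfl)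
  have huv : u ≠ v := hadj.ne'
  have hl : ∀ j, X.tree.Adj v j → h j = j → j = u := fun j h1 h2 =>
    (hmem j).1 (mem_remaining.2 ⟨h1, h2⟩)
  have hnbr : σ.arr anbr v = u := by rw [hσ.sum v hhv, hu, Finset.sum_singleton]
  obtain ⟨F, hheap, hF, hFN⟩ := hσ.heap
  have hsep := X.separated_of_leaf hD P hσ.contraction hhu hhv huv hl
  have hself := X.forgotten_contract_self P hhv hsep
  set σ₁ := σ.setReg ru u with hσ₁
  have hheap₁ : I.IsHeap g q N P.bagAt σ₁ F := hheap.congr ⟨rfl, rfl⟩ fun _ _ _ => rfl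
  have hset₁ : IsSetUp k b g q σ₁ := hσ.setUp.congr (fun x hx => by fin_cases hx <;> rfl) rfl
  have hmerge := I.exec_merge hinp hbags hb hg hq hset₁ hheap₁ (u := u) (v := v)
    (by simp [hσ₁]) (by simp [hσ₁, hv]) u.2.le v.2.le (by
      rw [hF u hhu, hF v hhv, P.bagAt_coe, P.bagAt_coe]; exact hsep)
  set σ₂ := exec inp merge σ₁ with hσ₂
  have g1 : σ₂.reg ru = u := (exec_reg_of_keeps inp rfl σ₁).trans (by simp [hσ₁])
  have g2 : σ₂.reg rv = v := (exec_reg_of_keeps inp rfl σ₁).trans (by simp [hσ₁, hv])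
  have g3 : σ₂.arr adeg = σ.arr adeg := exec_arr_of_keepsArr inp rfl σ₁
  have g4 : σ₂.arr anbr = σ.arr anbr := exec_arr_of_keepsArr inp rfl σ₁
  have hτ : exec inp contractLeaf σ = exec inp (.block [.put adeg rv 0,
    .put adeg ru (.arr adeg ru - 1), .put anbr ru (.arr anbr ru - rv), .set rv ru,
    .set rroot ru]) σ₂ := by
    simp [contractLeaf, hσ₂, hσ₁, hv, hnbr]
  have huv' : (u : ℕ) ≠ v := fun h => huv (Fin.ext h)
  have t1 : (exec inp contractLeaf σ).arr adeg =
      Function.update (Function.update (σ.arr adeg) v 0) u (σ.arr adeg u - 1) := by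
    rw [hτ]; simp [g1, g2, g3, huv']
  have t2 : (exec inp contractLeaf σ).arr anbr =
      Function.update (σ.arr anbr) u (σ.arr anbr u - v) := by
    rw [hτ]; simp [g1, g2, g4]
  have hcu := IsContraction.contract_eq_self_iff hhu huv
  refine ⟨u, hhu, hhv, huv, ⟨hσ.setUp.exec _ rfl rfl, ⟨_, hmerge.congr ?_ ?_, ?_, ?_⟩,
    hσ.contraction.contract_isContraction hhu hhv huv hl, ?_, ?_,
    (exec_reg_of_keeps inp rfl σ).trans hσ.nodes, u, ?_, (hcu u).2 ⟨hhu, huv⟩⟩, ?_, ?_, ?_⟩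
  · rw [hτ]; simp
  · intro t h1 h2
    rw [hτ]; simp [h1, h2]
  · intro i hi
    obtain ⟨hi, hiv⟩ := (hcu i).1 hi
    by_cases hiu : i = u
    · subst hiu
      rw [Function.update_self, hself, hF i hhu, hF v hhv, P.bagAt_coe, P.bagAt_coe]
    · rw [Function.update_of_ne (fun h => hiu (Fin.ext h)), hF i hi,
        X.forgotten_contract_of_ne hiu hiv]
  · rw [Function.update_of_ne u.2.ne', hFN]
  · intro i
    simp only [hcu]
    rw [t1]
    by_cases hiu : i = u
    · subst hiu
      rw [Function.update_self, if_pos ⟨hhu, huv⟩, hσ.degree, if_pos hhu]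
      rw [remaining_contract_self hhu huv, Finset.card_erase_of_mem]
      exact mem_remaining.2 ⟨hadj.symm, hhv⟩
    · rw [Function.update_of_ne fun h => hiu (Fin.ext h)]
      by_cases hiv : i = v
      · subst hiv
        simp
      · rw [Function.update_of_ne fun h => hiv (Fin.ext h), hσ.degree]
        by_cases hi : h i = i
        · rw [if_pos hi, if_pos ⟨hi, hiv⟩, remaining_contract hhu huv hl hi hiu]
        · rw [if_neg hi, if_neg fun h => hi h.1]
  · intro i hi
    obtain ⟨hi, hiv⟩ := (hcu i).1 hi
    rw [t2]
    by_cases hiu : i = u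
    · subst hiu
      rw [Function.update_self, hσ.sum i hhu]
      have hvm : v ∈ X.remaining h i := mem_remaining.2 ⟨hadj.symm, hhv⟩
      rw [← Finset.sum_erase_add _ _ hvm, Nat.add_sub_cancel, remaining_contract_self hhu huv]
    · rw [Function.update_of_ne (fun h => hiu (Fin.ext h)), hσ.sum i hi,
        remaining_contract hhu huv hl hi hiu]
  · rw [hτ]; simp [g1]
  · rw [hτ]; simp [g1]
  · intro j hju hjv
    rw [t1, Function.update_of_ne hju, Function.update_of_ne hjv]
  · rw [t1, Function.update_of_ne huv'.symm, Function.update_self]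

-- At any time no node up to `ri` is a leaf, except possibly `rv`: a contraction can create a new
-- leaf only at the node to which `rv` moves. Each iteration either advances `ri` or contracts a
-- node, and each happens at most `N` times, so `2 * N` iterations bring `ri` to `N`. Then no leaf
-- is left, and `exists_leaf` shows that a single node survives.
open Classical in
theorem exec_contractTree {inp : RAM.Input} (hinp : Encodes inp I)
    (hD : IsReducedGraph D I.lt) {P : X.Listing} {b g q : ℕ}
    (hbags : ∀ i ≤ N, ListsBag inp i (P.bagAt i)) (hb : ∀ i ≤ N, (P.bagAt i).length ≤ b)
    (hg : g = 3 ^ b) (hq : q = 2 * g + b + 1) {σ : St}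
    (hσ : IsPhase I P b g q (fun i => i) σ) (hri : σ.reg ri = 0) (hrv : σ.reg rv = 0)
    (hrn : σ.reg rn2 = 2 * N) :
    ∃ (i : Fin N), (exec inp contractTree σ).reg rroot = i ∧
      IsPhase I P b g q (fun _ => i) (exec inp contractTree σ) := by
  have hN : 0 < N := by obtain ⟨i, -⟩ := hσ.root; exact i.pos
  obtain ⟨τ, ⟨h, h1, h2, h3, h4⟩, he⟩ := exec_loop (inp := inp) (x := rit) (y := rn2)
    (p := contractStep) (σ := σ)
    (fun it τ => ∃ h : Fin N → Fin N, IsPhase I P b g q h τ ∧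
      (τ.reg ri < N ↔ τ.reg rv < N) ∧
      (∀ j < N, j ≤ τ.reg ri → j ≠ τ.reg rv → τ.arr adeg j ≠ 1) ∧
      (N ≤ τ.reg ri ∨ τ.reg ri + (Finset.univ.filter fun i => h i ≠ i).card = it))
    ⟨fun i => i, hσ, by omega, by omega, .inr (by simp [hri])⟩ (by
      rintro it hit τ₀ - - ⟨h, h1, h2, h3, h4⟩
      set τ := τ₀.setReg rit it with hτ
      replace h1 : IsPhase I P b g q h τ := h1.congr (fun x hx => by fin_cases hx <;> rfl) rfl
      replace h2 : τ.reg ri < N ↔ τ.reg rv < N := h2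
      replace h3 : ∀ j < N, j ≤ τ.reg ri → j ≠ τ.reg rv → τ.arr adeg j ≠ 1 := h3
      replace h4 : N ≤ τ.reg ri ∨
        τ.reg ri + (Finset.univ.filter fun i => h i ≠ i).card = it := h4
      clear_value τ
      rw [contractStep, exec_ite, exec_ite]
      split_ifs with hc hd
      · rw [holds_lt, eval_coe, eval_coe, h1.nodes] at hc
        rw [holds_eq, eval_arr, eval_coe, eval_ofNat] at hd
        obtain ⟨u, hu, hv, huv, p1, p2, p3, p4⟩ := exec_contractLeaf hinp hD hbags hb hg hq h1
          (v := ⟨τ.reg rv, h2.1 hc⟩) rfl hd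
        have e : (exec inp contractLeaf τ).reg ri = τ.reg ri := exec_reg_of_keeps inp rfl τ
        refine ⟨_, p1, ?_, ?_, .inr ?_⟩
        · rw [e, p2]; exact iff_of_true hc u.2
        · intro j hj hj' hne
          rw [p2] at hne
          rw [e] at hj'
          by_cases hjv : j = τ.reg rv
          · subst hjv
            rw [p4]; omega
          · rw [p3 j hne hjv]; exact h3 j hj hj' hjv
        · have : (Finset.univ.filter fun i => IsContraction.contract h u ⟨τ.reg rv, h2.1 hc⟩ i ≠ i) =
              insert ⟨τ.reg rv, h2.1 hc⟩ (Finset.univ.filter fun i => h i ≠ i) := by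
            ext i
            simp only [Finset.mem_filter, Finset.mem_univ, true_and, ne_eq, Finset.mem_insert,
              IsContraction.contract_eq_self_iff hu huv]
            tauto
          rw [e, this, Finset.card_insert_of_notMem (by simp [hv])]
          omega
      · rw [holds_lt, eval_coe, eval_coe, h1.nodes] at hc
        rw [holds_eq, eval_arr, eval_coe, eval_ofNat] at hd
        refine ⟨h, h1.congr (fun x hx => by fin_cases hx <;> rfl) rfl, ?_, ?_, ?_⟩
        · simp
        · intro j hj hj' hne
          simp only [exec_block_cons, exec_set, exec_block_nil, St.reg_setReg, reduceCtorEq,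
            if_false, if_true, eval_add, eval_coe, eval_ofNat, St.arr_setReg] at hj' hne ⊢
          by_cases hjv : j = τ.reg rv
          · rw [hjv]; exact hd
          · exact h3 j hj (by omega) hjv
        · simp only [exec_block_cons, exec_set, exec_block_nil, St.reg_setReg, reduceCtorEq,
            if_false, if_true, eval_add, eval_coe, eval_ofNat]
          omega
      · rw [holds_lt, eval_coe, eval_coe, h1.nodes] at hc
        exact ⟨h, h1, h2, h3, .inl (not_lt.1 hc)⟩)
  replace h1 : IsPhase I P b g q h (exec inp contractTree σ) := by
    rw [contractTree, he]
    exact h1.congr (fun x hx => by fin_cases hx <;> rfl) rfl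
  replace h3 : ∀ j : Fin N, (exec inp contractTree σ).arr adeg j ≠ 1 := by
    intro j
    have : N ≤ τ.reg ri := by
      rcases h4 with h4 | h4
      · exact h4
      · have := Finset.card_le_univ (Finset.univ.filter fun i => h i ≠ i)
        rw [Fintype.card_fin] at this
        omega
    rw [contractTree, he]
    exact h3 j j.2 (by omega) (by omega)
  obtain ⟨i, hi, hhi⟩ := h1.root
  have hall : h = fun _ => i := by
    funext j
    by_contra hne
    obtain ⟨l, hl, hl1⟩ := h1.contraction.exists_leaf X.isTree (h1.contraction.idem j) hhi hne
    refine h3 l ?_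
    rw [h1.degree, if_pos hl]
    exact hl1
  subst hall
  exact ⟨i, hi, h1⟩

end TreeDecomposition

/-! ### Preparing the tables and reading off the answer -/

section Preparation

variable {inp : RAM.Input} {σ : St}

theorem exec_maxBag :
    (exec inp maxBag σ).reg rb = (Finset.range (σ.reg rN)).sup fun i => inp 7 i 0 := by
  obtain ⟨τ, h, he⟩ := exec_loop (inp := inp) (x := rm) (y := rN) (p := maxStep)
    (σ := σ.setReg rb 0) (fun i τ => τ.reg rb = (Finset.range i).sup fun i => inp 7 i 0)
    (by simp) (by
      intro i _ τ _ _ h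
      rw [Finset.range_add_one, Finset.sup_insert, ← h, maxStep, exec_ite]
      split_ifs with hc
      · simp only [holds_lt, eval_coe, eval_inp, eval_ofNat, St.reg_setReg, reduceCtorEq, if_false,
          if_true] at hc
        simp [max_eq_left hc.le]
      · simp only [holds_lt, eval_coe, eval_inp, eval_ofNat, St.reg_setReg, reduceCtorEq, if_false,
          if_true] at hc
        simp [max_eq_right (not_lt.1 hc)])
  simp only [maxBag, exec_block_cons, exec_block_nil, exec_set, eval_ofNat, he]
  simpa using h

theorem exec_countTypes : (exec inp countTypes σ).reg rg = 3 ^ σ.reg rb := by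
  obtain ⟨τ, h, he⟩ := exec_loop (inp := inp) (x := rj) (y := rb) (p := .set rg (rg + rg + rg))
    (σ := σ.setReg rg 1) (fun i τ => τ.reg rg = 3 ^ i)
    (by simp) (by
      intro i _ τ _ _ h
      simp [h, pow_succ]
      ring)
  simp only [countTypes, exec_block_cons, exec_block_nil, exec_set, eval_ofNat, he]
  simpa using h

/-- Address `a` is to hold `a % q * q ^ (a / q)`. After `q` additions of `q ^ s` the accumulator is
the next power, so no multiplication is needed. -/
theorem exec_powerStep {q s : ℕ} (hq : σ.reg rq = q) (h0 : 0 < q) (hp : σ.reg rp = q ^ s)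
    (hptr : σ.reg rptr = s * q)
    (hpw : ∀ a < s * q, σ.arr apw a = a % q * q ^ (a / q)) :
    (exec inp powerStep σ).reg rp = q ^ (s + 1) ∧
      (exec inp powerStep σ).reg rptr = (s + 1) * q ∧
      ∀ a < (s + 1) * q, (exec inp powerStep σ).arr apw a = a % q * q ^ (a / q) := by
  obtain ⟨τ, ⟨h1, h2, h3⟩, he⟩ := exec_loop (inp := inp) (x := ro) (y := rq) (p := multipleStep)
    (σ := σ.setReg racc 0)
    (fun j τ => τ.reg racc = j * q ^ s ∧ τ.reg rptr = s * q + j ∧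
      ∀ a < s * q + j, τ.arr apw a = a % q * q ^ (a / q))
    ⟨by simp, by simp [hptr], by simpa using hpw⟩ (by
      rintro j hj τ hτ - ⟨h1, h2, h3⟩
      have hp' : τ.reg rp = q ^ s := (hτ rp rfl).trans (by simp [hp])
      have hjq : j < q := by simpa [hq] using hj
      refine ⟨by simp [multipleStep, h1, hp', Nat.add_mul], by simp [multipleStep, h2, Nat.add_assoc],
        fun a ha => ?_⟩
      simp only [multipleStep, exec_block_cons, exec_block_nil, exec_put, exec_set, St.arr_setReg,
        St.arr_setArr_same, eval_coe, St.reg_setReg, reduceCtorEq, if_false, h1, h2,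
        Function.update_apply]
      split_ifs with ha'
      · rw [ha', Nat.mul_add_mod', Nat.mod_eq_of_lt hjq, Nat.mul_comm s q, Nat.mul_add_div h0,
          Nat.div_eq_of_lt hjq, Nat.add_zero]
      · exact h3 a (by omega))
  have hq' : (σ.setReg racc 0).reg rq = q := by simp [hq]
  rw [hq'] at h1 h2 h3 he
  simp only [powerStep, exec_block_cons, exec_block_nil, exec_set, eval_ofNat, he]
  refine ⟨by simp [h1, pow_succ, Nat.mul_comm], by simp [h2, Nat.add_mul], ?_⟩
  intro a ha
  simpa using h3 a (by rw [Nat.add_mul] at ha; omega)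

theorem exec_tabulatePowers {k q : ℕ} (hk : σ.reg rk = k) (hq : σ.reg rq = q) (h0 : 0 < q) :
    (exec inp tabulatePowers σ).reg rqk = q ^ k ∧
      ∀ s < k, ∀ o < q, (exec inp tabulatePowers σ).arr apw (s * q + o) = o * q ^ s := by
  obtain ⟨τ, ⟨h1, h2, h3⟩, he⟩ := exec_loop (inp := inp) (x := rs) (y := rk) (p := powerStep)
    (σ := (σ.setReg rp 1).setReg rptr 0)
    (fun s τ => τ.reg rp = q ^ s ∧ τ.reg rptr = s * q ∧
      ∀ a < s * q, τ.arr apw a = a % q * q ^ (a / q))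
    ⟨by simp, by simp, by simp⟩ (by
      rintro s hs τ hτ - ⟨h1, h2, h3⟩
      exact exec_powerStep (by simp [hτ rq rfl, hq]) h0 (by simpa using h1) (by simpa using h2)
        (by simpa using h3))
  have hk' : ((σ.setReg rp 1).setReg rptr 0).reg rk = k := by simp [hk]
  rw [hk'] at h1 h2 h3 he
  simp only [tabulatePowers, exec_block_cons, exec_block_nil, exec_set, eval_ofNat, he]
  refine ⟨by simp [h1], fun s hs o ho => ?_⟩
  have hlt : s * q + o < k * q := by
    calc s * q + o < s * q + q := by omega
      _ = (s + 1) * q := by ring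
      _ ≤ k * q := Nat.mul_le_mul_right q hs
  simp only [St.arr_setReg]
  rw [h3 _ hlt, Nat.mul_add_mod', Nat.mod_eq_of_lt ho, Nat.mul_comm s q, Nat.mul_add_div h0,
    Nat.div_eq_of_lt ho, Nat.add_zero]

/-- The formula remains valid for `a = b`, so the effect of reading an edge needs no case
distinction. -/
theorem update_add_update_add (f : ℕ → ℕ) (a b x y i : ℕ) :
    Function.update (Function.update f a (f a + x)) b (Function.update f a (f a + x) b + y) i =
      f i + ((if a = i then x else 0) + if b = i then y else 0) := by
  rcases eq_or_ne b i with rfl | hb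
  · rcases eq_or_ne a b with rfl | ha
    · simp [Nat.add_assoc]
    · simp [ha, Function.update_of_ne ha.symm]
  · rw [Function.update_of_ne hb.symm]
    rcases eq_or_ne a i with rfl | ha
    · simp [hb]
    · simp [ha, hb, Function.update_of_ne ha.symm]

theorem exec_readTree {N : ℕ} {edges : List (Fin N × Fin N)} (hlen : σ.reg rn1 = edges.length)
    (hinp : ∀ m (hm : m < edges.length), inp 6 m 0 = edges[m].1 ∧ inp 6 m 1 = edges[m].2)
    (hdeg : ∀ i, σ.arr adeg i = 0) (hnbr : ∀ i, σ.arr anbr i = 0) (i : Fin N) :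
    (exec inp readTree σ).arr adeg i =
        (edges.map fun e => (if e.1 = i then 1 else 0) + if e.2 = i then 1 else 0).sum ∧
      (exec inp readTree σ).arr anbr i =
        (edges.map fun e => (if e.1 = i then (e.2 : ℕ) else 0) + if e.2 = i then (e.1 : ℕ) else 0).sum := by
  obtain ⟨τ, h, he⟩ := exec_loop (inp := inp) (x := rm) (y := rn1) (p := edgeStep)
    (σ := σ)
    (fun m τ => ∀ i : Fin N, τ.arr adeg i =
        ((edges.take m).map fun e => (if e.1 = i then 1 else 0) + if e.2 = i then 1 else 0).sum ∧
      τ.arr anbr i =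
        ((edges.take m).map fun e =>
          (if e.1 = i then (e.2 : ℕ) else 0) + if e.2 = i then (e.1 : ℕ) else 0).sum)
    (by simp [hdeg, hnbr]) (by
      intro m hm τ _ _ h i
      rw [hlen] at hm
      obtain ⟨e1, e2⟩ := hinp m hm
      rw [List.take_add_one, List.getElem?_eq_getElem hm]
      simp only [Option.toList_some, List.map_append, List.sum_append, List.map_cons, List.map_nil,
        List.sum_cons, List.sum_nil, Nat.add_zero]
      rw [← (h i).1, ← (h i).2]
      simp only [edgeStep, exec_block_cons, exec_block_nil, exec_put, exec_set, eval_inp, eval_coe,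
        eval_ofNat, eval_add, eval_arr, St.reg_setReg, St.reg_setArr, St.arr_setReg,
        St.arr_setArr, reduceCtorEq, if_false, if_true, e1, e2, update_add_update_add,
        Fin.ext_iff, and_self])
  rw [hlen, List.take_length] at h
  rw [readTree, he]
  exact h i

end Preparation

/-- For `w = 1` this is the degree, for `w j = j` the sum of the neighbours. The summand depends
only on the unordered pair, and each pair is listed once, so the orientations in the list do not
matter. -/
theorem TreeDecomposition.Listing.sum_edges {V ι : Type*} [Fintype ι] [DecidableEq ι]
    {D : Digraph V} {X : TreeDecomposition D ι} (P : X.Listing) [DecidableRel X.tree.Adj] (i : ι)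
    (w : ι → ℕ) :
    (P.edges.map fun e => (if e.1 = i then w e.2 else 0) + if e.2 = i then w e.1 else 0).sum =
      ∑ j ∈ Finset.univ.filter (X.tree.Adj i), w j := by
  let f : Sym2 ι → ℕ := Sym2.lift ⟨fun a b => (if a = i then w b else 0) + if b = i then w a else 0,
    fun a b => Nat.add_comm _ _⟩
  have hf : ∀ a b, f s(a, b) = (if a = i then w b else 0) + if b = i then w a else 0 :=
    fun _ _ => rfl
  have h1 : (P.edges.map fun e => (if e.1 = i then w e.2 else 0) + if e.2 = i then w e.1 else 0) =
      (P.edges.map fun e => s(e.1, e.2)).map f := by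
    rw [List.map_map]; rfl
  rw [h1, ← List.sum_toFinset _ P.edges_nodup]
  symm
  have hinj : Set.InjOn (fun j => s(i, j)) (Finset.univ.filter (X.tree.Adj i)) := by
    exact fun a _ b _ h => Sym2.congr_right.1 h
  calc ∑ j ∈ Finset.univ.filter (X.tree.Adj i), w j
      = ∑ j ∈ Finset.univ.filter (X.tree.Adj i), f s(i, j) := by
        refine Finset.sum_congr rfl fun j hj => ?_
        have : j ≠ i := by
          rintro rfl
          exact X.tree.irrefl (Finset.mem_filter.1 hj).2
        simp [hf, this]
    _ = ∑ e ∈ (Finset.univ.filter (X.tree.Adj i)).image fun j => s(i, j), f e :=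
        (Finset.sum_image hinj).symm
    _ = _ := by
        refine Finset.sum_subset ?_ ?_
        · intro e he
          obtain ⟨j, hj, rfl⟩ := Finset.mem_image.1 he
          exact List.mem_toFinset.2 ((P.mem_edges i j).2 (Finset.mem_filter.1 hj).2)
        · intro e he hne
          induction e with
          | h a b =>
            have hab := (P.mem_edges a b).1 (List.mem_toFinset.1 he)
            have ha : a ≠ i := by
              rintro rfl
              exact hne (Finset.mem_image.2 ⟨b, by simpa using hab, rfl⟩)
            have hb : b ≠ i := by
              rintro rfl
              exact hne (Finset.mem_image.2 ⟨a, by simpa using hab.symm, Sym2.eq_swap⟩)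
            simp [hf, ha, hb]

/-- The number of edges is not part of the input; the program takes `N - 1`, which is right for a
tree. -/
theorem TreeDecomposition.Listing.length_edges {V ι : Type*} [Fintype ι] {D : Digraph V}
    {X : TreeDecomposition D ι} (P : X.Listing) : P.edges.length + 1 = Fintype.card ι := by
  classical
  rw [← X.isTree.card_edgeFinset]
  congr 1
  rw [← List.length_map (fun e : ι × ι => s(e.1, e.2)), ← List.toFinset_card_of_nodup P.edges_nodup]
  congr 1
  ext e
  induction e with
  | h a b => rw [List.mem_toFinset, P.mem_edges, SimpleGraph.mem_edgeFinset, SimpleGraph.mem_edgeSet]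

theorem exec_readAnswer {inp : RAM.Input} {σ : St} {k b g q : ℕ} (hset : IsSetUp k b g q σ)
    (hq : 1 < q) :
    (exec inp readAnswer σ).reg rout =
      σ.arr atab (σ.arr atbase (σ.reg rN) + stateIndex q fun _ : Fin k => 1) := by
  obtain ⟨τ, ⟨h1, -⟩, he⟩ := exec_loop (inp := inp) (x := rs) (y := rk) (p := answerStep)
    (σ := (σ.setReg ra1 (σ.arr atbase (σ.reg rN))).setReg rbase 0)
    (fun s τ => τ.reg ra1 = σ.arr atbase (σ.reg rN) +
        ∑ s ∈ Finset.range s, σ.arr apw (s * σ.reg rq + 1) ∧ τ.reg rbase = s * σ.reg rq)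
    ⟨by simp, by simp⟩ (by
      rintro s - τ hτ hτa ⟨h1, h2⟩
      have e1 : τ.reg rq = σ.reg rq := (hτ rq rfl).trans (by simp)
      have e2 : τ.arr apw = σ.arr apw := hτa apw rfl
      simp [answerStep, h1, h2, e1, e2, Finset.sum_range_succ, Nat.add_assoc, Nat.add_mul])
  have ha : (exec inp (.loop rs rk answerStep)
      ((σ.setReg ra1 (σ.arr atbase (σ.reg rN))).setReg rbase 0)).arr atab = σ.arr atab :=
    exec_arr_of_keepsArr inp rfl _
  have hk : ((σ.setReg ra1 (σ.arr atbase (σ.reg rN))).setReg rbase 0).reg rk = σ.reg rk := by simp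
  rw [hk, hset.sum_powers (f := fun _ => 1) fun _ _ => hq] at h1
  rw [he] at ha
  simp only [St.arr_setReg] at ha
  simp only [readAnswer, exec_block_cons, exec_block_nil, exec_set, eval_ofNat, eval_arr, eval_coe,
    he]
  simp [h1, ha]

/-! ### The first tables and the last merge -/

namespace TreeDecomposition

variable {n k N : ℕ} {I : WSPInstance n k} {D : Digraph (Fin n)} {X : TreeDecomposition D (Fin N)}
  {inp : RAM.Input}

-- Everything has been contracted into `i`, so merging `i` into the empty bag of node `N` leaves all
-- users forgotten. The entry read off is then the one in `isYes_iff_realized`.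
open Classical in
theorem exec_finish (hinp : Encodes inp I) {P : X.Listing} {b g q : ℕ}
    (hbags : ∀ i ≤ N, ListsBag inp i (P.bagAt i)) (hb : ∀ i ≤ N, (P.bagAt i).length ≤ b)
    (hg : g = 3 ^ b) (hq : q = 2 * g + b + 1) {i : Fin N} {σ : St}
    (hσ : IsPhase I P b g q (fun _ => i) σ) (hi : σ.reg rroot = i) :
    (exec inp finish σ).reg rout = if I.IsYes then 1 else 0 := by
  obtain ⟨F, hheap, hF, hFN⟩ := hσ.heap
  set σ₁ := (σ.setReg rv i).setReg ru N with hσ₁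
  have hmerge := I.exec_merge hinp hbags hb hg hq
    (hσ.setUp.congr (τ := σ₁) (fun x hx => by fin_cases hx <;> rfl) rfl)
    (hheap.congr (τ := σ₁) ⟨rfl, rfl⟩ fun _ _ _ => rfl) (u := N) (v := i)
    (by simp [hσ₁]) (by simp [hσ₁]) le_rfl i.2.le (by
      rw [hF i rfl, hFN, P.bagAt_coe, P.bagAt_self]
      exact I.separated_nil fun y hy h => hy.2 ((P.mem_elems i y).1 h))
  rw [hF i rfl, hFN, P.bagAt_coe, P.bagAt_self,
    WSPInstance.forgotten_root_union X P fun _ => rfl] at hmerge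
  have h1 : exec inp finish σ = exec inp readAnswer (exec inp merge σ₁) := by
    simp [finish, hσ₁, hi, hσ.nodes]
  have h2 : (exec inp merge σ₁).reg rN = N :=
    (exec_reg_of_keeps inp rfl σ₁).trans (by simp [hσ₁, hσ.nodes])
  have h3 : IsSetUp k b g q (exec inp merge σ₁) :=
    (hσ.setUp.congr (τ := σ₁) (fun x hx => by fin_cases hx <;> rfl) rfl).exec _ rfl rfl
  have hq1 : 1 < q := by
    have : 0 < 3 ^ b := by positivity
    omega
  have h4 := hmerge.table N le_rfl (fun _ => 1) fun _ => hq1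
  rw [Function.update_self, P.bagAt_self] at h4
  rw [h1, exec_readAnswer h3 hq1, h2, h4, I.isYes_iff_realized]

/-- Nothing is forgotten yet, so all parts are empty and only the zero state is realized. Its number
is zero, and no other state has that number. -/
theorem IsPhase.initial {P : X.Listing} {b g q : ℕ} (hg : g = 3 ^ b) (hq : q = 2 * g + b + 1)
    {σ : St} (hset : IsSetUp k b g q σ) (hN : 0 < N) (hrN : σ.reg rN = N)
    (hroot : σ.reg rroot = 0)
    (hdeg : ∀ i : Fin N, σ.arr adeg i = (X.remaining (fun i => i) i).card)
    (hnbr : ∀ i : Fin N, σ.arr anbr i = ∑ j ∈ X.remaining (fun i => i) i, (j : ℕ))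
    (harr : ∀ t, t ≠ adeg → t ≠ anbr → t ≠ apw → ∀ a, σ.arr t a = 0) :
    IsPhase I P b g q (fun i => i)
      (exec inp initTables σ) := by
  have t1 : (exec inp initTables σ).arr atab = Function.update (σ.arr atab) 0 1 := by
    simp [initTables]
  have t2 : ∀ t, t ≠ atab → (exec inp initTables σ).arr t = σ.arr t := by
    intro t ht
    simp [initTables, ht]
  have t3 : (exec inp initTables σ).reg rfresh = q ^ k := by simp [initTables, hset.states]
  have t4 : (exec inp initTables σ).reg rfresh2 = q := by simp [initTables, hset.options]
  refine ⟨hset.exec _ rfl rfl, ⟨fun _ => ∅, ?_, fun i _ => (X.forgotten_id i).symm, rfl⟩,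
    .id _, fun i => ?_, fun i _ => ?_, (exec_reg_of_keeps inp rfl σ).trans hrN,
    ⟨0, hN⟩, (exec_reg_of_keeps inp rfl σ).trans hroot, rfl⟩
  · have hz : ∀ t, t ≠ adeg → t ≠ anbr → t ≠ apw → t ≠ atab →
        ∀ a, (exec inp initTables σ).arr t a = 0 := fun t h1 h2 h3 h4 a => by
      rw [t2 t h4, harr t h1 h2 h3]
    have hpos : 0 < q ^ k := by
      have : 0 < q := by omega
      positivity
    constructor
    · intro i _ d hd
      rw [hz atbase nofun nofun nofun nofun, t1, Nat.zero_add, I.realized_empty,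
        Function.update_apply, harr atab nofun nofun nofun]
      have hiff : stateIndex q d = 0 ↔ ∀ s, d s = 0 := by
        rw [stateIndex, Finset.sum_eq_zero_iff]
        refine ⟨fun h s => ?_, fun h s _ => by simp [h s]⟩
        exact (Nat.mul_eq_zero.1 (h s (Finset.mem_univ s))).resolve_right
          (pow_ne_zero _ (by omega))
      by_cases h0 : ∀ s, d s = 0
      · rw [if_pos (hiff.2 h0), if_pos h0]
      · rw [if_neg (mt hiff.1 h0), if_neg h0]
    · intro i _
      rw [hz atbase nofun nofun nofun nofun, t3, Nat.zero_add]
    · intro i _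
      refine ⟨fun c _ h => absurd (hz arep nofun nofun nofun nofun _) h, fun y hy => hy.elim⟩
    · intro i _
      rw [hz arbase nofun nofun nofun nofun, t4]; omega
    · intro a ha
      rw [t1, Function.update_of_ne (by omega), harr atab nofun nofun nofun]
    · exact fun a _ => hz arep nofun nofun nofun nofun a
    · exact fun a _ => hz adig nofun nofun nofun nofun a
    · exact ⟨hz acls nofun nofun nofun nofun 0, hz adu nofun nofun nofun nofun 0,
        hz adv nofun nofun nofun nofun 0, hz adn nofun nofun nofun nofun 0⟩
  · rw [t2 adeg nofun, hdeg, if_pos rfl]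
  · rw [t2 anbr nofun, hnbr]

end TreeDecomposition

/-! ### The running time -/

namespace ArrayLang

variable {inp : RAM.Input} {σ : St} {W : ℕ}

theorem TimeBound.block_cons {c : Cmd} {l : List Cmd} (h : TimeBound inp c σ (c.size * W))
    (hl : TimeBound inp (.block l) (exec inp c σ) ((Cmd.block l).size * W)) :
    TimeBound inp (.block (c :: l)) σ ((Cmd.block (c :: l)).size * W) :=
  (h.seq hl).mono (Nat.add_mul _ _ _).ge

theorem TimeBound.block_nil (hW : 1 ≤ W) :
    TimeBound inp (.block []) σ ((Cmd.block []).size * W) :=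
  timeBound_of_stable (by decide) σ hW

theorem timeBound_set (x : Reg) (e : Ex) (hW : 1 ≤ W) :
    TimeBound inp (.set x e) σ ((Cmd.set x e).size * W) :=
  timeBound_of_stable rfl σ hW

theorem weight_buildOption (ρ : Reg → ℕ) : buildOption.weight ρ ≤ ρ rb + 1 := by
  simp [buildOption, selectOption, computeType, storeOption, compareStep, Cmd.block, Cmd.weight]

theorem weight_processState (ρ : Reg → ℕ) :
    processState.weight ρ ≤ (ρ rk + 1) * (ρ rk + 1) := by
  simp [processState, checkStep, checkPair, incrementCounter, carryStep, Cmd.block, Cmd.weight]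

theorem weight_merge {ρ : Reg → ℕ} (h1 : (ρ rq + 1) * (ρ rb + 1) ≤ W)
    (h2 : (ρ rqk + 1) * ((ρ rk + 1) * (ρ rk + 1)) ≤ W) : merge.weight ρ ≤ W := by
  have h3 : buildOptions.weight ρ ≤ W :=
    (Nat.mul_le_mul_left _ (weight_buildOption ρ)).trans h1
  have h4 : (Cmd.loop rx rqk processState).weight ρ ≤ W :=
    (Nat.mul_le_mul_left _ (weight_processState ρ)).trans h2
  have h5 : 1 ≤ W := (Cmd.one_le_weight ρ _).trans h3
  simp only [merge, Cmd.block]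
  simp only [Cmd.weight, max_le_iff, h3, h5, and_true, true_and]
  exact h4

theorem weight_contractTree {ρ : Reg → ℕ} (h1 : (ρ rn2 + 1) * ((ρ rq + 1) * (ρ rb + 1)) ≤ W)
    (h2 : (ρ rn2 + 1) * ((ρ rqk + 1) * ((ρ rk + 1) * (ρ rk + 1))) ≤ W) :
    contractTree.weight ρ ≤ W := by
  have h3 : contractStep.weight ρ ≤
      max ((ρ rq + 1) * (ρ rb + 1)) ((ρ rqk + 1) * ((ρ rk + 1) * (ρ rk + 1))) := by
    have h := weight_merge (ρ := ρ) (le_max_left _ _) (le_max_right _ _)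
    have h' := (Cmd.one_le_weight ρ _).trans h
    simp only [contractStep, contractLeaf, Cmd.block]
    simp only [Cmd.weight, max_le_iff, h, h', and_true]
  refine (Nat.mul_le_mul_left _ h3).trans ?_
  rw [← Nat.mul_max_mul_left]
  exact max_le h1 h2

theorem weight_finish {ρ : Reg → ℕ} (h1 : (ρ rq + 1) * (ρ rb + 1) ≤ W)
    (h2 : (ρ rqk + 1) * ((ρ rk + 1) * (ρ rk + 1)) ≤ W) : finish.weight ρ ≤ W := by
  have h3 := weight_merge h1 h2
  have h4 := (Cmd.one_le_weight ρ _).trans h3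
  have h5 : ρ rk + 1 ≤ W := by nlinarith
  simp only [finish, readAnswer, answerStep, Cmd.block]
  simp only [Cmd.weight, max_le_iff, h3, h4, and_true, true_and, max_self, Nat.mul_one]
  exact h5

end ArrayLang

/-! ### Correctness of the dynamic program -/

namespace TreeDecomposition

variable {n k N : ℕ} {I : WSPInstance n k} {D : Digraph (Fin n)} {X : TreeDecomposition D (Fin N)}
  {inp : RAM.Input}

open Classical in
theorem exec_dynamicProgram (hinp : Encodes inp I) (hD : IsReducedGraph D I.lt) {P : X.Listing}
    {b q W : ℕ} (hN : inp 0 0 2 = N) (hbags : ∀ i ≤ N, ListsBag inp i (P.bagAt i))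
    (hb : ((Finset.range N).sup fun i => (P.bagAt i).length) = b)
    (hedges : ∀ m (hm : m < P.edges.length),
      inp 6 m 0 = P.edges[m].1 ∧ inp 6 m 1 = P.edges[m].2)
    (hq : q = 2 * 3 ^ b + b + 1) (hW1 : N + 1 ≤ W) (hW2 : b + 1 ≤ W)
    (hW3 : (k + 1) * (q + 1) ≤ W) (hW4 : (2 * N + 1) * ((q + 1) * (b + 1)) ≤ W)
    (hW5 : (2 * N + 1) * ((q ^ k + 1) * ((k + 1) * (k + 1))) ≤ W) :
    (exec inp dynamicProgram (St.zero.setReg rk k)).reg rout = (if I.IsYes then 1 else 0) ∧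
      TimeBound inp dynamicProgram (St.zero.setReg rk k) (dynamicProgram.size * W) := by
  have hN0 : 0 < N := X.isTree.1.nonempty.elim fun i => i.pos
  have h0 : 1 ≤ W := by omega
  set σ₁ := exec inp (.set rN (.inp 0 0 2)) (St.zero.setReg rk k) with hσ₁
  have a1 : σ₁.reg rN = N := by simp [hσ₁, hN]
  have b1 : σ₁.reg rk = k := by simp [hσ₁]
  set σ₂ := exec inp maxBag σ₁ with hσ₂
  have a2 : σ₂.reg rb = b := by
    rw [hσ₂, exec_maxBag, a1, ← hb]
    exact Finset.sup_congr rfl fun i hi => (hbags i (Finset.mem_range.1 hi).le).length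
  set σ₃ := exec inp countTypes σ₂ with hσ₃
  have a3 : σ₃.reg rg = 3 ^ b := by rw [hσ₃, exec_countTypes, a2]
  have b3 : σ₃.reg rb = b := (exec_reg_of_keeps inp rfl σ₂).trans a2
  have c3 : σ₃.reg rk = k :=
    (exec_reg_of_keeps inp rfl σ₂).trans ((exec_reg_of_keeps inp rfl σ₁).trans b1)
  have d3 : σ₃.reg rN = N :=
    (exec_reg_of_keeps inp rfl σ₂).trans ((exec_reg_of_keeps inp rfl σ₁).trans a1)
  set σ₄ := exec inp (.set rq (rg + rg + rb + 1)) σ₃ with hσ₄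
  have a4 : σ₄.reg rq = q := by simp [hσ₄, a3, b3, hq]; omega
  have b4 : σ₄.reg rk = k := (exec_reg_of_keeps inp rfl σ₃).trans c3
  set σ₅ := exec inp tabulatePowers σ₄ with hσ₅
  obtain ⟨a5, b5⟩ := exec_tabulatePowers (inp := inp) b4 a4 (by omega)
  have hset₅ : IsSetUp k b (3 ^ b) q σ₅ :=
    ⟨(exec_reg_of_keeps inp rfl σ₄).trans b4,
      (exec_reg_of_keeps inp rfl σ₄).trans ((exec_reg_of_keeps inp rfl σ₃).trans b3),
      (exec_reg_of_keeps inp rfl σ₄).trans ((exec_reg_of_keeps inp rfl σ₃).trans a3),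
      (exec_reg_of_keeps inp rfl σ₄).trans a4, a5, b5⟩
  have c5 : σ₅.reg rN = N :=
    (exec_reg_of_keeps inp rfl σ₄).trans ((exec_reg_of_keeps inp rfl σ₃).trans d3)
  set σ₆ := exec inp (.set rn1 (rN - 1)) σ₅ with hσ₆
  have hcard := P.length_edges
  rw [Fintype.card_fin] at hcard
  have a6 : σ₆.reg rn1 = P.edges.length := by simp [hσ₆, c5]; omega
  have hzero : ∀ t, t ≠ apw → σ₆.arr t = fun _ => 0 := by
    intro t ht
    have e1 : σ₅.arr t = σ₄.arr t := exec_arr_of_keepsArr inp (by cases t <;> first | rfl | exact absurd rfl ht) σ₄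
    have e2 : σ₃.arr t = σ₂.arr t := exec_arr_of_keepsArr inp (by cases t <;> rfl) σ₂
    have e3 : σ₂.arr t = σ₁.arr t := exec_arr_of_keepsArr inp (by cases t <;> rfl) σ₁
    exact e1.trans (e2.trans e3)
  have hreg : ∀ x ∈ [rroot, ri, rv], σ₆.reg x = 0 := by
    intro x hx
    have h1 : σ₆.reg x = σ₅.reg x := exec_reg_of_keeps inp (by fin_cases hx <;> rfl) σ₅
    have h2 : σ₅.reg x = σ₄.reg x := exec_reg_of_keeps inp (by fin_cases hx <;> rfl) σ₄
    have h3 : σ₄.reg x = σ₃.reg x := exec_reg_of_keeps inp (by fin_cases hx <;> rfl) σ₃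
    have h4 : σ₃.reg x = σ₂.reg x := exec_reg_of_keeps inp (by fin_cases hx <;> rfl) σ₂
    have h5 : σ₂.reg x = σ₁.reg x := exec_reg_of_keeps inp (by fin_cases hx <;> rfl) σ₁
    have h6 : σ₁.reg x = 0 := by fin_cases hx <;> rfl
    rw [h1, h2, h3, h4, h5, h6]
  set σ₇ := exec inp readTree σ₆ with hσ₇
  have hset₇ : IsSetUp k b (3 ^ b) q σ₇ := (hset₅.exec _ rfl rfl).exec _ rfl rfl
  have c7 : σ₇.reg rN = N :=
    (exec_reg_of_keeps inp rfl σ₆).trans ((exec_reg_of_keeps inp rfl σ₅).trans c5)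
  have htree := exec_readTree (inp := inp) a6 hedges (fun i => by rw [hzero adeg nofun])
    (fun i => by rw [hzero anbr nofun])
  have hrem : ∀ i, X.remaining (fun i => i) i = Finset.univ.filter (X.tree.Adj i) := by
    intro i; ext j; simp [mem_remaining]
  set σ₈ := exec inp initTables σ₇ with hσ₈
  have hphase : IsPhase I P b (3 ^ b) q (fun i => i) σ₈ := by
    refine .initial rfl hq hset₇ hN0 c7
      ((exec_reg_of_keeps inp rfl σ₆).trans (hreg _ (by simp))) (fun i => ?_) (fun i => ?_) ?_
    · rw [(htree i).1, P.sum_edges i fun _ => 1, hrem, Finset.card_eq_sum_ones]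
    · rw [(htree i).2, P.sum_edges i fun j => (j : ℕ), hrem]
    · intro t h1 h2 h3 a
      have e : σ₇.arr t = σ₆.arr t := exec_arr_of_keepsArr inp
        (by cases t <;> first | rfl | exact absurd rfl h1 | exact absurd rfl h2) σ₆
      rw [e, hzero t h3]
  have a8 : σ₈.reg rn2 = 2 * N := by simp [hσ₈, initTables, c7, Nat.two_mul]
  have hreg₈ : ∀ x ∈ [ri, rv], σ₈.reg x = 0 := by
    intro x hx
    have h1 : σ₈.reg x = σ₇.reg x := exec_reg_of_keeps inp (by fin_cases hx <;> rfl) σ₇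
    have h2 : σ₇.reg x = σ₆.reg x := exec_reg_of_keeps inp (by fin_cases hx <;> rfl) σ₆
    rw [h1, h2, hreg x (List.mem_cons_of_mem _ hx)]
  have hb' : ∀ i ≤ N, (P.bagAt i).length ≤ b := by
    intro i hi
    rcases hi.lt_or_eq with hi | rfl
    · rw [← hb]
      exact Finset.le_sup (f := fun i => (P.bagAt i).length) (Finset.mem_range.2 hi)
    · simp
  obtain ⟨i, hi, hphase'⟩ := exec_contractTree hinp hD hbags hb' rfl hq hphase
    (hreg₈ _ (by simp)) (hreg₈ _ (by simp)) a8
  refine ⟨exec_finish hinp hbags hb' rfl hq hphase' hi, ?_⟩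
  have hone : ∀ a, a ≤ (2 * N + 1) * a := fun a => Nat.le_mul_of_pos_left a (by omega)
  -- Loop bounds such as `rb` and `rq` are computed by the program itself, so the commands are timed
  -- one by one, each with the register values found at its start.
  refine .block_cons (timeBound_set _ _ h0) (.block_cons (timeBound_of_stable (by decide) σ₁ ?_)
    (.block_cons (timeBound_of_stable (by decide) σ₂ ?_) (.block_cons (timeBound_set _ _ h0)
    (.block_cons (timeBound_of_stable (by decide) σ₄ ?_) (.block_cons (timeBound_set _ _ h0)
    (.block_cons (timeBound_of_stable (by decide) σ₆ ?_)
    (.block_cons (timeBound_of_stable (by decide) σ₇ ?_)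
    (.block_cons (timeBound_of_stable (by decide) σ₈ ?_)
    (.block_cons (timeBound_of_stable (by decide) (exec inp contractTree σ₈) ?_)
    (.block_nil h0))))))))))
  · simp [maxBag, maxStep, Cmd.block, Cmd.weight, a1, hW1]
  · simp [countTypes, Cmd.block, Cmd.weight, a2, hW2]
  · simp [tabulatePowers, powerStep, multipleStep, Cmd.block, Cmd.weight, a4, b4, h0, hW3]
  · simp [readTree, edgeStep, Cmd.block, Cmd.weight, a6]; omega
  · simp [initTables, Cmd.block, Cmd.weight, h0]
  · obtain ⟨e1, e2, e3, e4, e5, -⟩ := hphase.setUp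
    apply weight_contractTree <;> simp only [e1, e2, e4, e5, a8] <;> assumption
  · obtain ⟨e1, e2, e3, e4, e5, -⟩ := hphase'.setUp
    apply weight_finish <;> simp only [e1, e2, e4, e5]
    · exact (hone _).trans hW4
    · exact (hone _).trans hW5

end TreeDecomposition

/-! ### Instances with one step -/

-- With one step every constraint relates the step to itself: `=` always holds, `≠` and `<` never
-- do.
open Classical in
theorem WSPInstance.exec_tryUsers {n : ℕ} {I : WSPInstance n 1} {inp : RAM.Input}
    (hinp : Encodes inp I) (hn : inp 0 0 0 = n) {σ : St} (h0 : σ.reg rout = 0) :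
    (exec inp tryUsers σ).reg rout = if I.IsYes then 1 else 0 := by
  have hyes : I.IsYes ↔ ∃ u : Fin n, inp 1 0 u ≠ 0 ∧ inp 3 0 0 = 0 ∧ inp 4 0 0 = 0 := by
    have h1 := fun u => hinp.auth 0 u
    have h3 := not_iff_not.2 (hinp.ne 0 0)
    have h4 := not_iff_not.2 (hinp.lt 0 0)
    simp only [Fin.val_zero, not_not] at h1 h3 h4
    simp only [h1, h3, h4]
    constructor
    · rintro ⟨π, h5, h6⟩
      exact ⟨π 0, h5 0, fun h => h6 _ _ _ h rfl, fun h => I.lt_irrefl _ (h6 _ _ _ h)⟩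
    · rintro ⟨u, h5, h6, h7⟩
      refine ⟨fun _ => u, fun s => by rwa [Subsingleton.elim s 0], fun ρ s s' h => ?_⟩
      rw [Subsingleton.elim s 0, Subsingleton.elim s' 0] at h
      cases ρ with
      | eq => rfl
      | ne => exact absurd h h6
      | lt => exact absurd h h7
  obtain ⟨τ, h, he⟩ := exec_loop (inp := inp) (x := rm) (y := rn) (p := tryUser)
    (σ := σ.setReg rn n)
    (fun i τ => τ.reg rout =
      if ∃ u < i, inp 1 0 u ≠ 0 ∧ inp 3 0 0 = 0 ∧ inp 4 0 0 = 0 then 1 else 0)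
    (by simp [h0]) (by
      intro i _ τ _ _ h
      rw [tryUser, exec_ite]
      split_ifs with hc hu hu
      · simp
      · refine absurd ⟨i, by omega, ?_⟩ hu
        simpa using hc
      · obtain ⟨u, hui, hu⟩ := hu
        have : u ≠ i := by
          rintro rfl
          exact hc (by simpa using hu)
        simp only [exec_skip, St.reg_setReg, reduceCtorEq, if_false, h]
        rw [if_pos ⟨u, by omega, hu⟩]
      · simp only [exec_skip, St.reg_setReg, reduceCtorEq, if_false, h]
        rw [if_neg]
        rintro ⟨u, hui, hu'⟩
        exact hu ⟨u, by omega, hu'⟩)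
  simp only [tryUsers, exec_block_cons, exec_block_nil, exec_set, eval_inp, eval_ofNat, hn, he]
  simp only [St.reg_setReg, reduceCtorEq, if_false, if_true] at h ⊢
  rw [h]
  refine if_congr ?_ rfl rfl
  rw [hyes]
  exact ⟨fun ⟨u, hu, h⟩ => ⟨⟨u, hu⟩, h⟩, fun ⟨u, h⟩ => ⟨u, u.2, h⟩⟩

/-! ### The input arrays and the bound -/

section Input

variable {n k N : ℕ} (I : WSPInstance n k) {D : Digraph (Fin n)} {X : TreeDecomposition D (Fin N)}
  (P : X.Listing)

theorem encodes_inputArrays : Encodes (inputArrays I P) I where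
  auth s u := relArray_ne_zero (fun s u => u ∈ I.auth s) s u
  eq s s' := relArray_ne_zero (fun s s' => (ConstraintKind.eq, s, s') ∈ I.constraints) s s'
  ne s s' := relArray_ne_zero (fun s s' => (ConstraintKind.ne, s, s') ∈ I.constraints) s s'
  lt s s' := relArray_ne_zero (fun s s' => (ConstraintKind.lt, s, s') ∈ I.constraints) s s'
  order u v := relArray_ne_zero I.lt u v
  order_le u v := by
    change relArray I.lt u v ≤ 1
    unfold relArray
    split_ifs <;> omega

theorem listsBag_inputArrays (i : ℕ) : ListsBag (inputArrays I P) i (P.bagAt i) := by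
  have h : ∀ j, inputArrays I P 7 i j =
      (if i < N then (P.bagAt i).length :: (P.bagAt i).map fun u : Fin n => (u : ℕ) else []).getD j 0 := by
    intro j
    change listArray _ i j = _
    unfold listArray
    congr 1
    split_ifs with hi
    · simp [List.getD_eq_getElem?_getD, hi, TreeDecomposition.Listing.bagAt, List.map_eq_flatMap]
    · simp [List.getD_eq_getElem?_getD, hi]
  by_cases hi : i < N
  · simp only [if_pos hi] at h
    exact ⟨h 0, fun j hj => by rw [h]; simp [List.getD_eq_getElem?_getD, hj]⟩
  · have hnil : P.bagAt i = [] := by simp [TreeDecomposition.Listing.bagAt, hi]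
    rw [hnil]
    refine ⟨by rw [h, if_neg hi]; rfl, fun j hj => absurd hj (by simp)⟩

theorem inputArrays_edges {m : ℕ} (hm : m < P.edges.length) :
    inputArrays I P 6 m 0 = P.edges[m].1 ∧ inputArrays I P 6 m 1 = P.edges[m].2 := by
  constructor <;>
  · change listArray _ _ _ = _
    simp [listArray, List.getD_eq_getElem?_getD, hm]

theorem sup_length_bagAt :
    ((Finset.range N).sup fun i => (P.bagAt i).length) =
      Finset.univ.sup fun i => (X.bag i).card := by
  have h : ∀ i, (P.elems i).length = (X.bag i).card := fun i => by
    rw [← List.toFinset_card_of_nodup (P.elems_nodup i)]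
    congr 1
    ext v
    rw [List.mem_toFinset, P.mem_elems]
  apply le_antisymm
  · refine Finset.sup_le fun i hi => ?_
    have := P.bagAt_coe ⟨i, Finset.mem_range.1 hi⟩
    dsimp only at this
    rw [this, h]
    exact Finset.le_sup (f := fun i => (X.bag i).card) (Finset.mem_univ _)
  · refine Finset.sup_le fun i _ => ?_
    rw [← h, ← P.bagAt_coe]
    exact Finset.le_sup (f := fun i => (P.bagAt i).length) (Finset.mem_range.2 i.2)

theorem one_le_sup_card_bag (hn : 1 ≤ n) : 1 ≤ Finset.univ.sup fun i => (X.bag i).card := by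
  obtain ⟨i, hi⟩ := X.exists_mem_bag ⟨0, hn⟩
  exact (Finset.card_pos.2 ⟨_, hi⟩).trans_le
    (Finset.le_sup (f := fun i => (X.bag i).card) (Finset.mem_univ i))

end Input

/-- The dominant term is the enumeration of the `q ^ k` vectors of options. The others are compared
with it. -/
theorem weight_bounds {k N b q M W : ℕ} (hk : 2 ≤ k) (hN : 1 ≤ N) (hM : M = b + 1 + 3 ^ b)
    (hq : q = 2 * 3 ^ b + b + 1) (hW : W = 24 * (N * k * 4 ^ k * M ^ k)) :
    N + 1 ≤ W ∧ b + 1 ≤ W ∧ (k + 1) * (q + 1) ≤ W ∧ (2 * N + 1) * ((q + 1) * (b + 1)) ≤ W ∧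
      (2 * N + 1) * ((q ^ k + 1) * ((k + 1) * (k + 1))) ≤ W := by
  have h3 : 0 < 3 ^ b := by positivity
  have hqk : q ^ k ≤ 2 ^ k * M ^ k := by
    rw [← Nat.mul_pow]; exact Nat.pow_le_pow_left (by omega) k
  have hq2 : q * q ≤ q ^ k := by
    rw [← pow_two]; exact Nat.pow_le_pow_right (by omega) hk
  have hq1 : q ≤ q * q := Nat.le_mul_self q
  have hk2 : k + 1 ≤ 2 ^ k := Nat.lt_two_pow_self
  have h4 : 2 ^ k * 2 ^ k = 4 ^ k := by rw [← Nat.mul_pow]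
  have hbig : (2 * N + 1) * ((q ^ k + 1) * ((k + 1) * (k + 1))) ≤ W := by
    calc (2 * N + 1) * ((q ^ k + 1) * ((k + 1) * (k + 1)))
        -- One of the two factors `k + 1` is at most `2 * k` and yields the factor `k` of the bound;
        -- the other is at most `2 ^ k` and, together with `q ^ k ≤ 2 ^ k * M ^ k`, yields `4 ^ k`.
        ≤ (3 * N) * ((2 * (2 ^ k * M ^ k)) * ((2 * k) * 2 ^ k)) := by
          have : 1 ≤ q ^ k := Nat.one_le_pow _ _ (by omega)
          gcongr <;> omega
      _ = 12 * (N * k * (2 ^ k * 2 ^ k) * M ^ k) := by ring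
      _ ≤ W := by rw [h4, hW]; omega
  have hkk : 9 ≤ (k + 1) * (k + 1) := by nlinarith
  have hmid : (2 * N + 1) * ((q + 1) * (b + 1)) ≤ W := by
    -- The cost of building option tables is absorbed here through `q * q ≤ q ^ k`, which uses `k ≥
    -- 2`.
    refine le_trans (Nat.mul_le_mul_left _ ?_) hbig
    calc (q + 1) * (b + 1) ≤ (2 * q) * q := Nat.mul_le_mul (by omega) (by omega)
      _ = 2 * (q * q) := by ring
      _ ≤ (q ^ k + 1) * 9 := by omega
      _ ≤ _ := Nat.mul_le_mul_left _ hkk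
  have hone : ∀ a c, 1 ≤ c → a ≤ a * c := fun a c h => Nat.le_mul_of_pos_right a h
  refine ⟨?_, ?_, ?_, hmid, hbig⟩
  · refine le_trans ?_ hmid
    exact (show N + 1 ≤ 2 * N + 1 by omega).trans (hone _ _ (Nat.mul_pos (by omega) (by omega)))
  · refine le_trans ?_ hmid
    rw [← Nat.mul_assoc]
    exact Nat.le_mul_of_pos_left _ (Nat.mul_pos (by omega) (by omega))
  · refine le_trans ?_ hbig
    calc (k + 1) * (q + 1) ≤ (k + 1) * (q ^ k + 1) := Nat.mul_le_mul_left _ (by omega)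
      _ ≤ (k + 1) * (q ^ k + 1) * ((2 * N + 1) * (k + 1)) :=
          hone _ _ (Nat.mul_pos (by omega) (by omega))
      _ = _ := by ring

-- In `n + N` the summand `n` pays for trying all users when `k = 1`, and `N` for the nodes of the
-- tree otherwise.
open Classical in
theorem exec_decideWSP {n k N : ℕ} (hn : 1 ≤ n) (hk : 1 ≤ k) {I : WSPInstance n k}
    {D : Digraph (Fin n)} (hD : IsReducedGraph D I.lt) {X : TreeDecomposition D (Fin N)}
    (P : X.Listing) {W : ℕ}
    (hW : W = 24 * ((n + N) * k * 4 ^ k * (X.width + 2 + 3 ^ (X.width + 1)) ^ k)) :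
    (exec (inputArrays I P) decideWSP .zero).reg rout = (if I.IsYes then 1 else 0) ∧
      TimeBound (inputArrays I P) decideWSP .zero (decideWSP.size * W) := by
  have hinp := encodes_inputArrays I P
  have hn0 : inputArrays I P 0 0 0 = n := rfl
  have hk0 : inputArrays I P 0 0 1 = k := rfl
  have hN0 : inputArrays I P 0 0 2 = N := rfl
  have hset : exec (inputArrays I P) (.set rk (.inp 0 0 1)) .zero = St.zero.setReg rk k := by
    simp [hk0]
  have hN : 1 ≤ N := X.isTree.1.nonempty.elim fun i => i.pos
  set M := X.width + 2 + 3 ^ (X.width + 1) with hM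
  have hM1 : 1 ≤ M ^ k := Nat.one_le_pow _ _ (by positivity)
  have hW1 : n + N ≤ W := by
    rw [hW, Nat.mul_assoc, Nat.mul_assoc]
    have : 1 ≤ k * (4 ^ k * M ^ k) := Nat.mul_pos hk (Nat.mul_pos (by positivity) hM1)
    have := Nat.le_mul_of_pos_right (n + N) this
    omega
  suffices H : (exec (inputArrays I P) (.ite (.eq rk 1) tryUsers dynamicProgram)
        (St.zero.setReg rk k)).reg rout = (if I.IsYes then 1 else 0) ∧
      TimeBound (inputArrays I P) (.ite (.eq rk 1) tryUsers dynamicProgram) (St.zero.setReg rk k)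
        ((Cmd.ite (.eq rk 1) tryUsers dynamicProgram).size * W) by
    rw [← hset] at H
    exact ⟨H.1, .block_cons (timeBound_set _ _ (by omega)) (.block_cons H.2 (.block_nil (by omega)))⟩
  have hite : ∀ T, T ≤ (tryUsers.size + dynamicProgram.size) * W →
      (Cn.eq rk 1).compile.cost + 1 + T ≤
        (Cmd.ite (.eq rk 1) tryUsers dynamicProgram).size * W := by
    intro T hT
    rw [Cmd.size, Nat.add_mul ((Cn.eq rk 1).compile.cost + 1)]
    exact add_le_add (Nat.le_mul_of_pos_right _ (by omega)) hT
  rcases hk.eq_or_lt with rfl | hk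
  · have hc : (Cn.eq rk 1).holds (inputArrays I P) (St.zero.setReg rk 1) := by simp
    refine ⟨?_, (TimeBound.ite (T := tryUsers.size * W) (fun _ => ?_)
      fun h => absurd hc h).mono (hite _ (Nat.mul_le_mul_right _ (Nat.le_add_right _ _)))⟩
    · rw [exec_ite, if_pos hc]
      exact I.exec_tryUsers hinp hn0 rfl
    · have h0 : 1 ≤ W := by omega
      refine .block_cons (timeBound_set _ _ h0) (.block_cons (timeBound_of_stable (by decide) _ ?_)
        (.block_nil h0))
      simp [tryUser, Cmd.weight, hn0]
      omega
  · have hc : ¬ (Cn.eq rk 1).holds (inputArrays I P) (St.zero.setReg rk k) := by simp; omega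
    have hb := sup_length_bagAt P
    set b := Finset.univ.sup fun i => (X.bag i).card with hb_def
    have hb1 : 1 ≤ b := one_le_sup_card_bag (X := X) hn
    -- Some bag is nonempty because there is a user, so the truncated subtraction in the width is
    -- exact.
    have hwidth : X.width + 1 = b := by
      have : X.width = b - 1 := rfl
      omega
    obtain ⟨w1, w2, w3, w4, w5⟩ := weight_bounds (b := b) (N := n + N) hk (by omega)
      (by rw [hM, ← hwidth]) rfl hW
    have hmono : 2 * N + 1 ≤ 2 * (n + N) + 1 := by omega
    obtain ⟨h1, h2⟩ := TreeDecomposition.exec_dynamicProgram hinp hD hN0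
      (fun i _ => listsBag_inputArrays I P i) hb (fun m hm => inputArrays_edges I P hm) rfl
      (by omega) w2 w3 ((Nat.mul_le_mul_right _ hmono).trans w4)
      ((Nat.mul_le_mul_right _ hmono).trans w5)
    refine ⟨?_, (TimeBound.ite (T := dynamicProgram.size * W) (fun h => absurd h hc)
      fun _ => h2).mono (hite _ (Nat.mul_le_mul_right _ (Nat.le_add_left _ _)))⟩
    rw [exec_ite, if_neg hc]
    exact h1

/-! ### The main theorem -/

theorem theorem1 :
    ∃ p : RAM.Program, ∀ c : ℕ, ∃ C : ℕ,
      ∀ (n k N : ℕ), 1 ≤ n → 1 ≤ k → N ≤ c * n →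
      ∀ (I : WSPInstance n k) (D : Digraph (Fin n)), IsReducedGraph D I.lt →
      ∀ (X : TreeDecomposition D (Fin N)) (P : X.Listing) (r : ℕ), X.width = r →
        ∃ (t : ℕ) (τ : RAM.State),
          RAM.Runs (inputArrays I P) p RAM.State.start t τ ∧
          (I.IsYes → τ.reg 0 = 1) ∧ (¬ I.IsYes → τ.reg 0 = 0) ∧
          t ≤ C * (n * k * 4 ^ k * (r + 2 + 3 ^ (r + 1)) ^ k) := by
  -- The factor `c + 1` comes from `n + N ≤ (c + 1) * n`, the factor 24 from `weight_bounds`, and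
  -- the size of the program from the timing of stable commands.
  refine ⟨decideWSP.compile, fun c => ⟨decideWSP.size * (24 * (c + 1)), ?_⟩⟩
  rintro n k N hn hk hN I D hD X P r rfl
  obtain ⟨h1, h2⟩ := exec_decideWSP hn hk hD P rfl
  obtain ⟨t, τ, h3, h4, h5⟩ := h2 _ represents_start
  have h6 : τ.reg 0 = _ := (h4.reg rout).trans h1
  refine ⟨t, τ, h3, fun h => by rw [h6, if_pos h], fun h => by rw [h6, if_neg h], h5.trans ?_⟩
  rw [Nat.mul_assoc decideWSP.size]
  refine Nat.mul_le_mul_left _ ?_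
  rw [Nat.mul_assoc 24]
  refine Nat.mul_le_mul_left _ ?_
  simp only [← Nat.mul_assoc]
  gcongr
  rw [Nat.add_mul]
  omega
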